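/- Let $A\in\mathbb Z^{d_a\times n}$, $B\in\mathbb Z^{d_b\times n}$ and $C\in\mathbb Z^{s\times n}$ be fixed integer matrices, and let $c_1,\ldots,c_s\in\mathbb Z^n$ be the rows of $C$. An instance consists of a number $N$ of blocks, vectors $b^{(0)}\in\mathbb Z^{d_b}$ and $b^{(i)}\in\mathbb Z^{d_a}$, $u^{(i)},c^{(i)}\in\mathbb Z^n$ for $i=1,\ldots,N$, and convex functions $f^{(i)}_j:\mathbb R\to\mathbb R$ ($i=1,\ldots,N$, $j=1,\ldots,s$) that map $\mathbb Z$ to $\mathbb Z$ and are given by evaluation oracles: queried on an integer $y$, the oracle for $f^{(i)}_j$ returns the integer $f^{(i)}_j(y)$. Its answering time is at least the binary length of the answer and is charged to the algorithm. The $N$-fold convex integer program is $$\min\left\{\sum_{i=1}^N\Big[\sum_{j=1}^s f^{(i)}_j\big(c_j^\intercal x^{(i)}\big)+{c^{(i)}}^\intercal x^{(i)}\Big]\;:\;\sum_{i=1}^N Bx^{(i)}=b^{(0)},\ Ax^{(i)}=b^{(i)},\ 0\le x^{(i)}\le u^{(i)},\ x^{(i)}\in\mathbb Z^n,\ i=1,\ldots,N\right\}.$$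 For an integer $y$, let $\langle y\rangle$ be its binary encoding length, and let $L$ be $N$ plus the sum of the binary encoding lengths of all entries of $b^{(0)},b^{(i)},u^{(i)},c^{(i)}$. Theorem. There is an algorithm, depending only on $A,B,C$ (a single program for a random access machine with logarithmic, that is bit, cost), such that for every polynomial $p$ there is a polynomial $q$ with the following property. For every instance and every integer $\ell\ge 0$ such that each oracle answers each query $y\in\mathbb Z$ in time at most $p(\langle y\rangle+\ell)$ (where $\ell$ may be taken to be the length of the data that specify the functions; $\ell=0$ is the case of oracles polynomial in the length of the query alone), the algorithm halts after time at most $q(L+\ell)$, and either outputs an optimal solution of the program or correctly reports that the program has no feasible solution. In particular, for fixed $A,B,C$ and polynomial time evaluation oracles, the problem is solvable in time polynomial in the encoding length of the input. -/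

import Mathlib

namespace NFold

/-! ### Machine model: random access machine programs with logarithmic cost and evaluation oracles

A program uses finitely many integer variables and finitely many unbounded integer arrays.
Every elementary operation is charged the binary lengths of the integers (operands, addresses,
results) that it handles, and an oracle call is charged the time that the oracle takes, so the
cost is a bit cost, polynomially equivalent to Turing machine time. -/

/-- Binary encoding length of an integer (one bit for the sign). -/
def intSize (z : ℤ) : ℕ := Nat.size z.natAbs + 1

/-- The memory: variables `var v` and arrays `arr a`, all holding arbitrary integers. -/
structure State where
  var : ℕ → ℤ
  arr : ℕ → ℤ → ℤ

/-- Arithmetic operations of the machine; `div` is floor division. -/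
inductive Op where
  | add | sub | mul | div

def Op.eval : Op → ℤ → ℤ → ℤ
  | .add, a, b => a + b
  | .sub, a, b => a - b
  | .mul, a, b => a * b
  | .div, a, b => Int.fdiv a b

/-- Expressions: constants, variables, array entries, arithmetic. -/
inductive Expr where
  | const (z : ℤ)
  | var (v : ℕ)
  | arr (a : ℕ) (i : Expr)
  | op (o : Op) (e₁ e₂ : Expr)

def Expr.eval (σ : State) : Expr → ℤ
  | .const z => z
  | .var v => σ.var v
  | .arr a i => σ.arr a (i.eval σ)
  | .op o e₁ e₂ => o.eval (e₁.eval σ) (e₂.eval σ)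

/-- Bit cost of evaluating an expression: the total length of all intermediate values. -/
def Expr.cost (σ : State) : Expr → ℕ
  | .const z => intSize z
  | .var v => intSize (σ.var v)
  | .arr a i => i.cost σ + intSize (σ.arr a (i.eval σ))
  | .op o e₁ e₂ => e₁.cost σ + e₂.cost σ + intSize (o.eval (e₁.eval σ) (e₂.eval σ))

/-- Programs. `store a i e` writes `e` to entry `i` of array `a`; `ite` and `loop` test whether
an expression is positive; `query v i j y` asks oracle `(i, j)` for its value at `y` and
writes the answer to variable `v`. -/
inductive Cmd where
  | skip
  | assign (v : ℕ) (e : Expr)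
  | store (a : ℕ) (i e : Expr)
  | query (v : ℕ) (i j y : Expr)
  | seq (c₁ c₂ : Cmd)
  | ite (e : Expr) (c₁ c₂ : Cmd)
  | loop (e : Expr) (c : Cmd)

/-- An oracle evaluating an integer function: its answers, and the time it takes on every query
(which is at least the length of the answer, since the answer has to be written). -/
structure EvalOracle where
  val : ℤ → ℤ
  time : ℤ → ℕ
  size_val_le : ∀ y, intSize (val y) ≤ time y

def State.setVar (σ : State) (v : ℕ) (z : ℤ) : State :=
  { σ with var := Function.update σ.var v z }

def State.setArr (σ : State) (a : ℕ) (i z : ℤ) : State :=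
  { σ with arr := Function.update σ.arr a (Function.update (σ.arr a) i z) }

/-- `Exec O c σ t τ`: with the oracles `O`, the program `c` started in `σ` halts in `τ`
after time `t`. Oracles are numbered from `(0, 0)`; a query with an invalid number, like a
loop that runs forever, has no execution. -/
inductive Exec {N s : ℕ} (O : Fin N → Fin s → EvalOracle) : Cmd → State → ℕ → State → Prop
  | skip (σ : State) : Exec O .skip σ 1 σ
  | assign (σ : State) (v : ℕ) (e : Expr) :
      Exec O (.assign v e) σ (e.cost σ + 1) (σ.setVar v (e.eval σ))
  | store (σ : State) (a : ℕ) (i e : Expr) :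
      Exec O (.store a i e) σ (i.cost σ + e.cost σ + 1) (σ.setArr a (i.eval σ) (e.eval σ))
  | query (σ : State) (v : ℕ) (ei ej ey : Expr) (i : Fin N) (j : Fin s)
      (hi : ei.eval σ = ((i : ℕ) : ℤ)) (hj : ej.eval σ = ((j : ℕ) : ℤ)) :
      Exec O (.query v ei ej ey) σ
        (ei.cost σ + ej.cost σ + ey.cost σ + (O i j).time (ey.eval σ) + 1)
        (σ.setVar v ((O i j).val (ey.eval σ)))
  | seq {c₁ c₂ : Cmd} {σ σ₁ σ₂ : State} {t₁ t₂ : ℕ}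
      (h₁ : Exec O c₁ σ t₁ σ₁) (h₂ : Exec O c₂ σ₁ t₂ σ₂) :
      Exec O (.seq c₁ c₂) σ (t₁ + t₂) σ₂
  | ite_pos {e : Expr} {c₁ c₂ : Cmd} {σ σ₁ : State} {t : ℕ}
      (he : 0 < e.eval σ) (h : Exec O c₁ σ t σ₁) :
      Exec O (.ite e c₁ c₂) σ (e.cost σ + t + 1) σ₁
  | ite_neg {e : Expr} {c₁ c₂ : Cmd} {σ σ₁ : State} {t : ℕ}
      (he : ¬ 0 < e.eval σ) (h : Exec O c₂ σ t σ₁) :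
      Exec O (.ite e c₁ c₂) σ (e.cost σ + t + 1) σ₁
  | loop_done {e : Expr} {c : Cmd} {σ : State} (he : ¬ 0 < e.eval σ) :
      Exec O (.loop e c) σ (e.cost σ + 1) σ
  | loop_step {e : Expr} {c : Cmd} {σ σ₁ σ₂ : State} {t₁ t₂ : ℕ}
      (he : 0 < e.eval σ) (h₁ : Exec O c σ t₁ σ₁) (h₂ : Exec O (.loop e c) σ₁ t₂ σ₂) :
      Exec O (.loop e c) σ (e.cost σ + t₁ + t₂ + 1) σ₂

/-! ### Convex `N`-fold integer programs -/

/-- The explicit part of the input: right-hand sides `b⁽⁰⁾`, `b⁽ⁱ⁾`, upper bounds `u⁽ⁱ⁾` and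
linear costs `c⁽ⁱ⁾`. -/
structure Data (da db n N : ℕ) where
  b₀ : Fin db → ℤ
  b : Fin N → Fin da → ℤ
  u : Fin N → Fin n → ℤ
  c : Fin N → Fin n → ℤ

variable {da db n s N : ℕ}

/-- Encoding length of the explicit input: `N` plus the binary lengths of all its integers. -/
def Data.length (D : Data da db n N) : ℕ :=
  N + ∑ k, intSize (D.b₀ k) + ∑ i, ∑ k, intSize (D.b i k)
    + ∑ i, ∑ k, intSize (D.u i k) + ∑ i, ∑ k, intSize (D.c i k)

/-- Row by row layout of a matrix in an array (entry `(i, k)` at position `i * r + k`),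
with zeros elsewhere. -/
def layout {m r : ℕ} (M : Fin m → Fin r → ℤ) (p : ℤ) : ℤ :=
  if h : 0 ≤ p ∧ p.toNat < m * r then
    M (finProdFinEquiv.symm ⟨p.toNat, h.2⟩).1 (finProdFinEquiv.symm ⟨p.toNat, h.2⟩).2
  else 0

theorem layout_apply {m r : ℕ} (M : Fin m → Fin r → ℤ) (i : Fin m) (k : Fin r) :
    layout M (((i : ℕ) : ℤ) * (r : ℤ) + ((k : ℕ) : ℤ)) = M i k := by
  have e : (((i : ℕ) : ℤ) * (r : ℤ) + ((k : ℕ) : ℤ)) = ((finProdFinEquiv (i, k) : ℕ) : ℤ) := by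
    simp only [finProdFinEquiv_apply_val]
    push_cast
    ring
  rw [e]
  have h : 0 ≤ ((finProdFinEquiv (i, k) : ℕ) : ℤ) ∧
      ((finProdFinEquiv (i, k) : ℕ) : ℤ).toNat < m * r := by
    refine ⟨Int.natCast_nonneg _, ?_⟩
    rw [Int.toNat_natCast]
    exact (finProdFinEquiv (i, k)).2
  rw [layout, dif_pos h]
  simp only [Int.toNat_natCast, Fin.eta, Equiv.symm_apply_apply]

/-- Initial memory: variable `0` holds `N`, arrays `0, 1, 2, 3` hold `b⁽⁰⁾, b, u, c`;
everything else is zero. -/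
def Data.init (D : Data da db n N) : State where
  var := fun v => if v = 0 then (N : ℤ) else 0
  arr := fun a => match a with
    | 0 => layout (m := 1) (fun _ => D.b₀)
    | 1 => layout D.b
    | 2 => layout D.u
    | 3 => layout D.c
    | _ => fun _ => 0

/-- Feasibility: `∑ᵢ B x⁽ⁱ⁾ = b⁽⁰⁾`, `A x⁽ⁱ⁾ = b⁽ⁱ⁾`, `0 ≤ x⁽ⁱ⁾ ≤ u⁽ⁱ⁾`. -/
def Data.Feasible (D : Data da db n N) (A : Matrix (Fin da) (Fin n) ℤ)
    (B : Matrix (Fin db) (Fin n) ℤ) (x : Fin N → Fin n → ℤ) : Prop :=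
  (∑ i, B.mulVec (x i) = D.b₀) ∧ (∀ i, A.mulVec (x i) = D.b i) ∧
    ∀ i, 0 ≤ x i ∧ x i ≤ D.u i

/-- The objective `∑ᵢ (∑ⱼ f⁽ⁱ⁾ⱼ(cⱼᵀ x⁽ⁱ⁾) + c⁽ⁱ⁾ᵀ x⁽ⁱ⁾)`, where `cⱼ` is row `j` of `C`. -/
def Data.objective (D : Data da db n N) (C : Matrix (Fin s) (Fin n) ℤ)
    (f : Fin N → Fin s → ℝ → ℝ) (x : Fin N → Fin n → ℤ) : ℝ :=
  ∑ i, (∑ j, f i j ((C.mulVec (x i) j : ℤ) : ℝ) + ((D.c i ⬝ᵥ x i : ℤ) : ℝ))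

/-- The vector stored row by row in array `4`. -/
def State.output (σ : State) (N n : ℕ) : Fin N → Fin n → ℤ :=
  fun i k => σ.arr 4 (((i : ℕ) : ℤ) * (n : ℤ) + ((k : ℕ) : ℤ))

/-- The final memory solves the problem: either variable `0` holds `1` and the output is an
optimal solution, or variable `0` holds `0` and there is no feasible solution. -/
def Data.SolvedBy (D : Data da db n N) (A : Matrix (Fin da) (Fin n) ℤ)
    (B : Matrix (Fin db) (Fin n) ℤ) (C : Matrix (Fin s) (Fin n) ℤ)
    (f : Fin N → Fin s → ℝ → ℝ) (σ : State) : Prop :=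
  (σ.var 0 = 1 ∧ D.Feasible A B (σ.output N n) ∧
      ∀ x, D.Feasible A B x → D.objective C f (σ.output N n) ≤ D.objective C f x) ∨
    (σ.var 0 = 0 ∧ ∀ x, ¬ D.Feasible A B x)

end NFold

/-! ### Bit lengths and a cost calculus for programs. -/

namespace NFold
open Finset

/-! Feasibility is folded into the objective. For an arbitrary integer vector `x`, let `P x`
(`Data.penalty`) be the sum of all `|x| + |u - x|` plus the absolute residuals of all equations.
Then `P x ≥ ∑ u`, with equality exactly at feasible vectors, and `P x` bounds every entry of `x`. It
therefore suffices to minimise `(P, objective)` lexicographically over all integer vectors, starting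
from `0`. Inside a box this is the order of one integer function `G = (2M+1) P + objective`. Vectors
with `G` at most `G 0` keep entries at most `W = P 0`.

Let `z` be a minimiser and `x` the current vector. Fix the signs of all entries of `z - x`, of its
images under `A` and `C` in every block, and of the sum of its images under `B`. The vectors with
these signs form a cone. Along it the arguments of all univariate convex terms move the same way, so
the increments of `G` at `x` are superadditive (`penalty_add_add_le`, `value_add_add_le`). The cone
is generated by vectors of ℓ₁-norm at most `g`, where `g` does not depend on `N`
(`exists_cone_generators`). Write `z - x` as a sum of generators; the nonzero ones have multiplicity
at most `2W`, because nothing cancels in a cone. Splitting multiplicities in binary gives at most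
`R` steps `2^j • m` with `m` in the ball of radius `g`. Hence the best single step closes at least
the fraction `1 / R` of the gap `G x - G z` (`gap_le`).

The ball has at most `(2Nn+1)^g` elements, so trying all steps is polynomial. A gap below `2^γ`
drops below `1`, hence to `0`, within `R * γ` rounds (`mul_pow_lt_pow`).

On the machine side, all numbers of a run have polynomial length (`setup_of_length`), so each
command costs a constant times a common unit, and loops multiply this unit by their number of rounds
(`Runs`). The program uses only `A`, `B`, `C` and `g`: it compares pairs by `lexExpr` and never
needs `M`, which depends on the oracle time bound. -/

theorem natAbs_fdiv_le (a b : ℤ) : (Int.fdiv a b).natAbs ≤ a.natAbs := by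
  have key : ∀ a b : ℤ, 0 < b → (Int.fdiv a b).natAbs ≤ a.natAbs := fun a b hb => by
    rw [Int.fdiv_eq_ediv_of_nonneg _ hb.le]
    exact Int.natAbs_ediv_le_natAbs a b
  rcases lt_trichotomy b 0 with hb | rfl | hb
  · have h := key (-a) (-b) (by omega)
    rwa [Int.neg_fdiv_neg, Int.natAbs_neg] at h
  · simp
  · exact key a b hb

theorem one_le_intSize (z : ℤ) : 1 ≤ intSize z := Nat.le_add_left _ _

theorem lt_two_pow_intSize (z : ℤ) : |z| < 2 ^ intSize z := by
  have h := Nat.lt_size_self z.natAbs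
  have h2 : z.natAbs < 2 ^ intSize z :=
    h.trans_le (Nat.pow_le_pow_right (by norm_num) (Nat.le_add_right _ _))
  rw [← Int.natCast_natAbs]
  exact_mod_cast h2

theorem intSize_le_of_lt_two_pow {z : ℤ} {k : ℕ} (h : |z| < 2 ^ k) : intSize z ≤ k + 1 := by
  refine Nat.add_le_add_right (Nat.size_le.2 ?_) 1
  rw [← Int.natCast_natAbs] at h
  exact_mod_cast h

theorem intSize_mul_le (a b : ℤ) : intSize (a * b) ≤ intSize a + intSize b := by
  have h : (a * b).natAbs.size ≤ a.natAbs.size + b.natAbs.size := by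
    rw [Nat.size_le, Int.natAbs_mul, pow_add]
    exact Nat.mul_lt_mul'' (Nat.lt_size_self _) (Nat.lt_size_self _)
  unfold intSize; omega

/-- A carry costs one bit, and this bit is paid by the second of the two sign bits on the right. -/
theorem intSize_add_le_of_natAbs_le {a b c : ℤ} (h : c.natAbs ≤ a.natAbs + b.natAbs) :
    intSize c ≤ intSize a + intSize b := by
  have h : c.natAbs.size ≤ a.natAbs.size + b.natAbs.size + 1 := by
    rw [Nat.size_le]
    have ha := Nat.lt_size_self a.natAbs
    have hb := Nat.lt_size_self b.natAbs
    have ha' : 2 ^ a.natAbs.size ≤ 2 ^ (a.natAbs.size + b.natAbs.size) :=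
      Nat.pow_le_pow_right (by norm_num) (by omega)
    have hb' : 2 ^ b.natAbs.size ≤ 2 ^ (a.natAbs.size + b.natAbs.size) :=
      Nat.pow_le_pow_right (by norm_num) (by omega)
    rw [pow_succ]
    omega
  unfold intSize; omega

theorem Op.intSize_eval_le (o : Op) (a b : ℤ) :
    intSize (o.eval a b) ≤ intSize a + intSize b := by
  cases o with
  | add => exact intSize_add_le_of_natAbs_le (Int.natAbs_add_le a b)
  | sub => exact intSize_add_le_of_natAbs_le (Int.natAbs_sub_le a b)
  | mul => exact intSize_mul_le a b
  | div =>
    exact (Nat.add_le_add_right (Nat.size_le_size (natAbs_fdiv_le a b)) 1).trans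
      (Nat.le_add_right _ _)

/-- A constant such that evaluating `e` in a memory with entries of length at most `S` costs
at most `e.wt * S`. -/
def Expr.wt : Expr → ℕ
  | .const z => intSize z
  | .var _ => 1
  | .arr _ i => i.wt + 1
  | .op _ e₁ e₂ => 2 * (e₁.wt + e₂.wt)

/-- Cost and length of the value are bounded together: an operation pays for both operands and again
for a result as long as both, which explains the factor `2` in `Expr.wt`. -/
theorem Expr.cost_le {σ : State} {S : ℕ} (hv : ∀ v, intSize (σ.var v) ≤ S)
    (ha : ∀ a i, intSize (σ.arr a i) ≤ S) (e : Expr) :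
    e.cost σ ≤ e.wt * S ∧ intSize (e.eval σ) ≤ e.wt * S := by
  have hS : 1 ≤ S := (one_le_intSize _).trans (hv 0)
  induction e with
  | const z =>
    have : intSize z ≤ intSize z * S := Nat.le_mul_of_pos_right _ hS
    exact ⟨this, this⟩
  | var v => simpa [Expr.cost, Expr.eval, Expr.wt] using hv v
  | arr a i ih =>
    have h := ha a (i.eval σ)
    simp only [Expr.cost, Expr.eval, Expr.wt, add_mul, one_mul]
    exact ⟨add_le_add ih.1 h, h.trans (Nat.le_add_left _ _)⟩
  | op o e₁ e₂ h₁ h₂ =>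
    have h := o.intSize_eval_le (e₁.eval σ) (e₂.eval σ)
    simp only [Expr.cost, Expr.eval, Expr.wt]
    constructor <;> nlinarith [h₁.1, h₁.2, h₂.1, h₂.2]

/-- Weight of a program: all the weights of its expressions plus a constant per command. -/
def Cmd.wt : Cmd → ℕ
  | .skip => 1
  | .assign _ e => e.wt + 1
  | .store _ i e => i.wt + e.wt + 1
  | .query _ i j y => i.wt + j.wt + y.wt + 2
  | .seq c₁ c₂ => c₁.wt + c₂.wt
  | .ite e c₁ c₂ => e.wt + c₁.wt + c₂.wt + 1
  | .loop e c => e.wt + c.wt + 1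

/-- The program `c` halts on `σ` after time at most `c.wt * H`, in a memory satisfying `P`. -/
def Runs {N s : ℕ} (O : Fin N → Fin s → EvalOracle) (H : ℕ) (c : Cmd) (σ : State)
    (P : State → Prop) : Prop :=
  ∃ t τ, Exec O c σ t τ ∧ t ≤ c.wt * H ∧ P τ

/-- All memory entries have binary length at most `S`. -/
def Sized (S : ℕ) (σ : State) : Prop :=
  (∀ v, intSize (σ.var v) ≤ S) ∧ ∀ a i, intSize (σ.arr a i) ≤ S

section Runs

variable {N s : ℕ} {O : Fin N → Fin s → EvalOracle} {H H' S : ℕ} {c c₁ c₂ : Cmd}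
  {σ : State} {P Q : State → Prop} {e : Expr}

theorem Sized.one_le (h : Sized S σ) : 1 ≤ S := (one_le_intSize _).trans (h.1 0)

theorem Sized.cost_le (h : Sized S σ) (hS : S ≤ H) (e : Expr) : e.cost σ ≤ e.wt * H :=
  (Expr.cost_le h.1 h.2 e).1.trans (Nat.mul_le_mul_left _ hS)

theorem Runs.mono (h : Runs O H c σ P) (hH : H ≤ H') (hP : ∀ τ, P τ → Q τ) :
    Runs O H' c σ Q := by
  obtain ⟨t, τ, he, ht, hp⟩ := h
  exact ⟨t, τ, he, ht.trans (Nat.mul_le_mul_left _ hH), hP τ hp⟩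

/-- Weights add under composition, so both halves share the time unit `H` and only loops enlarge it.
-/
theorem Runs.seq (h₁ : Runs O H c₁ σ P) (h₂ : ∀ τ, P τ → Runs O H c₂ τ Q) :
    Runs O H (.seq c₁ c₂) σ Q := by
  obtain ⟨t, τ, he, ht, hp⟩ := h₁
  obtain ⟨t', τ', he', ht', hp'⟩ := h₂ τ hp
  refine ⟨_, _, .seq he he', ?_, hp'⟩
  rw [Cmd.wt, add_mul]
  exact add_le_add ht ht'

theorem Runs.skip (hS : 1 ≤ H) (hP : P σ) : Runs O H .skip σ P :=
  ⟨1, σ, .skip σ, by simpa [Cmd.wt] using hS, hP⟩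

theorem Runs.assign (h : Sized S σ) (hS : S ≤ H) {v : ℕ} (hP : P (σ.setVar v (e.eval σ))) :
    Runs O H (.assign v e) σ P := by
  refine ⟨_, _, .assign σ v e, ?_, hP⟩
  have := h.cost_le hS e
  have := h.one_le
  rw [Cmd.wt, add_mul]
  omega

theorem Runs.store (h : Sized S σ) (hS : S ≤ H) {a : ℕ} {i : Expr}
    (hP : P (σ.setArr a (i.eval σ) (e.eval σ))) :
    Runs O H (.store a i e) σ P := by
  refine ⟨_, _, .store σ a i e, ?_, hP⟩
  have := h.cost_le hS e
  have := h.cost_le hS i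
  have := h.one_le
  simp only [Cmd.wt, add_mul]
  omega

theorem Runs.query (h : Sized S σ) (hS : S ≤ H) {v : ℕ} {ei ej ey : Expr} (i : Fin N) (j : Fin s)
    (hi : ei.eval σ = ((i : ℕ) : ℤ)) (hj : ej.eval σ = ((j : ℕ) : ℤ))
    (ht : (O i j).time (ey.eval σ) ≤ S)
    (hP : P (σ.setVar v ((O i j).val (ey.eval σ)))) :
    Runs O H (.query v ei ej ey) σ P := by
  refine ⟨_, _, .query σ v ei ej ey i j hi hj, ?_, hP⟩
  have := h.cost_le hS ei
  have := h.cost_le hS ej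
  have := h.cost_le hS ey
  have := h.one_le
  simp only [Cmd.wt, add_mul]
  omega

theorem Runs.ite (h : Sized S σ) (hS : S ≤ H) (h₁ : 0 < e.eval σ → Runs O H c₁ σ P)
    (h₂ : ¬ 0 < e.eval σ → Runs O H c₂ σ P) : Runs O H (.ite e c₁ c₂) σ P := by
  have := h.cost_le hS e
  have := h.one_le
  by_cases he : 0 < e.eval σ
  · obtain ⟨t, τ, hx, ht, hp⟩ := h₁ he
    refine ⟨_, _, .ite_pos he hx, ?_, hp⟩
    simp only [Cmd.wt, add_mul]
    omega
  · obtain ⟨t, τ, hx, ht, hp⟩ := h₂ he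
    refine ⟨_, _, .ite_neg he hx, ?_, hp⟩
    simp only [Cmd.wt, add_mul]
    omega

/-- A loop with an invariant `I k`, where `k` bounds the number of rounds that remain. -/
theorem Runs.loop (I : ℕ → State → Prop) (hS : S ≤ H) (hI : ∀ k σ, I k σ → Sized S σ)
    (hd : ∀ k σ, I k σ → ¬ 0 < e.eval σ → P σ)
    (hs : ∀ k σ, I k σ → 0 < e.eval σ → ∃ k', k = k' + 1 ∧ Runs O H c σ (I k')) :
    ∀ k σ, I k σ → Runs O ((k + 1) * H) (.loop e c) σ P := by
  intro k
  induction k with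
  | zero =>
    intro σ h
    have h1 := (hI _ _ h).cost_le hS e
    have := (hI _ _ h).one_le
    by_cases he : 0 < e.eval σ
    · obtain ⟨k', hk, -⟩ := hs _ _ h he
      omega
    · refine ⟨_, _, .loop_done he, ?_, hd _ _ h he⟩
      simp only [Cmd.wt, add_mul, one_mul, zero_add]
      omega
  | succ k ih =>
    intro σ h
    have h1 := (hI _ _ h).cost_le hS e
    have h2 := (hI _ _ h).one_le
    by_cases he : 0 < e.eval σ
    · obtain ⟨k', hk, t, τ, hx, ht, hp⟩ := hs _ _ h he
      obtain rfl : k = k' := by omega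
      obtain ⟨t', τ', hx', ht', hp'⟩ := ih τ hp
      refine ⟨_, _, .loop_step he hx hx', ?_, hp'⟩
      simp only [Cmd.wt] at ht' ⊢
      nlinarith
    · refine ⟨_, _, .loop_done he, ?_, hd _ _ h he⟩
      simp only [Cmd.wt]
      have h3 : 1 * H ≤ (k + 1 + 1) * H := Nat.mul_le_mul_right _ (by omega)
      generalize (k + 1 + 1) * H = H' at *
      nlinarith

/-- Sequential composition of a finite family of programs. -/
def Cmd.seqFin : {k : ℕ} → (Fin k → Cmd) → Cmd
  | 0, _ => .skip
  | _ + 1, c => .seq (Cmd.seqFin fun j => c j.castSucc) (c (Fin.last _))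

theorem Runs.seqFin {k : ℕ} {c : Fin k → Cmd} (I : ℕ → State → Prop) (hH : 1 ≤ H)
    (hI : ∀ (j : Fin k) σ, I j σ → Runs O H (c j) σ (I (j + 1))) (h0 : I 0 σ) :
    Runs O H (Cmd.seqFin c) σ (I k) := by
  induction k with
  | zero => exact Runs.skip hH h0
  | succ k ih =>
    exact Runs.seq (ih fun j σ h => hI j.castSucc σ h) fun τ h => hI (Fin.last k) τ h

end Runs

/-- Sum of a finite family of expressions. -/
def Expr.sumFin : {k : ℕ} → (Fin k → Expr) → Expr
  | 0, _ => .const 0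
  | _ + 1, e => .op .add (Expr.sumFin fun j => e j.castSucc) (e (Fin.last _))

theorem Expr.eval_sumFin (σ : State) {k : ℕ} (e : Fin k → Expr) :
    (Expr.sumFin e).eval σ = ∑ j, (e j).eval σ := by
  induction k with
  | zero => rfl
  | succ k ih => rw [Fin.sum_univ_castSucc, ← ih]; rfl

/-- Absolute value: `⌊e / (e² + 1)⌋` is `-1` if `e < 0` and `0` otherwise. -/
def Expr.abs (e : Expr) : Expr :=
  .op .mul e (.op .add (.const 1) (.op .mul (.const 2)
    (.op .div e (.op .add (.op .mul e e) (.const 1)))))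

theorem Expr.eval_abs (σ : State) (e : Expr) : e.abs.eval σ = |e.eval σ| := by
  simp only [Expr.abs, Expr.eval, Op.eval]
  set z := e.eval σ
  have hp : 0 < z * z + 1 := by nlinarith [mul_self_nonneg z]
  rw [Int.fdiv_eq_ediv_of_nonneg _ hp.le]
  rcases le_or_gt 0 z with h | h
  · rw [Int.ediv_eq_zero_of_lt h (by nlinarith), abs_of_nonneg h]; ring
  · have : z / (z * z + 1) = -1 := by
      rw [Int.ediv_eq_iff_of_pos hp]
      constructor <;> nlinarith
    rw [this, abs_of_neg h]; ring

end NFold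

/-! ### Counting loops, partial sums and the evaluation of a vector. -/

namespace NFold
open Finset

/-- `J k` describes the memory after `k` completed rounds; the guard evaluates to the number of
rounds that remain. -/
theorem Runs.forUp {N s : ℕ} {O : Fin N → Fin s → EvalOracle} {H S : ℕ} {c : Cmd} {e : Expr}
    (J : ℕ → State → Prop) {L : ℕ} (hS : S ≤ H) (hJ : ∀ k σ, J k σ → Sized S σ)
    (he : ∀ k σ, J k σ → e.eval σ = (L : ℤ) - k)
    (hs : ∀ k < L, ∀ σ, J k σ → Runs O H c σ (J (k + 1))) (σ : State) (h0 : J 0 σ) :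
    Runs O ((L + 1) * H) (.loop e c) σ (J L) := by
  refine Runs.loop (fun k σ => ∃ m, m + k = L ∧ J m σ) hS (fun k σ ⟨m, _, h⟩ => hJ m σ h)
    ?_ ?_ L σ ⟨0, by simp, h0⟩
  · rintro k σ ⟨m, hm, h⟩ hn
    rw [he m σ h] at hn
    obtain rfl : m = L := by omega
    exact h
  · rintro k σ ⟨m, hm, h⟩ hp
    rw [he m σ h] at hp
    refine ⟨k - 1, by omega, (hs m (by omega) σ h).mono le_rfl fun τ hτ => ⟨m + 1, by omega, hτ⟩⟩

/-- Partial sums of a finite family. -/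
def psum {N : ℕ} (f : Fin N → ℤ) (c : ℕ) : ℤ := ∑ i ∈ range c, if h : i < N then f ⟨i, h⟩ else 0

section psum
variable {N : ℕ} (f : Fin N → ℤ)

theorem psum_zero : psum f 0 = 0 := rfl

theorem psum_succ (i : Fin N) : psum f (i + 1) = psum f i + f i := by
  rw [psum, sum_range_succ, dif_pos i.2]; rfl

theorem psum_all : psum f N = ∑ i, f i := (Finset.sum_range _).trans (by simp)

theorem abs_psum_le {Y : ℤ} (hY : 0 ≤ Y) (h : ∀ i, |f i| ≤ Y) (c : ℕ) : |psum f c| ≤ c * Y := by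
  refine (abs_sum_le_sum_abs _ _).trans ((sum_le_card_nsmul _ _ Y fun i _ => ?_).trans_eq ?_)
  · split_ifs
    · exact h _
    · simpa using hY
  · simp
end psum

/-- The blocks of a vector that is stored row by row in an array. -/
def view (N n : ℕ) (w : ℤ → ℤ) : Fin N → Fin n → ℤ :=
  fun i k => w (((i : ℕ) : ℤ) * (n : ℤ) + ((k : ℕ) : ℤ))

variable {da db n s N : ℕ}

/-- Contribution of block `i` to the penalty. -/
def Data.qblk (D : Data da db n N) (A : Matrix (Fin da) (Fin n) ℤ) (i : Fin N)
    (v : Fin n → ℤ) : ℤ :=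
  ∑ k, (|v k| + |D.u i k - v k|) + ∑ r, |A.mulVec v r - D.b i r|

/-- Contribution of block `i` to the objective. -/
def Data.fblk (D : Data da db n N) (C : Matrix (Fin s) (Fin n) ℤ)
    (O : Fin N → Fin s → EvalOracle) (i : Fin N) (v : Fin n → ℤ) : ℤ :=
  D.c i ⬝ᵥ v + ∑ j, (O i j).val (C.mulVec v j)

/-- The penalty of a vector: it is at least the sum of all upper bounds, with equality for
feasible vectors only. -/
def Data.penalty (D : Data da db n N) (A : Matrix (Fin da) (Fin n) ℤ)
    (B : Matrix (Fin db) (Fin n) ℤ) (x : Fin N → Fin n → ℤ) : ℤ :=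
  ∑ i, D.qblk A i (x i) + ∑ r, |∑ i, B.mulVec (x i) r - D.b₀ r|

/-- The objective, as an integer. -/
def Data.value (D : Data da db n N) (C : Matrix (Fin s) (Fin n) ℤ)
    (O : Fin N → Fin s → EvalOracle) (x : Fin N → Fin n → ℤ) : ℤ := ∑ i, D.fblk C O i (x i)

/-- The intermediate results of the evaluation at `x` are bounded by `Y`, and the oracle calls
take time at most `S`. -/
structure Data.Tame (D : Data da db n N) (A : Matrix (Fin da) (Fin n) ℤ)
    (B : Matrix (Fin db) (Fin n) ℤ) (C : Matrix (Fin s) (Fin n) ℤ)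
    (O : Fin N → Fin s → EvalOracle) (Y : ℤ) (S : ℕ) (x : Fin N → Fin n → ℤ) : Prop where
  q : ∀ i, |D.qblk A i (x i)| ≤ Y
  u : ∀ i, |∑ k, D.u i k| ≤ Y
  c : ∀ i, |D.c i ⬝ᵥ x i| ≤ Y
  val : ∀ i j, |(O i j).val (C.mulVec (x i) j)| ≤ Y
  time : ∀ i j, (O i j).time (C.mulVec (x i) j) ≤ S
  bx : ∀ i r, |B.mulVec (x i) r| ≤ Y
  b0 : ∀ r, |D.b₀ r| ≤ Y

/-- Memory invariant: all entries are bounded by `M`, and the input is intact. -/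
structure Ok (D : Data da db n N) (M : ℤ) (σ : State) : Prop where
  var_le : ∀ v, |σ.var v| ≤ M
  arr_le : ∀ a p, |σ.arr a p| ≤ M
  var_zero : σ.var 0 = N
  data : ∀ a < 4, σ.arr a = D.init.arr a

theorem Ok.sized {D : Data da db n N} {M : ℤ} {σ : State} {S : ℕ}
    (hS : ∀ z, |z| ≤ M → intSize z ≤ S) (h : Ok D M σ) : Sized S σ :=
  ⟨fun v => hS _ (h.var_le v), fun a p => hS _ (h.arr_le a p)⟩

theorem Ok.setVar {D : Data da db n N} {M : ℤ} {σ : State} (h : Ok D M σ) {v : ℕ} {z : ℤ}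
    (hv : v ≠ 0) (hz : |z| ≤ M) : Ok D M (σ.setVar v z) where
  var_le v' := by
    rcases eq_or_ne v' v with rfl | hne
    · simpa [State.setVar] using hz
    · simpa [State.setVar, hne] using h.var_le v'
  arr_le := h.arr_le
  var_zero := by simpa [State.setVar, hv.symm] using h.var_zero
  data := h.data

theorem Ok.setArr {D : Data da db n N} {M : ℤ} {σ : State} (h : Ok D M σ) {a : ℕ} {p z : ℤ}
    (ha : 4 ≤ a) (hz : |z| ≤ M) : Ok D M (σ.setArr a p z) where
  var_le := h.var_le
  arr_le a' p' := by
    rcases eq_or_ne a' a with rfl | hne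
    · rcases eq_or_ne p' p with rfl | hp
      · simpa [State.setArr] using hz
      · simpa [State.setArr, hp] using h.arr_le a' p'
    · simpa [State.setArr, hne] using h.arr_le a' p'
  var_zero := h.var_zero
  data a' h' := by
    have : a' ≠ a := by omega
    simpa [State.setArr, this] using h.data a' h'

@[simp] theorem State.setVar_arr (σ : State) (v : ℕ) (z : ℤ) : (σ.setVar v z).arr = σ.arr := rfl
@[simp] theorem State.setVar_var_self (σ : State) (v : ℕ) (z : ℤ) :
    (σ.setVar v z).var v = z := Function.update_self _ _ _
theorem State.setVar_var_of_ne (σ : State) {v v' : ℕ} (z : ℤ) (h : v' ≠ v) :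
    (σ.setVar v z).var v' = σ.var v' := Function.update_of_ne h _ _
@[simp] theorem State.setArr_var (σ : State) (a : ℕ) (p z : ℤ) :
    (σ.setArr a p z).var = σ.var := rfl
@[simp] theorem State.setArr_arr_self (σ : State) (a : ℕ) (p z : ℤ) :
    (σ.setArr a p z).arr a = Function.update (σ.arr a) p z := Function.update_self _ _ _
theorem State.setArr_arr_of_ne (σ : State) {a a' : ℕ} (p z : ℤ) (h : a' ≠ a) :
    (σ.setArr a p z).arr a' = σ.arr a' := Function.update_of_ne h _ _

/-! ### Evaluation of penalty and objective -/

/-- Entry `k` of block `i` of array `a` with rows of length `m`, for `i` in variable `9`. -/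
def blockEntry (a m k : ℕ) : Expr :=
  .arr a (.op .add (.op .mul (.var 9) (.const m)) (.const k))

/-- Linear form of the current block of array `4`. -/
def linExpr {n : ℕ} (row : Fin n → ℤ) : Expr :=
  .sumFin fun k : Fin n => .op .mul (.const (row k)) (blockEntry 4 n k)

def penaltyExpr (A : Matrix (Fin da) (Fin n) ℤ) : Expr :=
  .op .add
    (.sumFin fun k : Fin n => .op .add (blockEntry 4 n k).abs
      (Expr.op .sub (blockEntry 2 n k) (blockEntry 4 n k)).abs)
    (.sumFin fun r : Fin da => (Expr.op .sub (linExpr (A r)) (blockEntry 1 da r)).abs)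

def costExpr (n : ℕ) : Expr :=
  .sumFin fun k : Fin n => .op .mul (blockEntry 3 n k) (blockEntry 4 n k)

def upperExpr (n : ℕ) : Expr := .sumFin fun k : Fin n => blockEntry 2 n k

theorem eval_blockEntry {σ : State} {i : Fin N} (h : σ.var 9 = ((i : ℕ) : ℤ)) (a m k : ℕ) :
    (blockEntry a m k).eval σ = σ.arr a (((i : ℕ) : ℤ) * (m : ℤ) + (k : ℤ)) := by
  simp [blockEntry, Expr.eval, Op.eval, h]

theorem eval_linExpr {σ : State} {i : Fin N} (h : σ.var 9 = ((i : ℕ) : ℤ)) (row : Fin n → ℤ) :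
    (linExpr row).eval σ = row ⬝ᵥ view N n (σ.arr 4) i := by
  rw [linExpr, Expr.eval_sumFin]
  exact sum_congr rfl fun k _ => by
    rw [Expr.eval, eval_blockEntry h]; rfl

theorem eval_penaltyExpr {D : Data da db n N} {M : ℤ} {σ : State} (hσ : Ok D M σ)
    {i : Fin N} (h : σ.var 9 = ((i : ℕ) : ℤ)) (A : Matrix (Fin da) (Fin n) ℤ) :
    (penaltyExpr A).eval σ = D.qblk A i (view N n (σ.arr 4) i) := by
  have h1 : σ.arr 1 = layout D.b := hσ.data 1 (by norm_num)
  have h2 : σ.arr 2 = layout D.u := hσ.data 2 (by norm_num)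
  simp only [penaltyExpr, Expr.eval, Op.eval, Expr.eval_sumFin, Expr.eval_abs,
    eval_blockEntry h, eval_linExpr h, h1, h2, layout_apply]
  rfl

theorem eval_costExpr {D : Data da db n N} {M : ℤ} {σ : State} (hσ : Ok D M σ)
    {i : Fin N} (h : σ.var 9 = ((i : ℕ) : ℤ)) :
    (costExpr n).eval σ = D.c i ⬝ᵥ view N n (σ.arr 4) i := by
  have h3 : σ.arr 3 = layout D.c := hσ.data 3 (by norm_num)
  simp only [costExpr, Expr.eval, Op.eval, Expr.eval_sumFin, eval_blockEntry h, h3, layout_apply]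
  rfl

theorem eval_upperExpr {D : Data da db n N} {M : ℤ} {σ : State} (hσ : Ok D M σ)
    {i : Fin N} (h : σ.var 9 = ((i : ℕ) : ℤ)) :
    (upperExpr n).eval σ = ∑ k, D.u i k := by
  have h2 : σ.arr 2 = layout D.u := hσ.data 2 (by norm_num)
  simp only [upperExpr, Expr.eval_sumFin, eval_blockEntry h, h2, layout_apply]

/-- Roles of the variables below: `6`, `7`, `8` accumulate penalty, upper bounds and objective, `9`
is the current block, `10` the last oracle answer, `11` the signed residual of a linking row. -/
def incr (v : ℕ) (e : Expr) : Cmd := .assign v (.op .add (.var v) e)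

def queryCmd (C : Matrix (Fin s) (Fin n) ℤ) (j : Fin s) : Cmd :=
  .seq (.query 10 (.var 9) (.const ((j : ℕ) : ℤ)) (linExpr (C j))) (incr 8 (.var 10))

def blockCmd (A : Matrix (Fin da) (Fin n) ℤ) (C : Matrix (Fin s) (Fin n) ℤ) : Cmd :=
  .seq (incr 6 (penaltyExpr A)) <| .seq (incr 7 (upperExpr n)) <| .seq (incr 8 (costExpr n)) <|
    .seq (Cmd.seqFin (queryCmd C)) (incr 9 (.const 1))

/-- Loop over all blocks. -/
def forBlocks (c : Cmd) : Cmd :=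
  .seq (.assign 9 (.const 0)) (.loop (.op .sub (.var 0) (.var 9)) c)

def linkCmd (B : Matrix (Fin db) (Fin n) ℤ) (r : Fin db) : Cmd :=
  .seq (.assign 11 (.op .sub (.const 0) (.arr 0 (.const ((r : ℕ) : ℤ))))) <|
    .seq (forBlocks (.seq (incr 11 (linExpr (B r))) (incr 9 (.const 1)))) <|
      incr 6 (Expr.abs (.var 11))

/-- Evaluates array `4`: the penalty goes to variable `6`, the sum of the upper bounds to
variable `7`, the objective to variable `8`. -/
def evalCmd (A : Matrix (Fin da) (Fin n) ℤ) (B : Matrix (Fin db) (Fin n) ℤ)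
    (C : Matrix (Fin s) (Fin n) ℤ) : Cmd :=
  .seq (.assign 6 (.const 0)) <| .seq (.assign 7 (.const 0)) <| .seq (.assign 8 (.const 0)) <|
    .seq (forBlocks (blockCmd A C)) (Cmd.seqFin (linkCmd B))

/-- The memory differs from `σ₀` in the variables `6` to `11` only. -/
structure Local (D : Data da db n N) (M : ℤ) (σ₀ σ : State) : Prop where
  ok : Ok D M σ
  arr : σ.arr = σ₀.arr
  var : ∀ v, v < 6 ∨ 11 < v → σ.var v = σ₀.var v

theorem Local.setVar {D : Data da db n N} {M : ℤ} {σ₀ σ : State} (h : Local D M σ₀ σ) {v : ℕ}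
    {z : ℤ} (hv : 6 ≤ v) (hv' : v ≤ 11) (hz : |z| ≤ M) : Local D M σ₀ (σ.setVar v z) where
  ok := h.ok.setVar (by omega) hz
  arr := h.arr
  var v' hv'' := by rw [State.setVar_var_of_ne _ _ (by omega)]; exact h.var v' hv''

section Eval

variable {D : Data da db n N} {A : Matrix (Fin da) (Fin n) ℤ} {B : Matrix (Fin db) (Fin n) ℤ}
  {C : Matrix (Fin s) (Fin n) ℤ} {O : Fin N → Fin s → EvalOracle} {M Y : ℤ} {S : ℕ}
  {σ₀ : State}

/-- Accumulators are controlled by counting summands: each summand is at most `Y`, and `hM` says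
that as many summands as ever occur stay below `M`. A block contributes `s + 1` summands to variable
`8`, its linear cost and `s` oracle values. -/
theorem runs_queries (hS : ∀ z, |z| ≤ M → intSize z ≤ S)
    (ht : D.Tame A B C O Y S (view N n (σ₀.arr 4)))
    (hM : ∀ a : ℕ, a ≤ (N + 1) * (s + db + 4) → a * Y ≤ M) (hY : 0 ≤ Y)
    {σ : State} (hσ : Local D M σ₀ σ) {i : Fin N} (h9 : σ.var 9 = ((i : ℕ) : ℤ))
    (h8 : |σ.var 8| ≤ ((i * (s + 1) + 1 : ℕ) : ℤ) * Y) :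
    Runs O S (Cmd.seqFin (queryCmd C)) σ fun τ => Local D M σ₀ τ ∧ τ.var 9 = σ.var 9 ∧
      τ.var 6 = σ.var 6 ∧ τ.var 7 = σ.var 7 ∧
      τ.var 8 = σ.var 8 + ∑ j, (O i j).val (C.mulVec (view N n (σ₀.arr 4) i) j) := by
  set f : Fin s → ℤ := fun j => (O i j).val (C.mulVec (view N n (σ₀.arr 4) i) j) with hf
  rw [← psum_all f]
  refine Runs.seqFin (fun m τ => Local D M σ₀ τ ∧ τ.var 9 = σ.var 9 ∧
      τ.var 6 = σ.var 6 ∧ τ.var 7 = σ.var 7 ∧ τ.var 8 = σ.var 8 + psum f m)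
    (hσ.ok.sized hS).one_le ?_ ⟨hσ, rfl, rfl, rfl, by simp [psum_zero]⟩
  rintro j τ ⟨hl, e9, e6, e7, e8⟩
  have hv : |f j| ≤ Y := ht.val i j
  have hi9 : τ.var 9 = ((i : ℕ) : ℤ) := e9.trans h9
  have hlin : (linExpr (C j)).eval τ = C.mulVec (view N n (σ₀.arr 4) i) j := by
    rw [eval_linExpr hi9, hl.arr]; rfl
  have h1 : |f j| ≤ M := hv.trans (by simpa using hM 1 (by nlinarith))
  refine Runs.seq (P := fun ρ => ρ = τ.setVar 10 (f j)) ?_ ?_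
  · exact Runs.query (hl.ok.sized hS) le_rfl i j hi9 rfl (by rw [hlin]; exact ht.time i j)
      (by rw [hlin])
  · rintro ρ rfl
    have hl' := hl.setVar (v := 10) (by norm_num) (by norm_num) h1
    refine Runs.assign (hl'.ok.sized hS) le_rfl ?_
    simp only [Expr.eval, Op.eval, State.setVar_var_self]
    rw [State.setVar_var_of_ne _ _ (by norm_num), e8, add_assoc, ← psum_succ]
    have hb : |σ.var 8 + psum f (j + 1)| ≤ M := by
      have := abs_psum_le f hY (fun j => ht.val i j) (j + 1)
      have h2 := hM (i * (s + 1) + 1 + (j + 1)) (by nlinarith [i.2, j.2])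
      push_cast at h2 h8 this ⊢
      exact (abs_add_le _ _).trans (by linarith)
    refine ⟨hl'.setVar (by norm_num) (by norm_num) hb, ?_, ?_, ?_, by simp⟩ <;>
    · rw [State.setVar_var_of_ne _ _ (by norm_num), State.setVar_var_of_ne _ _ (by norm_num)]
      assumption

theorem runs_forBlocks {c : Cmd} (hS : ∀ z, |z| ≤ M → intSize z ≤ S) (hN : (N : ℤ) ≤ M)
    (J : ℕ → State → Prop)
    {σ : State} (hσ : Local D M σ₀ σ) (h0 : J 0 (σ.setVar 9 0))
    (hs : ∀ (i : Fin N) τ, Local D M σ₀ τ → τ.var 9 = ((i : ℕ) : ℤ) → J i τ →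
      Runs O S c τ fun τ => Local D M σ₀ τ ∧ τ.var 9 = ((i : ℕ) : ℤ) + 1 ∧ J (i + 1) τ) :
    Runs O ((N + 1) * S) (forBlocks c) σ fun τ => Local D M σ₀ τ ∧ J N τ := by
  have hSH : S ≤ (N + 1) * S := Nat.le_mul_of_pos_left _ (Nat.succ_pos _)
  refine Runs.seq (P := fun ρ => ρ = σ.setVar 9 0) ?_ ?_
  · exact Runs.assign (hσ.ok.sized hS) hSH rfl
  · rintro ρ rfl
    refine (Runs.forUp (O := O) (S := S)
      (fun c τ => Local D M σ₀ τ ∧ τ.var 9 = (c : ℤ) ∧ J c τ) le_rfl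
      (fun c τ h => h.1.ok.sized hS) ?_ ?_ _ ⟨?_, ?_, h0⟩).mono le_rfl fun τ h => ⟨h.1, h.2.2⟩
    · rintro k τ ⟨hl, h9, -⟩
      simp [Expr.eval, Op.eval, h9, hl.ok.var_zero]
    · rintro k hk τ ⟨hl, h9, hJ⟩
      simpa using hs ⟨k, hk⟩ τ hl h9 hJ
    · refine hσ.setVar (by norm_num) (by norm_num) (by simp; omega)
    · simp

theorem runs_block (hS : ∀ z, |z| ≤ M → intSize z ≤ S)
    (ht : D.Tame A B C O Y S (view N n (σ₀.arr 4)))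
    (hM : ∀ a : ℕ, a ≤ (N + 1) * (s + db + 4) → a * Y ≤ M) (hY : 1 ≤ Y)
    (i : Fin N) (τ : State) (hl : Local D M σ₀ τ) (h9 : τ.var 9 = ((i : ℕ) : ℤ))
    (h6 : τ.var 6 = psum (fun i => D.qblk A i (view N n (σ₀.arr 4) i)) i)
    (h7 : τ.var 7 = psum (fun i => ∑ k, D.u i k) i)
    (h8 : τ.var 8 = psum (fun i => D.fblk C O i (view N n (σ₀.arr 4) i)) i) :
    Runs O S (blockCmd A C) τ fun τ => Local D M σ₀ τ ∧ τ.var 9 = ((i : ℕ) : ℤ) + 1 ∧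
      τ.var 6 = psum (fun i => D.qblk A i (view N n (σ₀.arr 4) i)) (i + 1) ∧
      τ.var 7 = psum (fun i => ∑ k, D.u i k) (i + 1) ∧
      τ.var 8 = psum (fun i => D.fblk C O i (view N n (σ₀.arr 4) i)) (i + 1) := by
  have hY0 : 0 ≤ Y := by omega
  have hi := i.2
  have b6 := abs_psum_le (fun i => D.qblk A i (view N n (σ₀.arr 4) i)) hY0 ht.q (i + 1)
  have b7 := abs_psum_le (fun i => ∑ k, D.u i k) hY0 ht.u (i + 1)
  have hf : ∀ i, |D.fblk C O i (view N n (σ₀.arr 4) i)| ≤ ((s + 1 : ℕ) : ℤ) * Y := fun i => by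
    have h1 := ht.c i
    have h2 : |∑ j, (O i j).val (C.mulVec (view N n (σ₀.arr 4) i) j)| ≤ s * Y := by
      refine (abs_sum_le_sum_abs _ _).trans ((sum_le_card_nsmul _ _ Y fun j _ => ht.val i j).trans_eq
        (by simp))
    refine (abs_add_le _ _).trans ?_
    push_cast
    linarith
  have b8 := abs_psum_le (fun i => D.fblk C O i (view N n (σ₀.arr 4) i)) (by positivity) hf i
  have hM1 := hM (i + 1) (by nlinarith)
  have hM2 := hM (i * (s + 1) + 1) (by nlinarith)
  have hw : ∀ {ρ : State}, Local D M σ₀ ρ → view N n (ρ.arr 4) = view N n (σ₀.arr 4) :=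
    fun h => by rw [h.arr]
  refine Runs.seq (P := fun ρ => ρ = τ.setVar 6
    (psum (fun i => D.qblk A i (view N n (σ₀.arr 4) i)) (i + 1))) ?_ ?_
  · refine Runs.assign (hl.ok.sized hS) le_rfl ?_
    simp only [Expr.eval, Op.eval]
    rw [eval_penaltyExpr hl.ok h9, h6, psum_succ, hw hl]
  rintro ρ rfl
  have hl := hl.setVar (v := 6) (by norm_num) (by norm_num) (b6.trans hM1)
  rw [← State.setVar_var_of_ne τ (v := 6)
    (psum (fun i => D.qblk A i (view N n (σ₀.arr 4) i)) (i + 1)) (by norm_num)] at h7 h8 h9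
  have e6 := State.setVar_var_self τ 6 (psum (fun i => D.qblk A i (view N n (σ₀.arr 4) i)) (i + 1))
  generalize τ.setVar 6 (psum (fun i => D.qblk A i (view N n (σ₀.arr 4) i)) (i + 1)) = τ at *
  refine Runs.seq (P := fun ρ => ρ = τ.setVar 7 (psum (fun i => ∑ k, D.u i k) (i + 1))) ?_ ?_
  · refine Runs.assign (hl.ok.sized hS) le_rfl ?_
    simp only [Expr.eval, Op.eval]
    rw [eval_upperExpr hl.ok h9, h7, psum_succ]
  rintro ρ rfl
  have hl := hl.setVar (v := 7) (by norm_num) (by norm_num) (b7.trans hM1)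
  rw [← State.setVar_var_of_ne τ (v := 7) (psum (fun i => ∑ k, D.u i k) (i + 1))
    (by norm_num)] at e6 h8 h9
  have e7 := State.setVar_var_self τ 7 (psum (fun i => ∑ k, D.u i k) (i + 1))
  generalize τ.setVar 7 (psum (fun i => ∑ k, D.u i k) (i + 1)) = τ at *
  set y := psum (fun i => D.fblk C O i (view N n (σ₀.arr 4) i)) i +
    D.c i ⬝ᵥ view N n (σ₀.arr 4) i with hy
  have by8 : |y| ≤ ((i * (s + 1) + 1 : ℕ) : ℤ) * Y := by
    have := ht.c i
    refine (abs_add_le _ _).trans ?_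
    push_cast at b8 ⊢
    linarith
  refine Runs.seq (P := fun ρ => ρ = τ.setVar 8 y) ?_ ?_
  · refine Runs.assign (hl.ok.sized hS) le_rfl ?_
    simp only [Expr.eval, Op.eval]
    rw [eval_costExpr hl.ok h9, h8, hw hl]
  rintro ρ rfl
  have hl := hl.setVar (v := 8) (by norm_num) (by norm_num) (by8.trans hM2)
  rw [← State.setVar_var_of_ne τ (v := 8) y (by norm_num)] at e6 e7 h9
  have e8 := State.setVar_var_self τ 8 y
  generalize τ.setVar 8 y = τ at *
  refine Runs.seq (runs_queries hS ht hM hY0 hl h9 (by rwa [e8])) ?_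
  rintro ρ ⟨hl, g9, g6, g7, g8⟩
  refine Runs.assign (hl.ok.sized hS) le_rfl ?_
  simp only [Expr.eval, Op.eval]
  rw [g9, h9]
  refine ⟨hl.setVar (by norm_num) (by norm_num) ?_, by simp, ?_, ?_, ?_⟩
  · rw [abs_of_nonneg (by positivity)]
    push_cast at hM1
    nlinarith
  · rw [State.setVar_var_of_ne _ _ (by norm_num), g6, e6]
  · rw [State.setVar_var_of_ne _ _ (by norm_num), g7, e7]
  · rw [State.setVar_var_of_ne _ _ (by norm_num), g8, e8, psum_succ, hy, add_assoc]
    rfl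

/-- The linking residual couples all blocks, so the absolute value can be taken only after a
separate loop over the blocks for each row of `B`. -/
theorem runs_link (hS : ∀ z, |z| ≤ M → intSize z ≤ S)
    (ht : D.Tame A B C O Y S (view N n (σ₀.arr 4)))
    (hM : ∀ a : ℕ, a ≤ (N + 1) * (s + db + 4) → a * Y ≤ M) (hY : 1 ≤ Y)
    (r : Fin db) (τ : State) (hl : Local D M σ₀ τ)
    (h6 : |τ.var 6 + (|∑ i, B.mulVec (view N n (σ₀.arr 4) i) r - D.b₀ r|)| ≤ M) :
    Runs O ((N + 1) * S) (linkCmd B r) τ fun ρ => Local D M σ₀ ρ ∧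
      ρ.var 6 = τ.var 6 + |∑ i, B.mulVec (view N n (σ₀.arr 4) i) r - D.b₀ r| ∧
      ρ.var 7 = τ.var 7 ∧ ρ.var 8 = τ.var 8 := by
  have hY0 : 0 ≤ Y := by omega
  have hN : (N : ℤ) ≤ M := by
    have := hM N (by nlinarith)
    nlinarith
  have hSH : S ≤ (N + 1) * S := Nat.le_mul_of_pos_left _ (Nat.succ_pos _)
  have hbd : ∀ m : ℕ, m ≤ N →
      |(0 - D.b₀ r + psum (fun i => B.mulVec (view N n (σ₀.arr 4) i) r) m)| ≤ M := fun m hm => by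
    have h1 := abs_psum_le (fun i => B.mulVec (view N n (σ₀.arr 4) i) r) hY0 (fun i => ht.bx i r) m
    have h2 := ht.b0 r
    have h3 := hM (m + 1) (by nlinarith)
    refine (abs_add_le _ _).trans ?_
    rw [zero_sub, abs_neg]
    push_cast at h3
    linarith
  refine Runs.seq (P := fun ρ => ρ = τ.setVar 11 (0 - D.b₀ r)) ?_ ?_
  · refine Runs.assign (hl.ok.sized hS) hSH ?_
    simp only [Expr.eval, Op.eval]
    have h0 : τ.arr 0 = layout (m := 1) (fun _ => D.b₀) := hl.ok.data 0 (by norm_num)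
    have := layout_apply (m := 1) (fun _ => D.b₀) 0 r
    simp only [Fin.val_zero, Nat.cast_zero, zero_mul, zero_add] at this
    rw [h0, this]
  rintro ρ rfl
  have hl' := hl.setVar (v := 11) (z := 0 - D.b₀ r) (by norm_num) (by norm_num)
    (by simpa [psum_zero] using hbd 0 (Nat.zero_le _))
  refine Runs.seq (runs_forBlocks hS hN (fun m ρ => ρ.var 11 = 0 - D.b₀ r +
    psum (fun i => B.mulVec (view N n (σ₀.arr 4) i) r) m ∧ ρ.var 6 = τ.var 6 ∧
    ρ.var 7 = τ.var 7 ∧ ρ.var 8 = τ.var 8) hl' ?_ ?_) ?_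
  · simp [State.setVar, psum_zero]
  · rintro i ρ hρ h9 ⟨h11, e6, e7, e8⟩
    refine Runs.seq (P := fun ρ' => ρ' = ρ.setVar 11 (0 - D.b₀ r +
      psum (fun i => B.mulVec (view N n (σ₀.arr 4) i) r) (i + 1))) ?_ ?_
    · refine Runs.assign (hρ.ok.sized hS) le_rfl ?_
      simp only [Expr.eval, Op.eval]
      rw [eval_linExpr h9, h11, hρ.arr, psum_succ, ← add_assoc]
      rfl
    rintro ρ' rfl
    have hρ' := hρ.setVar (v := 11) (by norm_num) (by norm_num) (hbd (i + 1) i.2)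
    refine Runs.assign (hρ'.ok.sized hS) le_rfl ?_
    simp only [Expr.eval, Op.eval]
    rw [State.setVar_var_of_ne _ _ (by norm_num), h9]
    refine ⟨hρ'.setVar (by norm_num) (by norm_num) ?_, by simp, ?_⟩
    · rw [abs_of_nonneg (by positivity)]
      have := i.2
      omega
    · simp [State.setVar, e6, e7, e8]
  · rintro ρ ⟨hρ, h11, e6, e7, e8⟩
    refine Runs.assign (hρ.ok.sized hS) hSH ?_
    simp only [Expr.eval, Op.eval, Expr.eval_abs]
    rw [h11, e6, psum_all, zero_sub, neg_add_eq_sub]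
    exact ⟨hρ.setVar (by norm_num) (by norm_num) h6, by simp [State.setVar, e7, e8]⟩

theorem runs_eval (hS : ∀ z, |z| ≤ M → intSize z ≤ S) (hσ : Ok D M σ₀)
    (ht : D.Tame A B C O Y S (view N n (σ₀.arr 4)))
    (hM : ∀ a : ℕ, a ≤ (N + 1) * (s + db + 4) → a * Y ≤ M) (hY : 1 ≤ Y) :
    Runs O ((N + 1) * S) (evalCmd A B C) σ₀ fun τ => Local D M σ₀ τ ∧
      τ.var 6 = D.penalty A B (view N n (σ₀.arr 4)) ∧ τ.var 7 = ∑ i, ∑ k, D.u i k ∧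
      τ.var 8 = D.value C O (view N n (σ₀.arr 4)) := by
  have hY0 : 0 ≤ Y := by omega
  have hN : (N : ℤ) ≤ M := by
    have := hM N (by nlinarith)
    nlinarith
  have hM0 : |(0 : ℤ)| ≤ M := by simp; omega
  have hSH : S ≤ (N + 1) * S := Nat.le_mul_of_pos_left _ (Nat.succ_pos _)
  have hl : Local D M σ₀ σ₀ := ⟨hσ, rfl, fun _ _ => rfl⟩
  refine Runs.seq (P := fun ρ => ρ = σ₀.setVar 6 0) (Runs.assign (hl.ok.sized hS) hSH rfl) ?_
  rintro _ rfl
  have hl := hl.setVar (v := 6) (by norm_num) (by norm_num) hM0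
  refine Runs.seq (P := fun ρ => ρ = (σ₀.setVar 6 0).setVar 7 0)
    (Runs.assign (hl.ok.sized hS) hSH rfl) ?_
  rintro _ rfl
  have hl := hl.setVar (v := 7) (by norm_num) (by norm_num) hM0
  refine Runs.seq (P := fun ρ => ρ = ((σ₀.setVar 6 0).setVar 7 0).setVar 8 0)
    (Runs.assign (hl.ok.sized hS) hSH rfl) ?_
  rintro _ rfl
  have hl := hl.setVar (v := 8) (by norm_num) (by norm_num) hM0
  refine Runs.seq (runs_forBlocks hS hN (fun m τ =>
      τ.var 6 = psum (fun i => D.qblk A i (view N n (σ₀.arr 4) i)) m ∧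
      τ.var 7 = psum (fun i => ∑ k, D.u i k) m ∧
      τ.var 8 = psum (fun i => D.fblk C O i (view N n (σ₀.arr 4) i)) m) hl ?_
      fun i τ hτ h9 ⟨h6, h7, h8⟩ => runs_block hS ht hM hY i τ hτ h9 h6 h7 h8) ?_
  · simp [State.setVar, psum_zero]
  rintro τ ⟨hτ, h6, h7, h8⟩
  rw [psum_all] at h6 h7 h8
  set g : Fin db → ℤ := fun r => |∑ i, B.mulVec (view N n (σ₀.arr 4) i) r - D.b₀ r| with hg
  have hgb : ∀ r, |g r| ≤ ((N + 1 : ℕ) : ℤ) * Y := fun r => by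
    have h1 := abs_psum_le (fun i => B.mulVec (view N n (σ₀.arr 4) i) r) hY0 (fun i => ht.bx i r) N
    have h2 := ht.b0 r
    rw [psum_all] at h1
    rw [hg, abs_abs]
    refine (abs_sub _ _).trans ?_
    push_cast
    linarith
  have h6b := abs_psum_le (fun i => D.qblk A i (view N n (σ₀.arr 4) i)) hY0 ht.q N
  rw [psum_all, ← h6] at h6b
  refine (Runs.seqFin (fun m ρ => Local D M σ₀ ρ ∧ ρ.var 6 = τ.var 6 + psum g m ∧
    ρ.var 7 = τ.var 7 ∧ ρ.var 8 = τ.var 8) ((hτ.ok.sized hS).one_le.trans hSH) ?_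
    ⟨hτ, by simp [psum_zero], rfl, rfl⟩).mono le_rfl ?_
  · rintro r ρ ⟨hρ, e6, e7, e8⟩
    refine (runs_link hS ht hM hY r ρ hρ ?_).mono le_rfl ?_
    · rw [e6, add_assoc, ← psum_succ g r]
      have h1 := abs_psum_le g (by positivity) hgb (r + 1)
      -- `N` block penalties, and `r + 1` linking residuals of at most `N + 1` summands each.
      have h2 := hM (N + (r + 1) * (N + 1)) (by nlinarith [r.2])
      refine (abs_add_le _ _).trans ?_
      push_cast at h1 h2
      linarith
    · rintro ρ' ⟨hρ', f6, f7, f8⟩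
      exact ⟨hρ', by rw [f6, e6, psum_succ, add_assoc], f7.trans e7, f8.trans e8⟩
  · rintro ρ ⟨hρ, e6, e7, e8⟩
    refine ⟨hρ, ?_, e7.trans h7, e8.trans h8⟩
    rw [e6, h6, psum_all]
    rfl

end Eval

end NFold

/-! ### Enumeration of short moves. -/

namespace NFold
open Finset

variable {da db n s N : ℕ}

/-! ### Copying arrays -/

def copyCmd (n a b : ℕ) : Cmd :=
  .seq (.assign 13 (.op .mul (.var 0) (.const n))) <| .loop (.var 13) <|
    .seq (.assign 13 (.op .sub (.var 13) (.const 1))) (.store b (.var 13) (.arr a (.var 13)))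

theorem view_lt (i : Fin N) (k : Fin n) :
    0 ≤ ((i : ℕ) : ℤ) * (n : ℤ) + ((k : ℕ) : ℤ) ∧
      ((i : ℕ) : ℤ) * (n : ℤ) + ((k : ℕ) : ℤ) < ((N * n : ℕ) : ℤ) := by
  refine ⟨by positivity, ?_⟩
  have := i.2
  have := k.2
  have h : (i : ℕ) * n + k < N * n := by
    calc (i : ℕ) * n + k < i * n + n := by omega
      _ = (i + 1) * n := by ring
      _ ≤ N * n := Nat.mul_le_mul_right _ i.2
  exact_mod_cast h

theorem exists_view_index {p : ℕ} (hp : p < N * n) :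
    ∃ (i : Fin N) (k : Fin n), (p : ℤ) = ((i : ℕ) : ℤ) * (n : ℤ) + ((k : ℕ) : ℤ) := by
  refine ⟨(finProdFinEquiv.symm ⟨p, hp⟩).1, (finProdFinEquiv.symm ⟨p, hp⟩).2, ?_⟩
  have h : ((finProdFinEquiv (finProdFinEquiv.symm ⟨p, hp⟩) : Fin (N * n)) : ℕ) = p :=
    congrArg Fin.val (finProdFinEquiv.apply_symm_apply _)
  rw [finProdFinEquiv_apply_val] at h
  have h' := congrArg (Nat.cast (R := ℤ)) h
  push_cast at h'
  rw [← h']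
  ring

theorem view_index_inj {i i' : Fin N} {k k' : Fin n}
    (h : ((i : ℕ) : ℤ) * (n : ℤ) + ((k : ℕ) : ℤ) = ((i' : ℕ) : ℤ) * (n : ℤ) + ((k' : ℕ) : ℤ)) :
    i = i' ∧ k = k' := by
  have h' : finProdFinEquiv (i, k) = finProdFinEquiv (i', k') := by
    ext
    simp only [finProdFinEquiv_apply_val]
    zify
    linarith
  simpa using h'

section Copy

variable {D : Data da db n N} {O : Fin N → Fin s → EvalOracle} {M : ℤ} {S : ℕ} {σ : State}

/-- The index runs downwards, with the entries from `k` on already copied; since `a ≠ b`, the source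
is never overwritten. -/
theorem runs_copy (hS : ∀ z, |z| ≤ M → intSize z ≤ S) (hM : ((N * n : ℕ) : ℤ) ≤ M)
    (hσ : Ok D M σ) {a b : ℕ} (hb : 4 ≤ b) (hab : a ≠ b) :
    Runs O ((N * n + 1) * S) (copyCmd n a b) σ fun τ => Ok D M τ ∧
      (∀ v, v ≠ 13 → τ.var v = σ.var v) ∧ (∀ a', a' ≠ b → τ.arr a' = σ.arr a') ∧
      ∀ p, τ.arr b p = if 0 ≤ p ∧ p < ((N * n : ℕ) : ℤ) then σ.arr a p else σ.arr b p := by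
  have hSH : S ≤ (N * n + 1) * S := Nat.le_mul_of_pos_left _ (Nat.succ_pos _)
  refine Runs.seq (P := fun ρ => ρ = σ.setVar 13 ((N * n : ℕ) : ℤ)) ?_ ?_
  · refine Runs.assign (hσ.sized hS) hSH ?_
    simp [Expr.eval, Op.eval, hσ.var_zero]
  rintro _ rfl
  refine Runs.loop (S := S) (fun k τ => Ok D M τ ∧ k ≤ N * n ∧ τ.var 13 = (k : ℤ) ∧
      (∀ v, v ≠ 13 → τ.var v = σ.var v) ∧ (∀ a', a' ≠ b → τ.arr a' = σ.arr a') ∧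
      ∀ p, τ.arr b p = if (k : ℤ) ≤ p ∧ p < ((N * n : ℕ) : ℤ) then σ.arr a p else σ.arr b p)
    le_rfl (fun k τ h => h.1.sized hS) ?_ ?_ (N * n) _ ?_
  · rintro k τ ⟨h1, -, h3, h4, h5, h6⟩ hn
    simp only [Expr.eval, h3] at hn
    obtain rfl : k = 0 := by omega
    exact ⟨h1, h4, h5, by simpa using h6⟩
  · rintro k τ ⟨h1, h2, h3, h4, h5, h6⟩ hp
    simp only [Expr.eval, h3] at hp
    obtain ⟨k, rfl⟩ : ∃ k', k = k' + 1 := ⟨k - 1, by omega⟩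
    refine ⟨k, rfl, Runs.seq (P := fun ρ => ρ = τ.setVar 13 (k : ℤ)) ?_ ?_⟩
    · refine Runs.assign (h1.sized hS) le_rfl ?_
      simp [Expr.eval, Op.eval, h3]
    rintro _ rfl
    have hk := h1.setVar (v := 13) (z := (k : ℤ)) (by norm_num)
      (by rw [abs_of_nonneg (by positivity)]; omega)
    refine Runs.store (hk.sized hS) le_rfl ?_
    simp only [Expr.eval, State.setVar_var_self, State.setVar_arr]
    refine ⟨hk.setArr hb (h1.arr_le _ _), by omega, by simp, fun v hv => ?_, fun a' ha' => ?_,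
      fun p => ?_⟩
    · rw [State.setArr_var, State.setVar_var_of_ne _ _ hv, h4 v hv]
    · rw [State.setArr_arr_of_ne _ _ _ ha', State.setVar_arr, h5 a' ha']
    · rw [State.setArr_arr_self, State.setVar_arr, h5 a hab]
      rcases eq_or_ne p k with rfl | hne
      · rw [Function.update_self, if_pos ⟨le_rfl, by omega⟩]
      · rw [Function.update_of_ne hne, h6]
        have : ((k + 1 : ℕ) : ℤ) ≤ p ↔ (k : ℤ) ≤ p := by omega
        simp only [this]
  · refine ⟨hσ.setVar (by norm_num) (by rwa [abs_of_nonneg (by positivity)]), le_rfl, by simp,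
      fun v hv => by rw [State.setVar_var_of_ne _ _ hv], fun _ _ => rfl, fun p => ?_⟩
    rw [if_neg (by omega)]; rfl

theorem view_eq_of_copy {w w' w'' : ℤ → ℤ}
    (h : ∀ p, w'' p = if 0 ≤ p ∧ p < ((N * n : ℕ) : ℤ) then w p else w' p) :
    view N n w'' = view N n w := by
  funext i k
  rw [view, h, if_pos (view_lt i k)]; rfl

end Copy

/-! ### Moves of bounded norm -/

/-- The unit vector at coordinate `k` of block `i`. -/
def unitVec {N n : ℕ} (p : Fin N × Fin n) : Fin N → Fin n → ℤ := Pi.single p.1 (Pi.single p.2 1)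

/-- Sums of at most `d` positive or negative unit vectors. -/
def ball (N n : ℕ) : ℕ → Finset (Fin N → Fin n → ℤ)
  | 0 => {0}
  | d + 1 => ball N n d ∪ univ.biUnion fun p : Fin N × Fin n =>
      (ball N n d).image (· + unitVec p) ∪ (ball N n d).image (· - unitVec p)

/-- Each level keeps a vector or adds one of `2Nn` signed unit vectors. For fixed `d` this is
polynomial in `N`, which is what makes exhaustive search affordable. -/
theorem card_ball_le (N n d : ℕ) : (ball N n d).card ≤ (2 * (N * n) + 1) ^ d := by
  induction d with
  | zero => simp [ball]
  | succ d ih =>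
    have h : (univ.biUnion fun p : Fin N × Fin n =>
        (ball N n d).image (· + unitVec p) ∪ (ball N n d).image (· - unitVec p)).card
        ≤ (N * n) * (2 * (ball N n d).card) := by
      refine (card_biUnion_le_card_mul _ _ (2 * (ball N n d).card) fun p _ => ?_).trans_eq (by simp)
      refine (card_union_le _ _).trans ?_
      have h1 := card_image_le (s := ball N n d) (f := (· + unitVec p))
      have h2 := card_image_le (s := ball N n d) (f := (· - unitVec p))
      omega
    rw [pow_succ]
    calc _ ≤ (ball N n d).card + (N * n) * (2 * (ball N n d).card) :=
          (card_union_le _ _).trans (Nat.add_le_add_left h _)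
      _ = (ball N n d).card * (2 * (N * n) + 1) := by ring
      _ ≤ _ := Nat.mul_le_mul_right _ ih

/-- Moving a nonzero entry one unit towards zero lowers the ℓ₁-norm by one, so induction on `d`
applies. -/
theorem mem_ball_of_sum_le {d : ℕ} {m : Fin N → Fin n → ℤ} (h : ∑ i, ∑ k, |m i k| ≤ d) :
    m ∈ ball N n d := by
  induction d generalizing m with
  | zero =>
    have h0 : m = 0 := by
      have h1 : ∑ i, ∑ k, |m i k| = 0 :=
        le_antisymm h (sum_nonneg fun i _ => sum_nonneg fun k _ => abs_nonneg _)
      rw [sum_eq_zero_iff_of_nonneg fun i _ => sum_nonneg fun k _ => abs_nonneg _] at h1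
      funext i k
      have h2 := h1 i (mem_univ _)
      rw [sum_eq_zero_iff_of_nonneg fun k _ => abs_nonneg _] at h2
      exact abs_eq_zero.1 (h2 k (mem_univ _))
    simp [ball, h0]
  | succ d ih =>
    rw [ball, mem_union]
    by_cases h0 : ∀ i k, m i k = 0
    · left
      refine ih ?_
      simp [h0]
    · push Not at h0
      obtain ⟨i, k, hik⟩ := h0
      right
      have key : ∀ z : ℤ, |m i k - z| + 1 = |m i k| →
          m - z • unitVec (i, k) ∈ ball N n d := fun z hz => by
        refine ih ?_
        have e : ∑ i', ∑ k', |(m - z • unitVec (i, k)) i' k'| + 1 = ∑ i', ∑ k', |m i' k'| := by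
          rw [← Finset.add_sum_erase univ (fun i' => ∑ k', |m i' k'|) (mem_univ i),
            ← Finset.add_sum_erase univ (fun i' => ∑ k', |(m - z • unitVec (i, k)) i' k'|)
              (mem_univ i),
            ← Finset.add_sum_erase univ (fun k' => |m i k'|) (mem_univ k),
            ← Finset.add_sum_erase univ (fun k' => |(m - z • unitVec (i, k)) i k'|) (mem_univ k)]
          have e1 : ∑ i' ∈ univ.erase i, ∑ k', |(m - z • unitVec (i, k)) i' k'| =
              ∑ i' ∈ univ.erase i, ∑ k', |m i' k'| :=
            sum_congr rfl fun i' hi' => sum_congr rfl fun k' _ => by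
              simp [unitVec, Pi.single_eq_of_ne (ne_of_mem_erase hi')]
          have e2 : ∑ k' ∈ univ.erase k, |(m - z • unitVec (i, k)) i k'| =
              ∑ k' ∈ univ.erase k, |m i k'| :=
            sum_congr rfl fun k' hk' => by
              simp [unitVec, Pi.single_eq_of_ne (ne_of_mem_erase hk')]
          have e3 : (m - z • unitVec (i, k)) i k = m i k - z := by simp [unitVec]
          rw [e1, e2, e3]
          linarith
        push_cast at h
        linarith
      refine mem_biUnion.2 ⟨(i, k), mem_univ _, mem_union.2 ?_⟩
      rcases lt_or_gt_of_ne hik with hneg | hpos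
      · right
        refine mem_image.2 ⟨_, key (-1) ?_, by simp⟩
        rw [abs_of_neg hneg, abs_of_nonpos (by linarith)]
        ring
      · left
        refine mem_image.2 ⟨_, key 1 ?_, by simp⟩
        rw [abs_of_pos hpos, abs_of_nonneg (by linarith)]
        ring

theorem view_update (w : ℤ → ℤ) (i : Fin N) (k : Fin n) {p : ℤ} (z : ℤ)
    (hp : p = ((i : ℕ) : ℤ) * (n : ℤ) + ((k : ℕ) : ℤ)) :
    view N n (Function.update w p (w p + z)) = view N n w + z • unitVec (i, k) := by
  subst hp
  funext i' k'
  simp only [view, Pi.add_apply, Pi.smul_apply, unitVec, smul_eq_mul]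
  by_cases h : i' = i ∧ k' = k
  · obtain ⟨rfl, rfl⟩ := h
    simp
  · rw [Function.update_of_ne fun e => h (view_index_inj e)]
    rcases eq_or_ne i' i with rfl | hi
    · have hk : k' ≠ k := fun e => h ⟨rfl, e⟩
      simp [hk]
    · simp [hi]

/-! ### Search for the best move -/

/-- Positive if variables `6, 8` (a penalty and an objective) are lexicographically smaller than
variables `1, 2`. -/
def lexExpr : Expr :=
  .op .add (.op .mul (.op .sub (.var 1) (.var 6))
      (.op .add (Expr.abs (.op .sub (.var 2) (.var 8))) (.const 1)))
    (.op .sub (.var 2) (.var 8))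

section Search

variable (A : Matrix (Fin da) (Fin n) ℤ) (B : Matrix (Fin db) (Fin n) ℤ)
  (C : Matrix (Fin s) (Fin n) ℤ)

/-- Compares array `4` with the best vector so far, in array `5`. -/
def compareCmd : Cmd :=
  .seq (evalCmd A B C) <| .ite lexExpr
    (.seq (.assign 1 (.var 6)) <| .seq (.assign 2 (.var 8)) <| .seq (.assign 3 (.const 1)) <|
      copyCmd n 4 5) .skip

/-- Adds `e` to the entry of array `4` with index in variable `v`. -/
def bumpCmd (v : ℕ) (e : Expr) : Cmd := .store 4 (.var v) (.op .add (.arr 4 (.var v)) e)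

/-- Compares all vectors that differ from array `4` by a step times a move of norm at most `d`. -/
def searchCmd : ℕ → Cmd
  | 0 => compareCmd A B C
  | d + 1 => .seq (searchCmd d) <| .seq (.assign (20 + d) (.op .mul (.var 0) (.const n))) <|
      .loop (.var (20 + d)) <| .seq (.assign (20 + d) (.op .sub (.var (20 + d)) (.const 1))) <|
        .seq (bumpCmd (20 + d) (.var 4)) <| .seq (searchCmd d) <|
        .seq (bumpCmd (20 + d) (.op .mul (.const (-2)) (.var 4))) <| .seq (searchCmd d) <|
        bumpCmd (20 + d) (.var 4)

/-- Bounds that hold during the whole run: vectors with entries bounded by `X` are evaluated, all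
numbers are bounded by `M` and have length at most `S`. The order by `G` is the lexicographic order
by penalty and objective. -/
structure Setup (D : Data da db n N) (O : Fin N → Fin s → EvalOracle) (X Y M : ℤ) (S : ℕ)
    (G : (Fin N → Fin n → ℤ) → ℤ) : Prop where
  size : ∀ z, |z| ≤ M → intSize z ≤ S
  le : ∀ a : ℕ, a ≤ (N + 1) * (s + db + 4) → a * Y ≤ M
  one_le : 1 ≤ Y
  box_le : X ≤ M
  dim_le : ((N * n : ℕ) : ℤ) ≤ M
  tame : ∀ x : Fin N → Fin n → ℤ, (∀ i k, |x i k| ≤ X) → D.Tame A B C O Y S x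
  lex : ∀ x y : Fin N → Fin n → ℤ, (∀ i k, |x i k| ≤ X) → (∀ i k, |y i k| ≤ X) →
    (G y < G x ↔ 0 < (D.penalty A B x - D.penalty A B y) *
      (|D.value C O x - D.value C O y| + 1) + (D.value C O x - D.value C O y))

/-- Array `5` holds a vector with its values in variables `1` and `2`. -/
structure Best (D : Data da db n N) (O : Fin N → Fin s → EvalOracle) (X M : ℤ)
    (σ : State) : Prop where
  ok : Ok D M σ
  box : ∀ p, |σ.arr 5 p| ≤ X
  penalty : σ.var 1 = D.penalty A B (view N n (σ.arr 5))
  value : σ.var 2 = D.value C O (view N n (σ.arr 5))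

/-- The best vector has been compared with all vectors in `E`; variable `3` tells whether it
has changed. -/
structure Adv (D : Data da db n N) (O : Fin N → Fin s → EvalOracle) (X M : ℤ)
    (G : (Fin N → Fin n → ℤ) → ℤ) (σ τ : State) (E : Set (Fin N → Fin n → ℤ)) : Prop where
  best : Best A B C D O X M τ
  le : G (view N n (τ.arr 5)) ≤ G (view N n (σ.arr 5))
  all : ∀ x ∈ E, G (view N n (τ.arr 5)) ≤ G x
  go : (view N n (τ.arr 5) = view N n (σ.arr 5) ∧ τ.var 3 = σ.var 3) ∨
    (τ.var 3 = 1 ∧ G (view N n (τ.arr 5)) < G (view N n (σ.arr 5)))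

variable {A B C} {D : Data da db n N} {O : Fin N → Fin s → EvalOracle} {X Y M : ℤ} {S : ℕ}
  {G : (Fin N → Fin n → ℤ) → ℤ} {σ τ ρ : State} {E E' : Set (Fin N → Fin n → ℤ)}

theorem Adv.trans (h : Adv A B C D O X M G σ τ E) (h' : Adv A B C D O X M G τ ρ E') :
    Adv A B C D O X M G σ ρ (E ∪ E') where
  best := h'.best
  le := h'.le.trans h.le
  all := by
    rintro x (hx | hx)
    · exact h'.le.trans (h.all x hx)
    · exact h'.all x hx
  go := by
    rcases h'.go with ⟨h1, h2⟩ | ⟨h1, h2⟩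
    · rw [h1, h2]; exact h.go
    · exact Or.inr ⟨h1, h2.trans_le h.le⟩

theorem Adv.mono (h : Adv A B C D O X M G σ τ E) (hE : E' ⊆ E) : Adv A B C D O X M G σ τ E' :=
  ⟨h.best, h.le, fun x hx => h.all x (hE hx), h.go⟩

/-- Bookkeeping commands that leave the best vector and variables `1`, `2`, `3` alone count as
progress over the empty set. -/
theorem Best.adv (h : Best A B C D O X M σ) (hτ : Ok D M τ) (h5 : τ.arr 5 = σ.arr 5)
    (hv : ∀ v, v = 1 ∨ v = 2 ∨ v = 3 → τ.var v = σ.var v) : Adv A B C D O X M G σ τ ∅ where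
  best := ⟨hτ, by rw [h5]; exact h.box, by rw [hv 1 (by simp), h5, h.penalty],
    by rw [hv 2 (by simp), h5, h.value]⟩
  le := by rw [h5]
  all x hx := hx.elim
  go := Or.inl ⟨by rw [h5], hv 3 (by simp)⟩

theorem eval_lexExpr (σ : State) : lexExpr.eval σ =
    (σ.var 1 - σ.var 6) * (|σ.var 2 - σ.var 8| + 1) + (σ.var 2 - σ.var 8) := by
  simp [lexExpr, Expr.eval, Op.eval, Expr.eval_abs]

theorem runs_compare (hs : Setup A B C D O X Y M S G) (hσ : Best A B C D O X M σ)
    (hX : ∀ p, |σ.arr 4 p| ≤ X) :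
    Runs O ((N * n + N + 1) * S) (compareCmd A B C) σ fun τ =>
      Adv A B C D O X M G σ τ {view N n (σ.arr 4)} ∧ τ.arr 4 = σ.arr 4 ∧
      ∀ v, v = 4 ∨ v = 5 ∨ 20 ≤ v → τ.var v = σ.var v := by
  have h1 : (N + 1) * S ≤ (N * n + N + 1) * S := Nat.mul_le_mul_right _ (by omega)
  have h2 : (N * n + 1) * S ≤ (N * n + N + 1) * S := Nat.mul_le_mul_right _ (by omega)
  have h3 : S ≤ (N * n + N + 1) * S := Nat.le_mul_of_pos_left _ (Nat.succ_pos _)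
  refine Runs.seq ((runs_eval hs.size hσ.ok (hs.tame _ fun i k => hX _) hs.le hs.one_le).mono h1
    fun _ => id) ?_
  rintro τ ⟨hτ, e6, e7, e8⟩
  have hlex := hs.lex (view N n (σ.arr 5)) (view N n (σ.arr 4)) (fun i k => hσ.box _)
    (fun i k => hX _)
  rw [← hσ.penalty, ← hσ.value, ← e6, ← e8, ← hτ.var 1 (by norm_num), ← hτ.var 2 (by norm_num),
    ← eval_lexExpr] at hlex
  refine Runs.ite (hτ.ok.sized hs.size) h3 (fun hpos => ?_) fun hneg => ?_
  · have hτ1 := hτ.ok.setVar (v := 1) (z := τ.var 6) (by norm_num) (hτ.ok.var_le _)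
    have hτ2 := hτ1.setVar (v := 2) (z := τ.var 8) (by norm_num) (hτ.ok.var_le _)
    have hτ3 := hτ2.setVar (v := 3) (z := 1) (by norm_num)
      (by simpa using (by simpa using hs.le 1 (by nlinarith) : Y ≤ M).trans' hs.one_le)
    refine Runs.seq (P := fun ρ => ρ = τ.setVar 1 (τ.var 6))
      (Runs.assign (hτ.ok.sized hs.size) h3 rfl) ?_
    rintro _ rfl
    refine Runs.seq (P := fun ρ => ρ = (τ.setVar 1 (τ.var 6)).setVar 2 (τ.var 8))
      (Runs.assign (hτ1.sized hs.size) h3 rfl) ?_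
    rintro _ rfl
    refine Runs.seq (P := fun ρ => ρ = ((τ.setVar 1 (τ.var 6)).setVar 2 (τ.var 8)).setVar 3 1)
      (Runs.assign (hτ2.sized hs.size) h3 rfl) ?_
    rintro _ rfl
    refine (runs_copy hs.size hs.dim_le hτ3 (by norm_num) (by norm_num)).mono h2 ?_
    rintro ρ ⟨hρ, hv, ha, h5⟩
    have hview := view_eq_of_copy h5
    simp only [State.setVar_arr, hτ.arr] at hview
    have v3 : ρ.var 3 = 1 := by rw [hv 3 (by norm_num)]; simp
    refine ⟨⟨⟨hρ, fun p => ?_, ?_, ?_⟩, ?_, ?_, ?_⟩, ?_, ?_⟩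
    · rw [h5]
      simp only [State.setVar_arr, hτ.arr]
      split_ifs
      · exact hX p
      · exact hσ.box p
    · rw [hv 1 (by norm_num), hview, ← e6]; simp [State.setVar]
    · rw [hv 2 (by norm_num), hview, ← e8]; simp [State.setVar]
    · rw [hview]; exact (hlex.2 hpos).le
    · rintro x rfl; rw [hview]
    · rw [hview]; exact Or.inr ⟨v3, hlex.2 hpos⟩
    · rw [ha 4 (by norm_num)]; exact congrFun hτ.arr 4
    · intro v h
      rw [hv v (by omega), State.setVar_var_of_ne _ _ (by omega),
        State.setVar_var_of_ne _ _ (by omega), State.setVar_var_of_ne _ _ (by omega),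
        hτ.var v (by omega)]
  · refine Runs.skip ((hτ.ok.sized hs.size).one_le.trans h3) ?_
    have ha := hσ.adv (G := G) hτ.ok (congrFun hτ.arr 5) (fun v hv => hτ.var v (by omega))
    refine ⟨⟨ha.best, ha.le, ?_, ha.go⟩, congrFun hτ.arr 4, fun v hv => hτ.var v (by omega)⟩
    rintro x rfl
    rw [hτ.arr]
    exact not_lt.1 fun h => hneg (hlex.1 h)

/-- The vectors that are compared with `x` in a search with given step length. -/
def targets (N n d : ℕ) (x : Fin N → Fin n → ℤ) (z : ℤ) : Set (Fin N → Fin n → ℤ) :=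
  {y | ∃ m ∈ ball N n d, y = x + z • m}

theorem runs_bump (hs : Setup A B C D O X Y M S G) (hσ : Best A B C D O X M σ) {v : ℕ} {e : Expr}
    {p z : ℤ} (hp : σ.var v = p) (hz : e.eval σ = z) (hb : |σ.arr 4 p + z| ≤ X) {H : ℕ}
    (hH : S ≤ H) :
    Runs O H (bumpCmd v e) σ fun τ => Adv A B C D O X M G σ τ ∅ ∧ τ.var = σ.var ∧
      τ.arr 4 = Function.update (σ.arr 4) p (σ.arr 4 p + z) := by
  refine Runs.store (hσ.ok.sized hs.size) hH ?_
  simp only [Expr.eval, Op.eval, hz, hp]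
  have h := hσ.ok.setArr (a := 4) (p := p) (z := σ.arr 4 p + z) le_rfl (hb.trans hs.box_le)
  exact ⟨hσ.adv h (State.setArr_arr_of_ne _ _ _ (by norm_num)) fun _ _ => rfl, rfl, by simp⟩

/-- The recursion mirrors that of `ball`: for every coordinate the search of level `d` is run after
a shift by `z` and after a shift by `-z`, and then the vector is restored. Each level multiplies the
time unit by at most `N * n + N + 1`. Level `d + 1` counts in variable `20 + d`, which the inner
levels preserve. The assumption on the entries is the room that `d` shifts of length `z` need inside
the box. -/
theorem runs_search (hs : Setup A B C D O X Y M S G) (d : ℕ) : ∀ (σ : State),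
    Best A B C D O X M σ → 0 ≤ σ.var 4 → (∀ p, |σ.arr 4 p| + d * σ.var 4 ≤ X) →
    Runs O ((N * n + N + 1) ^ (d + 1) * S) (searchCmd A B C d) σ fun τ =>
      Adv A B C D O X M G σ τ (targets N n d (view N n (σ.arr 4)) (σ.var 4)) ∧
      τ.arr 4 = σ.arr 4 ∧ ∀ v, v = 4 ∨ v = 5 ∨ 20 + d ≤ v → τ.var v = σ.var v := by
  induction d with
  | zero =>
    intro σ hσ h4 hX
    rw [zero_add, pow_one]
    refine (runs_compare hs hσ fun p => by simpa using hX p).mono le_rfl ?_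
    rintro τ ⟨h1, h2, h3⟩
    refine ⟨h1.mono ?_, h2, h3⟩
    rintro y ⟨m, hm, rfl⟩
    simp only [ball, mem_singleton] at hm
    simp [hm]
  | succ d ih =>
    intro σ hσ h4 hX
    set H := (N * n + N + 1) ^ (d + 1) * S with hH
    have hPpos : 1 ≤ (N * n + N + 1) ^ (d + 1) := Nat.one_le_pow _ _ (Nat.succ_pos _)
    have hSH : S ≤ H := Nat.le_mul_of_pos_left _ hPpos
    have hHH : (N * n + 1) * H ≤ (N * n + N + 1) ^ (d + 1 + 1) * S := by
      rw [pow_succ, hH, mul_comm _ (N * n + N + 1), mul_assoc]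
      exact Nat.mul_le_mul_right _ (by omega)
    have hHH' : H ≤ (N * n + N + 1) ^ (d + 1 + 1) * S :=
      (Nat.le_mul_of_pos_left _ (Nat.succ_pos _)).trans hHH
    have hstep : ∀ p, |σ.arr 4 p| + σ.var 4 + d * σ.var 4 ≤ X := fun p => by
      have := hX p
      push_cast at this
      linarith
    refine Runs.seq ((ih σ hσ h4 fun p => by linarith [hstep p]).mono hHH' fun _ => id) ?_
    rintro τ ⟨hadv, ha4, hv⟩
    refine Runs.seq (P := fun ρ => ρ = τ.setVar (20 + d) ((N * n : ℕ) : ℤ)) ?_ ?_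
    · refine Runs.assign (hadv.best.ok.sized hs.size) (hSH.trans hHH') ?_
      simp [Expr.eval, Op.eval, hadv.best.ok.var_zero]
    rintro _ rfl
    set x := view N n (σ.arr 4) with hx
    set z := σ.var 4 with hz
    -- Unshifted targets are done, and so are both shifts at every coordinate with index at least
    -- `k`.
    let I : ℕ → State → Prop := fun k ρ =>
      Adv A B C D O X M G σ ρ (targets N n d x z ∪ {y | ∃ (i : Fin N) (k' : Fin n),
        (k : ℤ) ≤ ((i : ℕ) : ℤ) * (n : ℤ) + ((k' : ℕ) : ℤ) ∧
        (y ∈ targets N n d (x + z • unitVec (i, k')) z ∨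
          y ∈ targets N n d (x + (-z) • unitVec (i, k')) z)}) ∧
      k ≤ N * n ∧ ρ.var (20 + d) = (k : ℤ) ∧ ρ.arr 4 = σ.arr 4 ∧
      ∀ v, v = 4 ∨ v = 5 ∨ 20 + (d + 1) ≤ v → ρ.var v = σ.var v
    refine (Runs.loop (S := S) I hSH (fun k ρ h => h.1.best.ok.sized hs.size) (fun k ρ h hn => ?_)
      (fun k ρ h hp => ?_) (N * n) _ ?_).mono hHH fun _ => id
    · obtain ⟨h1, h2, h3, h4, h5⟩ := h
      simp only [Expr.eval, h3] at hn
      obtain rfl : k = 0 := by omega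
      refine ⟨h1.mono ?_, h4, h5⟩
      rintro y ⟨m, hm, rfl⟩
      -- Since `x + z • (m' ± e) = (x ± z • e) + z • m'`, the loop supplies one unit vector and the
      -- inner search the remaining `m'`.
      rw [ball, mem_union, mem_biUnion] at hm
      rcases hm with hm | ⟨⟨i, k'⟩, -, hm⟩
      · exact Or.inl ⟨m, hm, rfl⟩
      · refine Or.inr ⟨i, k', by exact_mod_cast (view_lt i k').1, ?_⟩
        rcases mem_union.1 hm with hm | hm
        · obtain ⟨m', hm', rfl⟩ := mem_image.1 hm
          exact Or.inl ⟨m', hm', by module⟩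
        · obtain ⟨m', hm', rfl⟩ := mem_image.1 hm
          exact Or.inr ⟨m', hm', by module⟩
    · obtain ⟨h1, h2, h3, ha, h5⟩ := h
      simp only [Expr.eval, h3] at hp
      obtain ⟨k, rfl⟩ : ∃ k', k = k' + 1 := ⟨k - 1, by omega⟩
      refine ⟨k, rfl, ?_⟩
      obtain ⟨i, k', hik⟩ := exists_view_index (N := N) (n := n) (p := k) (by omega)
      have hw := hstep (k : ℤ)
      have hw' := hstep
      have hdz : 0 ≤ (d : ℤ) * z := mul_nonneg (by positivity) h4
      -- decrement the counter
      refine Runs.seq (P := fun ρ' => ρ' = ρ.setVar (20 + d) (k : ℤ)) ?_ ?_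
      · refine Runs.assign (h1.best.ok.sized hs.size) hSH ?_
        simp [Expr.eval, Op.eval, h3]
      rintro _ rfl
      have ok0 := h1.best.ok.setVar (v := 20 + d) (z := (k : ℤ)) (by omega)
        (by rw [abs_of_nonneg (by positivity)]
            exact le_trans (by exact_mod_cast (by omega : k ≤ N * n)) hs.dim_le)
      have a0 : Adv A B C D O X M G ρ (ρ.setVar (20 + d) (k : ℤ)) ∅ :=
        h1.best.adv ok0 rfl fun v hv => State.setVar_var_of_ne _ _ (by omega)
      have c0 : (ρ.setVar (20 + d) (k : ℤ)).var (20 + d) = k := by simp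
      have f0 : ∀ v, v = 4 ∨ v = 5 ∨ 20 + (d + 1) ≤ v →
          (ρ.setVar (20 + d) (k : ℤ)).var v = σ.var v := fun v hv => by
        rw [State.setVar_var_of_ne _ _ (by omega), h5 v hv]
      have w0 : (ρ.setVar (20 + d) (k : ℤ)).arr 4 = σ.arr 4 := ha
      generalize ρ.setVar (20 + d) (k : ℤ) = ρ₀ at *
      have a0 := h1.trans a0
      -- first move
      refine Runs.seq (runs_bump (G := G) hs a0.best (e := .var 4) (p := (k : ℤ)) (z := z) c0
        (f0 4 (by simp)) ?_ hSH) ?_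
      · rw [w0]
        exact (abs_add_le _ _).trans (by rw [abs_of_nonneg h4]; linarith)
      rintro ρ₁ ⟨a1, f1, w1⟩
      rw [w0] at w1
      have z1 : ρ₁.var 4 = z := by rw [f1, f0 4 (by simp)]
      refine Runs.seq (ih ρ₁ a1.best (by rw [z1]; exact h4) ?_) ?_
      · intro p
        rw [w1, z1]
        rcases eq_or_ne p k with rfl | hpk
        · rw [Function.update_self]
          linarith [abs_add_le (σ.arr 4 k) z, abs_of_nonneg h4]
        · rw [Function.update_of_ne hpk]
          linarith [hw' p]
      rintro ρ₂ ⟨a2, w2, f2⟩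
      rw [z1, w1, view_update _ i k' z hik] at a2
      rw [w1] at w2
      have c2 : ρ₂.var (20 + d) = k := by rw [f2 _ (by omega), f1, c0]
      have z2 : ρ₂.var 4 = z := by rw [f2 _ (by omega), z1]
      -- second move
      refine Runs.seq (runs_bump (G := G) hs a2.best (p := (k : ℤ)) (z := -2 * z) c2
        (by simp [Expr.eval, Op.eval, z2]) ?_ hSH) ?_
      · rw [w2, Function.update_self,
          show σ.arr 4 (k : ℤ) + z + -2 * z = σ.arr 4 k + -z by ring]
        exact (abs_add_le _ _).trans (by rw [abs_neg, abs_of_nonneg h4]; linarith)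
      rintro ρ₃ ⟨a3, f3, w3⟩
      have w3' : ρ₃.arr 4 = Function.update (σ.arr 4) k (σ.arr 4 k + -z) := by
        rw [w3, w2, Function.update_idem, Function.update_self]
        congr 1
        ring
      have z3 : ρ₃.var 4 = z := by rw [f3, z2]
      refine Runs.seq (ih ρ₃ a3.best (by rw [z3]; exact h4) ?_) ?_
      · intro p
        rw [w3', z3]
        rcases eq_or_ne p k with rfl | hpk
        · rw [Function.update_self]
          linarith [abs_add_le (σ.arr 4 k) (-z), abs_neg z, abs_of_nonneg h4]
        · rw [Function.update_of_ne hpk]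
          linarith [hw' p]
      rintro ρ₄ ⟨a4, w4, f4⟩
      rw [z3, w3', view_update _ i k' (-z) hik] at a4
      have c4 : ρ₄.var (20 + d) = k := by rw [f4 _ (by omega), f3, c2]
      have z4 : ρ₄.var 4 = z := by rw [f4 _ (by omega), z3]
      rw [w3'] at w4
      -- back to the start
      refine (runs_bump (G := G) hs a4.best (e := .var 4) (p := (k : ℤ)) (z := z) c4 z4 ?_ hSH).mono le_rfl ?_
      · rw [w4, Function.update_self, neg_add_cancel_right]
        linarith [hw' k]
      rintro ρ₅ ⟨a5, f5, w5⟩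
      refine ⟨(((((a0.trans a1).trans a2).trans a3).trans a4).trans a5).mono ?_, by omega,
        by rw [f5, c4], ?_, ?_⟩
      · rintro y (hy | ⟨i', k'', hle, hy⟩)
        · simp [hy]
        · by_cases hc : ((k + 1 : ℕ) : ℤ) ≤ ((i' : ℕ) : ℤ) * (n : ℤ) + ((k'' : ℕ) : ℤ)
          · exact Or.inl <| Or.inl <| Or.inl <| Or.inl <| Or.inl <| Or.inl <|
              Or.inr ⟨i', k'', hc, hy⟩
          · obtain ⟨rfl, rfl⟩ := view_index_inj (i := i) (i' := i') (k := k') (k' := k'')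
              (by push_cast at hc; linarith)
            rcases hy with hy | hy
            · exact Or.inl <| Or.inl <| Or.inl <| Or.inr hy
            · exact Or.inl <| Or.inr hy
      · rw [w5, w4, Function.update_idem, Function.update_self, neg_add_cancel_right,
          Function.update_eq_self]
      · intro v hv
        rw [f5, f4 v (by omega), f3, f2 v (by omega), f1, f0 v hv]
    · have ok0 := hadv.best.ok.setVar (v := 20 + d) (z := ((N * n : ℕ) : ℤ)) (by omega)
        (by rw [abs_of_nonneg (by positivity)]; exact hs.dim_le)
      refine ⟨(hadv.trans (hadv.best.adv ok0 rfl
        fun v hv => State.setVar_var_of_ne _ _ (by omega))).mono ?_, le_rfl, by simp, ha4, ?_⟩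
      · rintro y (hy | ⟨i', k'', hle, hy⟩)
        · exact Or.inl hy
        · exact absurd hle (not_le.2 (view_lt i' k'').2)
      · intro v h
        rw [State.setVar_var_of_ne _ _ (by omega), hv v (by omega)]

end Search

end NFold

namespace NFold
open Finset

variable {da db n s N : ℕ}

/-! ### The algorithm -/

section Main

variable (A : Matrix (Fin da) (Fin n) ℤ) (B : Matrix (Fin db) (Fin n) ℤ)
  (C : Matrix (Fin s) (Fin n) ℤ) (g : ℕ)

/-- Tries all step lengths `1, 2, 4, …` up to variable `5`. -/
def stepsCmd : Cmd :=
  .loop (.op .sub (.op .add (.var 5) (.const 1)) (.var 4)) <|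
    .seq (searchCmd A B C g) (.assign 4 (.op .mul (.const 2) (.var 4)))

/-- Replaces the current vector by the best one that a single step can reach. -/
def roundCmd : Cmd :=
  .seq (.assign 3 (.const 0)) <| .seq (.assign 4 (.const 1)) <| .seq (stepsCmd A B C g) <|
    copyCmd n 5 4

/-- The start is the zero vector, which arrays `4` and `5` hold initially. Variables `1` and `2`
keep the values of the best vector, and variable `5` holds twice the initial penalty, the longest
step ever useful. The last test compares the final penalty with `∑ u`: a larger penalty means
infeasibility. -/
def mainCmd : Cmd :=
  .seq (evalCmd A B C) <| .seq (.assign 1 (.var 6)) <| .seq (.assign 2 (.var 8)) <|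
    .seq (.assign 5 (.op .mul (.const 2) (.var 6))) <| .seq (.assign 3 (.const 1)) <|
    .seq (.loop (.var 3) (roundCmd A B C g)) <| .seq (evalCmd A B C) <|
    .ite (.op .sub (.var 6) (.var 7)) (.assign 0 (.const 0)) (.assign 0 (.const 1))

variable {A B C g} {D : Data da db n N} {O : Fin N → Fin s → EvalOracle} {X Y M : ℤ} {S : ℕ}
  {G : (Fin N → Fin n → ℤ) → ℤ} {σ τ : State}

/-- This is why the penalty contains `|x|` and `|u - x|` rather than only the violation of the
bounds: its sublevel sets are bounded. -/
theorem abs_le_penalty (D : Data da db n N) (A : Matrix (Fin da) (Fin n) ℤ)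
    (B : Matrix (Fin db) (Fin n) ℤ) (x : Fin N → Fin n → ℤ) (i : Fin N) (k : Fin n) :
    |x i k| ≤ D.penalty A B x := by
  have h0 : ∀ i, 0 ≤ D.qblk A i (x i) := fun i =>
    add_nonneg (sum_nonneg fun _ _ => add_nonneg (abs_nonneg _) (abs_nonneg _))
      (sum_nonneg fun _ _ => abs_nonneg _)
  have h1 : D.qblk A i (x i) ≤ ∑ i, D.qblk A i (x i) :=
    single_le_sum (f := fun i => D.qblk A i (x i)) (fun i _ => h0 i) (mem_univ i)
  have h2 : |x i k| + |D.u i k - x i k| ≤ ∑ k, (|x i k| + |D.u i k - x i k|) :=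
    single_le_sum (f := fun k => |x i k| + |D.u i k - x i k|)
      (fun _ _ => add_nonneg (abs_nonneg _) (abs_nonneg _)) (mem_univ k)
  have h3 : 0 ≤ ∑ r, |A.mulVec (x i) r - D.b i r| := sum_nonneg fun _ _ => abs_nonneg _
  have h4 : 0 ≤ ∑ r, |∑ i, B.mulVec (x i) r - D.b₀ r| := sum_nonneg fun _ _ => abs_nonneg _
  have h5 := abs_nonneg (D.u i k - x i k)
  have h6 : D.qblk A i (x i) =
    ∑ k, (|x i k| + |D.u i k - x i k|) + ∑ r, |A.mulVec (x i) r - D.b i r| := rfl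
  rw [Data.penalty]
  linarith

/-- The penalty has priority in the lexicographic order, so it cannot grow when `G` does not. -/
theorem Setup.penalty_le (hs : Setup A B C D O X Y M S G) {x y : Fin N → Fin n → ℤ}
    (hx : ∀ i k, |x i k| ≤ X) (hy : ∀ i k, |y i k| ≤ X) (h : G y ≤ G x) :
    D.penalty A B y ≤ D.penalty A B x := by
  by_contra hc
  have h1 := (hs.lex y x hy hx).not.1 (not_lt.2 h)
  apply h1
  have := neg_abs_le (D.value C O y - D.value C O x)
  have := abs_nonneg (D.value C O y - D.value C O x)
  nlinarith

/-- Two vectors with entries at most `W` differ by at most `2 * W` in each entry, so longer steps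
are not needed. A move of norm `g` then stays within `W + g * (2 * W)`. At most `J` doublings occur,
and the step variable never exceeds `4 * W`. -/
theorem runs_steps (hs : Setup A B C D O X Y M S G) {W : ℤ} (hWX : W + g * (2 * W) ≤ X)
    (hWM : 4 * W + 1 ≤ M) {J : ℕ} (hJ : 2 * W < 2 ^ J) (hσ : Best A B C D O X M σ)
    (h4 : σ.var 4 = 1) (h5 : σ.var 5 = 2 * W) (ha : ∀ p, |σ.arr 4 p| ≤ W) :
    Runs O ((J + 1) * ((N * n + N + 1) ^ (g + 1) * S)) (stepsCmd A B C g) σ fun τ =>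
      Adv A B C D O X M G σ τ {y | ∃ j : ℕ, (2 : ℤ) ^ j ≤ 2 * W ∧
        y ∈ targets N n g (view N n (σ.arr 4)) (2 ^ j)} ∧
      τ.arr 4 = σ.arr 4 ∧ τ.var 5 = σ.var 5 := by
  have hSH : S ≤ (N * n + N + 1) ^ (g + 1) * S :=
    Nat.le_mul_of_pos_left _ (Nat.one_le_pow _ _ (Nat.succ_pos _))
  let I : ℕ → State → Prop := fun k τ => ∃ j : ℕ, j + k = J ∧ τ.var 4 = 2 ^ j ∧
    Adv A B C D O X M G σ τ {y | ∃ j' < j, y ∈ targets N n g (view N n (σ.arr 4)) (2 ^ j')} ∧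
      τ.arr 4 = σ.arr 4 ∧ τ.var 5 = σ.var 5
  refine Runs.loop (S := S) I hSH (fun k τ h => ?_) (fun k τ h hn => ?_) (fun k τ h hp => ?_) J σ ?_
  · obtain ⟨j, -, -, h, -⟩ := h
    exact h.best.ok.sized hs.size
  · obtain ⟨j, hj, e4, h, e⟩ := h
    simp only [Expr.eval, Op.eval, e.2, e4, h5] at hn
    refine ⟨h.mono ?_, e⟩
    rintro y ⟨j', hj', hy⟩
    refine ⟨j', ?_, hy⟩
    exact (pow_lt_pow_iff_right₀ (by norm_num : (1 : ℤ) < 2)).1 (by omega)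
  · obtain ⟨j, hj, e4, h, e⟩ := h
    simp only [Expr.eval, Op.eval, e.2, e4, h5] at hp
    have hjJ : j < J :=
      (pow_lt_pow_iff_right₀ (by norm_num : (1 : ℤ) < 2)).1 (by omega)
    have hj2 : (2 : ℤ) ^ j ≤ 2 * W := by omega
    refine ⟨k - 1, by omega, Runs.seq (runs_search hs g τ h.best (by rw [e4]; positivity) ?_) ?_⟩
    · intro p
      rw [e.1, e4]
      have := ha p
      have : (g : ℤ) * 2 ^ j ≤ g * (2 * W) := mul_le_mul_of_nonneg_left hj2 (by positivity)
      linarith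
    rintro ρ ⟨h', e4', ev⟩
    have v4 : ρ.var 4 = 2 ^ j := by rw [ev 4 (by simp), e4]
    refine Runs.assign (h'.best.ok.sized hs.size) hSH ?_
    simp only [Expr.eval, Op.eval, v4]
    have ok' := h'.best.ok.setVar (v := 4) (z := 2 * 2 ^ j) (by norm_num)
      (by rw [abs_of_nonneg (by positivity)]; linarith)
    refine ⟨j + 1, by omega, by rw [State.setVar_var_self, pow_succ'], ?_, ?_, ?_⟩
    · refine ((h.trans h').trans (h'.best.adv ok' rfl fun v hv =>
        State.setVar_var_of_ne _ _ (by omega))).mono ?_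
      rintro y ⟨j', hj', hy⟩
      left
      rcases Nat.lt_succ_iff_lt_or_eq.1 hj' with hlt | rfl
      · exact Or.inl ⟨j', hlt, hy⟩
      · right
        rw [e4, e.1]
        exact hy
    · rw [State.setVar_arr, e4', e.1]
    · rw [State.setVar_var_of_ne _ _ (by norm_num), ev 5 (by simp), e.2]
  · refine ⟨0, by simp, by simpa using h4, ?_, rfl, rfl⟩
    refine (hσ.adv hσ.ok rfl fun _ _ => rfl).mono ?_
    rintro y ⟨j', hj', -⟩
    omega

/-- State between two rounds. -/
structure Between (A : Matrix (Fin da) (Fin n) ℤ) (B : Matrix (Fin db) (Fin n) ℤ)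
    (C : Matrix (Fin s) (Fin n) ℤ) (D : Data da db n N) (O : Fin N → Fin s → EvalOracle)
    (X M W : ℤ) (σ : State) : Prop where
  best : Best A B C D O X M σ
  view_eq : view N n (σ.arr 5) = view N n (σ.arr 4)
  arr_le : ∀ p, |σ.arr 4 p| ≤ W
  var_five : σ.var 5 = 2 * W
  penalty_le : D.penalty A B (view N n (σ.arr 4)) ≤ W

/-- The new vector is at least as good as every single step from the old one, and variable `3` tells
exactly whether `G` has decreased. -/
theorem runs_round (hs : Setup A B C D O X Y M S G) {W : ℤ} (hW : 0 ≤ W) (hWX : W + g * (2 * W) ≤ X)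
    (hWM : 4 * W + 1 ≤ M) {J : ℕ} (hJ : 2 * W < 2 ^ J) (hσ : Between A B C D O X M W σ) :
    Runs O ((J + 1) * ((N * n + N + 1) ^ (g + 1) * S)) (roundCmd A B C g) σ fun τ =>
      Between A B C D O X M W τ ∧
      (∀ j : ℕ, (2 : ℤ) ^ j ≤ 2 * W → ∀ m ∈ ball N n g,
        G (view N n (τ.arr 4)) ≤ G (view N n (σ.arr 4) + (2 : ℤ) ^ j • m)) ∧
      ((τ.var 3 = 0 ∧ G (view N n (τ.arr 4)) = G (view N n (σ.arr 4))) ∨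
        (τ.var 3 = 1 ∧ G (view N n (τ.arr 4)) < G (view N n (σ.arr 4)))) := by
  have hPpos : 1 ≤ (N * n + N + 1) ^ g := Nat.one_le_pow _ _ (Nat.succ_pos _)
  have hPH : (N * n + N + 1) * S ≤ (J + 1) * ((N * n + N + 1) ^ (g + 1) * S) := by
    rw [pow_succ, mul_assoc _ (N * n + N + 1) S, ← mul_assoc (J + 1)]
    exact Nat.le_mul_of_pos_left _ (by positivity)
  have hSH : S ≤ (J + 1) * ((N * n + N + 1) ^ (g + 1) * S) :=
    (Nat.le_mul_of_pos_left _ (Nat.succ_pos _)).trans hPH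
  have hCH : (N * n + 1) * S ≤ (J + 1) * ((N * n + N + 1) ^ (g + 1) * S) :=
    (Nat.mul_le_mul_right _ (by omega)).trans hPH
  have hgW : 0 ≤ (g : ℤ) * (2 * W) := by positivity
  have hWX' : W ≤ X := by linarith
  refine Runs.seq (P := fun ρ => ρ = σ.setVar 3 0)
    (Runs.assign (hσ.best.ok.sized hs.size) hSH rfl) ?_
  rintro _ rfl
  have ok1 := hσ.best.ok.setVar (v := 3) (z := 0) (by norm_num) (by simp; omega)
  refine Runs.seq (P := fun ρ => ρ = (σ.setVar 3 0).setVar 4 1)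
    (Runs.assign (ok1.sized hs.size) hSH rfl) ?_
  rintro _ rfl
  have ok2 := ok1.setVar (v := 4) (z := 1) (by norm_num) (by simp; omega)
  have hb : Best A B C D O X M ((σ.setVar 3 0).setVar 4 1) :=
    ⟨ok2, hσ.best.box, hσ.best.penalty, hσ.best.value⟩
  refine Runs.seq (runs_steps hs hWX hWM hJ hb rfl hσ.var_five hσ.arr_le) ?_
  rintro τ ⟨h, e4, e5⟩
  refine (runs_copy hs.size hs.dim_le h.best.ok (by norm_num) (by norm_num)).mono hCH ?_
  rintro ρ ⟨hρ, fv, fa, f4⟩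
  have a5 : ρ.arr 5 = τ.arr 5 := fa 5 (by norm_num)
  have hview : view N n (ρ.arr 4) = view N n (τ.arr 5) := view_eq_of_copy f4
  have hle := h.le
  have hgo := h.go
  simp only [State.setVar_arr, hσ.view_eq] at hle hgo
  have hpen : D.penalty A B (view N n (ρ.arr 4)) ≤ W := by
    rw [hview]
    exact (hs.penalty_le (fun i k => (hσ.arr_le _).trans hWX') (fun i k => h.best.box _)
      hle).trans hσ.penalty_le
  refine ⟨⟨⟨hρ, ?_, ?_, ?_⟩, by rw [a5, hview], fun p => ?_, ?_, hpen⟩, ?_, ?_⟩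
  · rw [a5]; exact h.best.box
  · rw [fv 1 (by norm_num), a5]; exact h.best.penalty
  · rw [fv 2 (by norm_num), a5]; exact h.best.value
  -- The entries of the vector are bounded by its penalty, which does not grow, so the bound `W`
  -- survives all rounds; the entries outside the window are untouched.
  · by_cases hp : 0 ≤ p ∧ p < ((N * n : ℕ) : ℤ)
    · obtain ⟨q, rfl⟩ := Int.eq_ofNat_of_zero_le hp.1
      obtain ⟨i, k, hik⟩ := exists_view_index (N := N) (n := n) (p := q) (by exact_mod_cast hp.2)
      have := (abs_le_penalty D A B (view N n (ρ.arr 4)) i k).trans hpen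
      rwa [view, ← hik] at this
    · rw [f4, if_neg hp, e4]
      exact hσ.arr_le p
  · rw [fv 5 (by norm_num), e5]; exact hσ.var_five
  · intro j hj m hm
    rw [hview]
    exact h.all _ ⟨j, hj, m, hm, rfl⟩
  · rw [hview]
    have v3 : ((σ.setVar 3 0).setVar 4 1).var 3 = 0 := rfl
    rw [v3] at hgo
    rw [fv 3 (by norm_num)]
    rcases hgo with ⟨h1, h2⟩ | h
    · exact Or.inl ⟨h2, by rw [h1]⟩
    · exact Or.inr h

/-- By `hgap` each round multiplies the gap to `Gmin` by at most `(R - 1) / R`; `hK` says that `K`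
rounds bring it below `1`. -/
theorem runs_main (hs : Setup A B C D O X Y M S G) {W : ℤ} (hW : D.penalty A B 0 = W)
    (hWX : W + g * (2 * W) ≤ X) (hWM : 4 * W + 1 ≤ M) {J : ℕ} (hJ : 2 * W < 2 ^ J) {R : ℕ}
    (hR : 0 < R) {Gmin : ℤ} (hmin : ∀ x, D.penalty A B x ≤ W → Gmin ≤ G x)
    (hgap : ∀ x y, D.penalty A B x ≤ W → G y ≤ G x →
      (∀ j : ℕ, (2 : ℤ) ^ j ≤ 2 * W → ∀ m ∈ ball N n g, G y ≤ G (x + (2 : ℤ) ^ j • m)) →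
      G x - Gmin ≤ R * (G x - G y))
    {K : ℕ} (hK : (G 0 - Gmin) * ((R : ℤ) - 1) ^ K < (R : ℤ) ^ K) (hdata : Ok D M D.init) :
    Runs O ((K + 2) * ((J + 1) * ((N * n + N + 1) ^ (g + 1) * S))) (mainCmd A B C g) D.init
      fun τ => D.penalty A B (τ.output N n) ≤ W ∧ G (τ.output N n) = Gmin ∧
        ((τ.var 0 = 0 ∧ ∑ i, ∑ k, D.u i k < D.penalty A B (τ.output N n)) ∨
          (τ.var 0 = 1 ∧ D.penalty A B (τ.output N n) ≤ ∑ i, ∑ k, D.u i k)) := by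
  set H := (J + 1) * ((N * n + N + 1) ^ (g + 1) * S) with hH
  have hPpos : 1 ≤ (N * n + N + 1) ^ g := Nat.one_le_pow _ _ (Nat.succ_pos _)
  have hPH : (N * n + N + 1) * S ≤ H := by
    rw [hH, pow_succ, mul_assoc _ (N * n + N + 1) S, ← mul_assoc (J + 1)]
    exact Nat.le_mul_of_pos_left _ (by positivity)
  have hHK : H ≤ (K + 2) * H := Nat.le_mul_of_pos_left _ (Nat.succ_pos _)
  have hSH : S ≤ (K + 2) * H := ((Nat.le_mul_of_pos_left _ (Nat.succ_pos _)).trans hPH).trans hHK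
  have hEH : (N + 1) * S ≤ (K + 2) * H :=
    ((Nat.mul_le_mul_right _ (by omega)).trans hPH).trans hHK
  have hSH' : S ≤ H := (Nat.le_mul_of_pos_left _ (Nat.succ_pos _)).trans hPH
  have hW0 : 0 ≤ W := by
    rw [← hW]
    exact add_nonneg (sum_nonneg fun i _ => add_nonneg
      (sum_nonneg fun _ _ => add_nonneg (abs_nonneg _) (abs_nonneg _))
      (sum_nonneg fun _ _ => abs_nonneg _)) (sum_nonneg fun _ _ => abs_nonneg _)
  have hgW : 0 ≤ (g : ℤ) * (2 * W) := by positivity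
  have hWX' : W ≤ X := by linarith
  have i4 : D.init.arr 4 = fun _ => 0 := rfl
  have i5 : D.init.arr 5 = fun _ => 0 := rfl
  have hv0 : view N n (fun _ => 0) = 0 := rfl
  have hX0 : ∀ p, |D.init.arr 4 p| ≤ X := fun p => by
    rw [i4, abs_zero]; linarith
  refine Runs.seq ((runs_eval hs.size hdata (hs.tame _ fun i k => hX0 _) hs.le hs.one_le).mono hEH
    fun _ => id) ?_
  rintro τ ⟨hτ, e6, -, e8⟩
  rw [i4, hv0] at e6 e8
  rw [hW] at e6
  have ok1 := hτ.ok.setVar (v := 1) (z := τ.var 6) (by norm_num) (hτ.ok.var_le _)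
  have ok2 := ok1.setVar (v := 2) (z := τ.var 8) (by norm_num) (hτ.ok.var_le _)
  have ok3 := ok2.setVar (v := 5) (z := 2 * τ.var 6) (by norm_num)
    (by rw [e6, abs_of_nonneg (by positivity)]; linarith)
  have ok4 := ok3.setVar (v := 3) (z := 1) (by norm_num) (by rw [abs_one]; linarith)
  refine Runs.seq (P := fun ρ => ρ = τ.setVar 1 (τ.var 6))
    (Runs.assign (hτ.ok.sized hs.size) hSH rfl) ?_
  rintro _ rfl
  refine Runs.seq (P := fun ρ => ρ = (τ.setVar 1 (τ.var 6)).setVar 2 (τ.var 8))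
    (Runs.assign (ok1.sized hs.size) hSH rfl) ?_
  rintro _ rfl
  refine Runs.seq (P := fun ρ => ρ = ((τ.setVar 1 (τ.var 6)).setVar 2 (τ.var 8)).setVar 5
    (2 * τ.var 6)) (Runs.assign (ok2.sized hs.size) hSH rfl) ?_
  rintro _ rfl
  refine Runs.seq (P := fun ρ => ρ = (((τ.setVar 1 (τ.var 6)).setVar 2 (τ.var 8)).setVar 5
    (2 * τ.var 6)).setVar 3 1) (Runs.assign (ok3.sized hs.size) hSH rfl) ?_
  rintro _ rfl
  have a4 : τ.arr 4 = fun _ => 0 := by rw [hτ.arr, i4]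
  have a5 : τ.arr 5 = fun _ => 0 := by rw [hτ.arr, i5]
  have hb : Between A B C D O X M W ((((τ.setVar 1 (τ.var 6)).setVar 2 (τ.var 8)).setVar 5
      (2 * τ.var 6)).setVar 3 1) := by
    refine ⟨⟨ok4, fun p => ?_, ?_, ?_⟩, ?_, fun p => ?_, ?_, ?_⟩
    · simpa [a5] using hW0.trans hWX'
    · simp [State.setVar, a5, hv0, e6, hW]
    · simp [State.setVar, a5, hv0, e8]
    · simp [State.setVar, a4, a5]
    · simpa [a4] using hW0
    · simp [State.setVar, e6]
    · simp [a4, hv0, hW]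
  have hG0 : G (view N n (((((τ.setVar 1 (τ.var 6)).setVar 2 (τ.var 8)).setVar 5
      (2 * τ.var 6)).setVar 3 1).arr 4)) = G 0 := by simp [a4, hv0]
  have hv3 : ((((τ.setVar 1 (τ.var 6)).setVar 2 (τ.var 8)).setVar 5
      (2 * τ.var 6)).setVar 3 1).var 3 = 1 := rfl
  generalize (((τ.setVar 1 (τ.var 6)).setVar 2 (τ.var 8)).setVar 5
      (2 * τ.var 6)).setVar 3 1 = σ at *
  -- Either the search has stopped at the minimum, or `k'` further contractions would bring the gap
  -- below `1`.
  let I : ℕ → State → Prop := fun k ρ => Between A B C D O X M W ρ ∧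
    ((ρ.var 3 = 0 ∧ G (view N n (ρ.arr 4)) = Gmin) ∨ (ρ.var 3 = 1 ∧ ∃ k', k = k' + 1 ∧
      (G (view N n (ρ.arr 4)) - Gmin) * ((R : ℤ) - 1) ^ k' < (R : ℤ) ^ k'))
  have hR1 : (1 : ℤ) ≤ R := by exact_mod_cast hR
  refine Runs.seq (P := fun ρ => Between A B C D O X M W ρ ∧ G (view N n (ρ.arr 4)) = Gmin) ?_ ?_
  · refine (Runs.loop (S := S) I hSH' (fun k ρ h => h.1.best.ok.sized hs.size) ?_ ?_ (K + 1) σ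
      ⟨hb, Or.inr ⟨hv3, K, rfl, by rwa [hG0]⟩⟩).mono le_rfl fun _ => id
    · rintro k ρ ⟨h1, h2⟩ hn
      simp only [Expr.eval] at hn
      rcases h2 with ⟨-, h⟩ | ⟨h, -⟩
      · exact ⟨h1, h⟩
      · omega
    · rintro k ρ ⟨h1, h2⟩ hp
      simp only [Expr.eval] at hp
      obtain ⟨-, k', rfl, hk⟩ : ρ.var 3 = 1 ∧ ∃ k', k = k' + 1 ∧
          (G (view N n (ρ.arr 4)) - Gmin) * ((R : ℤ) - 1) ^ k' < (R : ℤ) ^ k' :=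
        h2.resolve_left fun h => by omega
      refine ⟨k', rfl, (runs_round hs hW0 hWX hWM hJ h1).mono le_rfl ?_⟩
      rintro ρ' ⟨h1', hall, hgo⟩
      have hle : G (view N n (ρ'.arr 4)) ≤ G (view N n (ρ.arr 4)) := by
        rcases hgo with ⟨-, h⟩ | ⟨-, h⟩ <;> linarith
      have hg := hgap _ _ h1.penalty_le hle hall
      have hm := hmin _ h1.penalty_le
      have hm' := hmin _ h1'.penalty_le
      refine ⟨h1', ?_⟩
      rcases hgo with ⟨h3, he⟩ | ⟨h3, hlt⟩
      · left
        refine ⟨h3, ?_⟩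
        -- A round without improvement closes a positive fraction of the gap and yet nothing, so the
        -- gap was zero.
        rw [he, sub_self, mul_zero] at hg
        linarith
      · right
        refine ⟨h3, ?_⟩
        cases k' with
        -- The integer gap is already below `1`, so a strict decrease would pass below `Gmin`.
        | zero => simp at hk; omega
        | succ k' =>
          refine ⟨k', rfl, ?_⟩
          have hp : 0 ≤ ((R : ℤ) - 1) ^ k' := pow_nonneg (by linarith) _
          have h4 : (G (view N n (ρ'.arr 4)) - Gmin) * R ≤
              (G (view N n (ρ.arr 4)) - Gmin) * ((R : ℤ) - 1) := by linarith
          have h5 := mul_le_mul_of_nonneg_right h4 hp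
          rw [pow_succ, pow_succ] at hk
          have h6 : ((G (view N n (ρ'.arr 4)) - Gmin) * ((R : ℤ) - 1) ^ k') * R
              < (R : ℤ) ^ k' * R := by linarith
          exact lt_of_mul_lt_mul_right h6 (by linarith)
  · rintro ρ ⟨hρ, hG⟩
    refine Runs.seq ((runs_eval hs.size hρ.best.ok (hs.tame _ fun i k =>
      (hρ.arr_le _).trans hWX') hs.le hs.one_le).mono hEH fun _ => id) ?_
    rintro π ⟨hπ, p6, p7, -⟩
    have hout : ∀ z, (π.setVar 0 z).output N n = view N n (ρ.arr 4) := fun z => by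
      rw [← hπ.arr]; rfl
    refine Runs.ite (hπ.ok.sized hs.size) hSH (fun hpos => ?_) fun hneg => ?_
    · refine Runs.assign (hπ.ok.sized hs.size) hSH ?_
      rw [hout]
      refine ⟨hρ.penalty_le, hG, Or.inl ⟨rfl, ?_⟩⟩
      simp only [Expr.eval, Op.eval, p6, p7] at hpos
      linarith
    · refine Runs.assign (hπ.ok.sized hs.size) hSH ?_
      rw [hout]
      refine ⟨hρ.penalty_le, hG, Or.inr ⟨rfl, ?_⟩⟩
      simp only [Expr.eval, Op.eval, p6, p7] at hneg
      linarith

end Main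

end NFold

namespace NFold
open Finset

/-! ### Generators of cones of sign-compatible vectors -/

/-- One slack variable per inequality turns the solution set into the equaliser of two homomorphisms
on a power of `ℕ`, which is finitely generated (Gordan's lemma). `R` is the largest coordinate sum
of a generator without its slacks. -/
theorem exists_sum_of_nonneg {ι κ : Type*} [Fintype ι] [Fintype κ] (T : κ → ι → ℤ) :
    ∃ R : ℕ, ∀ m : ι → ℕ, (∀ r, 0 ≤ ∑ i, T r i * m i) →
      ∃ P : Multiset (ι → ℕ), P.sum = m ∧
        ∀ w ∈ P, (∀ r, 0 ≤ ∑ i, T r i * w i) ∧ ∑ i, w i ≤ R := by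
  let f : (ι ⊕ κ → ℕ) →+ (κ → ℤ) :=
    { toFun := fun m r => ∑ i, T r i * m (.inl i)
      map_zero' := by ext; simp
      map_add' := fun m m' => by ext; simp [mul_add, sum_add_distrib] }
  let g : (ι ⊕ κ → ℕ) →+ (κ → ℤ) :=
    { toFun := fun m r => m (.inr r)
      map_zero' := by ext; simp
      map_add' := fun m m' => by ext; simp }
  obtain ⟨F, hF⟩ := AddSubmonoid.fg_eqLocusM f g
  refine ⟨F.sup fun w => ∑ i, w (.inl i), fun m hm => ?_⟩
  let x : ι ⊕ κ → ℕ := Sum.elim m fun r => (∑ i, T r i * m i).toNat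
  have hx : x ∈ AddSubmonoid.closure (F : Set (ι ⊕ κ → ℕ)) := by
    rw [hF]
    change f x = g x
    ext r
    exact (Int.toNat_of_nonneg (hm r)).symm
  obtain ⟨P, hP, hPx⟩ := AddSubmonoid.exists_multiset_of_mem_closure hx
  let π : (ι ⊕ κ → ℕ) →+ (ι → ℕ) :=
    { toFun := fun m i => m (.inl i), map_zero' := rfl, map_add' := fun _ _ => rfl }
  refine ⟨P.map π, ?_, fun w hw => ?_⟩
  · rw [← map_multiset_sum, hPx]; rfl
  · obtain ⟨y, hy, rfl⟩ := Multiset.mem_map.1 hw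
    have hyF := hP y hy
    refine ⟨fun r => ?_, Finset.le_sup (f := fun w : ι ⊕ κ → ℕ => ∑ i, w (.inl i)) hyF⟩
    have h1 : y ∈ f.eqLocusM g := by rw [← hF]; exact AddSubmonoid.subset_closure hyF
    have h2 : f y r = g y r := congrFun h1 r
    change 0 ≤ f y r
    rw [h2]
    exact Int.natCast_nonneg _

/-- The previous bound applied to multiplicities. It depends on the finite set of possible elements
but not on the size of `m`; this is the source of independence of `N`. -/
theorem exists_multiset_sum_of_nonneg {α κ : Type*} [DecidableEq α] [Fintype κ] (s : Finset α)
    (T : κ → α → ℤ) : ∃ R : ℕ, ∀ m : Multiset α, (∀ a ∈ m, a ∈ s) →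
      (∀ r, 0 ≤ (m.map (T r)).sum) → ∃ H : Multiset (Multiset α), H.sum = m ∧
        ∀ h ∈ H, (∀ r, 0 ≤ (h.map (T r)).sum) ∧ Multiset.card h ≤ R := by
  obtain ⟨R, hR⟩ := exists_sum_of_nonneg fun r (a : s) => T r a
  let φ : (s → ℕ) →+ Multiset α :=
    { toFun := fun w => ∑ a, w a • {(a : α)}
      map_zero' := by simp
      map_add' := fun w w' => by simp [add_smul, sum_add_distrib] }
  have hφ : ∀ w r, ((φ w).map (T r)).sum = ∑ a : s, T r a * w a := fun w r => by
    change (Multiset.map (T r) (∑ a, w a • {(a : α)})).sum = _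
    rw [← Multiset.coe_mapAddMonoidHom, map_sum, ← Multiset.coe_sumAddMonoidHom, map_sum]
    refine sum_congr rfl fun a _ => ?_
    simp [Multiset.map_nsmul, Multiset.sum_nsmul, mul_comm]
  have hcard : ∀ w, Multiset.card (φ w) = ∑ a : s, w a := fun w => by
    change Multiset.card (∑ a, w a • {(a : α)}) = _
    rw [Multiset.card_sum]
    simp
  have hm : ∀ m : Multiset α, (∀ a ∈ m, a ∈ s) → φ (fun a => m.count (a : α)) = m :=
    fun m hms => by
    ext b
    change Multiset.count b (∑ a : s, m.count (a : α) • {(a : α)}) = _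
    rw [← Multiset.coe_countAddMonoidHom, map_sum]
    simp only [Multiset.coe_countAddMonoidHom, Multiset.count_nsmul, Multiset.count_singleton]
    by_cases hb : b ∈ s
    · rw [Finset.sum_eq_single ⟨b, hb⟩]
      · simp
      · rintro a - hab
        have : b ≠ a := fun e => hab (Subtype.ext e.symm)
        simp [this]
      · simp
    · rw [Multiset.count_eq_zero_of_notMem fun h => hb (hms b h)]
      refine sum_eq_zero fun a _ => ?_
      have : b ≠ a := fun e => hb (e ▸ a.2)
      simp [this]
  refine ⟨R, fun m hms hpos => ?_⟩
  obtain ⟨P, hP, hPw⟩ := hR (fun a => m.count (a : α)) fun r => by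
    rw [← hφ, hm m hms]; exact hpos r
  refine ⟨P.map φ, by rw [← map_multiset_sum, hP, hm m hms], fun h hh => ?_⟩
  obtain ⟨w, hw, rfl⟩ := Multiset.mem_map.1 hh
  refine ⟨fun r => ?_, ?_⟩
  · rw [hφ]; exact (hPw w hw).1 r
  · rw [hcard]; exact (hPw w hw).2

theorem Multiset.exists_eq_add_of_map_eq_add {α β : Type*} (f : α → β) (s t : Multiset β)
    (P : Multiset α) (h : P.map f = s + t) :
    ∃ P₁ P₂, P = P₁ + P₂ ∧ P₁.map f = s ∧ P₂.map f = t := by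
  induction s using Multiset.induction generalizing P with
  | empty => exact ⟨0, P, by simp, by simp, by simpa using h⟩
  | cons a s ih =>
    have ha : a ∈ P.map f := by rw [h]; simp
    obtain ⟨p, hp, rfl⟩ := Multiset.mem_map.1 ha
    obtain ⟨P', rfl⟩ := Multiset.exists_cons_of_mem hp
    rw [Multiset.map_cons, Multiset.cons_add, Multiset.cons_inj_right] at h
    obtain ⟨P₁, P₂, rfl, h1, h2⟩ := ih P' h
    exact ⟨p ::ₘ P₁, P₂, by simp, by simp [h1], h2⟩

/-- Needed to put block labels back: a grouping of unlabelled vectors lifts to a grouping of the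
labelled ones. -/
theorem Multiset.exists_sum_eq_of_map_eq_sum {α β : Type*} (f : α → β)
    (H : Multiset (Multiset β)) (P : Multiset α) (h : P.map f = H.sum) :
    ∃ L : Multiset (Multiset α), L.sum = P ∧ ∀ p ∈ L, p.map f ∈ H := by
  induction H using Multiset.induction generalizing P with
  | empty =>
    refine ⟨0, ?_, by simp⟩
    rw [Multiset.sum_zero, Multiset.map_eq_zero] at h
    simp [h]
  | cons s H ih =>
    rw [Multiset.sum_cons] at h
    obtain ⟨P₁, P₂, rfl, h1, h2⟩ := Multiset.exists_eq_add_of_map_eq_add f s H.sum P h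
    obtain ⟨L, rfl, hL⟩ := ih P₂ h2
    refine ⟨P₁ ::ₘ L, by simp, fun p hp => ?_⟩
    rcases Multiset.mem_cons.1 hp with rfl | hp
    · rw [h1]; exact Multiset.mem_cons_self _ _
    · exact Multiset.mem_cons_of_mem (hL p hp)

variable {κ : Type*} [Fintype κ] {db n N : ℕ}

/-- The vectors `v` with prescribed signs of all entries of `v` and of `E v`. -/
def blockCone (E : Matrix κ (Fin n) ℤ) (ε : Fin n → ℤˣ) (η : κ → ℤˣ) :
    AddSubmonoid (Fin n → ℤ) where
  carrier := {v | (∀ k, 0 ≤ (ε k : ℤ) * v k) ∧ ∀ r, 0 ≤ (η r : ℤ) * E.mulVec v r}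
  zero_mem' := by simp
  add_mem' := by
    rintro v w ⟨h1, h2⟩ ⟨h3, h4⟩
    refine ⟨fun k => ?_, fun r => ?_⟩
    · simpa [mul_add] using add_nonneg (h1 k) (h3 k)
    · simpa [mul_add, Matrix.mulVec_add] using add_nonneg (h2 r) (h4 r)

/-- Multiplication by the signs `ε` moves the vector into the nonnegative orthant, where
`exists_sum_of_nonneg` applies. -/
theorem exists_sum_of_mem_blockCone (E : Matrix κ (Fin n) ℤ) (ε : Fin n → ℤˣ) (η : κ → ℤˣ) :
    ∃ R : ℕ, ∀ v ∈ blockCone E ε η, ∃ P : Multiset (Fin n → ℤ), P.sum = v ∧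
      ∀ w ∈ P, w ∈ blockCone E ε η ∧ ∀ k, |w k| ≤ R := by
  have hε : ∀ k, (ε k : ℤ) * ε k = 1 := fun k => by
    rw [← Units.val_mul, Int.units_mul_self, Units.val_one]
  have hε' : ∀ k, |(ε k : ℤ)| = 1 := fun k => by
    rcases Int.units_eq_one_or (ε k) with h | h <;> simp [h]
  obtain ⟨R, hR⟩ := exists_sum_of_nonneg fun r k => (η r : ℤ) * E r k * ε k
  let φ : (Fin n → ℕ) →+ (Fin n → ℤ) :=
    { toFun := fun w k => ε k * w k
      map_zero' := by ext; simp
      map_add' := fun w w' => by ext; simp [mul_add] }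
  have hφ : ∀ w r, (η r : ℤ) * E.mulVec (φ w) r = ∑ k, (η r : ℤ) * E r k * ε k * w k :=
    fun w r => by
    rw [Matrix.mulVec, dotProduct, mul_sum]
    exact sum_congr rfl fun k _ => by simp only [φ, AddMonoidHom.coe_mk, ZeroHom.coe_mk]; ring
  refine ⟨R, fun v hv => ?_⟩
  have hv' : φ (fun k => (v k).natAbs) = v := by
    ext k
    change (ε k : ℤ) * ((v k).natAbs : ℤ) = v k
    have h1 : |v k| = ε k * v k := by
      rw [← abs_of_nonneg (hv.1 k), abs_mul, hε', one_mul]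
    rw [Int.natCast_natAbs, h1, ← mul_assoc, hε, one_mul]
  obtain ⟨P, hP, hPw⟩ := hR (fun k => (v k).natAbs) fun r => by
    rw [← hφ, hv']; exact hv.2 r
  refine ⟨P.map φ, by rw [← map_multiset_sum, hP, hv'], fun u hu => ?_⟩
  obtain ⟨w, hw, rfl⟩ := Multiset.mem_map.1 hu
  refine ⟨⟨fun k => ?_, fun r => ?_⟩, fun k => ?_⟩
  · change 0 ≤ (ε k : ℤ) * (ε k * w k)
    rw [← mul_assoc, hε, one_mul]
    positivity
  · rw [hφ]; exact (hPw w hw).1 r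
  · change |(ε k : ℤ) * w k| ≤ R
    rw [abs_mul, hε', one_mul, Nat.abs_cast]
    exact_mod_cast (single_le_sum (fun _ _ => Nat.zero_le _) (mem_univ k)).trans (hPw w hw).2

/-- The vectors with prescribed signs of all entries, of `E` times every block, and of `B` times
the sum of the blocks. -/
def cone (E : Matrix κ (Fin n) ℤ) (B : Matrix (Fin db) (Fin n) ℤ) (ε : Fin N → Fin n → ℤˣ)
    (η : Fin N → κ → ℤˣ) (δ : Fin db → ℤˣ) : AddSubmonoid (Fin N → Fin n → ℤ) where
  carrier := {x | (∀ i, x i ∈ blockCone E (ε i) (η i)) ∧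
    ∀ r, 0 ≤ (δ r : ℤ) * ∑ i, B.mulVec (x i) r}
  zero_mem' := ⟨fun i => zero_mem _, fun r => by simp⟩
  add_mem' := by
    rintro x y ⟨h1, h2⟩ ⟨h3, h4⟩
    refine ⟨fun i => add_mem (h1 i) (h3 i), fun r => ?_⟩
    simpa [mul_add, Matrix.mulVec_add, sum_add_distrib] using add_nonneg (h2 r) (h4 r)

/-- Makes bounds uniform over the finitely many sign patterns of a single block or of the linking
rows. -/
theorem exists_bound_of_forall {ι : Type*} [Finite ι] {P : ι → ℕ → Prop}
    (hmono : ∀ i a b, a ≤ b → P i a → P i b) (h : ∀ i, ∃ R, P i R) : ∃ R, ∀ i, P i R := by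
  choose f hf using h
  cases nonempty_fintype ι
  exact ⟨univ.sup f, fun i => hmono i _ _ (le_sup (mem_univ i)) (hf i)⟩

/-- The cones are generated by elements of bounded norm, with a bound that does not depend on the
number of blocks. -/
theorem exists_cone_generators (E : Matrix κ (Fin n) ℤ) (B : Matrix (Fin db) (Fin n) ℤ) :
    ∃ g : ℕ, ∀ (N : ℕ) (ε : Fin N → Fin n → ℤˣ) (η : Fin N → κ → ℤˣ) (δ : Fin db → ℤˣ),
      ∀ x ∈ cone E B ε η δ, ∃ L : Multiset (Fin N → Fin n → ℤ), L.sum = x ∧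
        ∀ m ∈ L, m ∈ cone E B ε η δ ∧ ∑ i, ∑ k, |m i k| ≤ g := by
  obtain ⟨R, hR⟩ := exists_bound_of_forall (ι := (Fin n → ℤˣ) × (κ → ℤˣ))
    (P := fun p R => ∀ v ∈ blockCone E p.1 p.2, ∃ P : Multiset (Fin n → ℤ), P.sum = v ∧
      ∀ w ∈ P, w ∈ blockCone E p.1 p.2 ∧ ∀ k, |w k| ≤ R)
    (fun p a b hab h v hv => by
      obtain ⟨P, h1, h2⟩ := h v hv
      exact ⟨P, h1, fun w hw => ⟨(h2 w hw).1, fun k =>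
        ((h2 w hw).2 k).trans (by exact_mod_cast hab)⟩⟩)
    (fun p => exists_sum_of_mem_blockCone E p.1 p.2)
  -- All pieces of all blocks lie in this one finite box, whatever `N` is.
  let s : Finset (Fin n → ℤ) := Finset.Icc (fun _ => -(R : ℤ)) fun _ => (R : ℤ)
  obtain ⟨R', hR'⟩ := exists_bound_of_forall (ι := Fin db → ℤˣ)
    (P := fun δ R' => ∀ m : Multiset (Fin n → ℤ), (∀ a ∈ m, a ∈ s) →
      (∀ r, 0 ≤ (m.map fun v => (δ r : ℤ) * B.mulVec v r).sum) →
      ∃ H : Multiset (Multiset (Fin n → ℤ)), H.sum = m ∧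
        ∀ h ∈ H, (∀ r, 0 ≤ (h.map fun v => (δ r : ℤ) * B.mulVec v r).sum) ∧ Multiset.card h ≤ R')
    (fun p a b hab h m h1 h2 => by
      obtain ⟨H, h3, h4⟩ := h m h1 h2
      exact ⟨H, h3, fun w hw => ⟨(h4 w hw).1, (h4 w hw).2.trans hab⟩⟩)
    (fun δ => exists_multiset_sum_of_nonneg s _)
  -- A generator groups at most `R'` pieces, each in a single block and of ℓ₁-norm at most `n * R`.
  refine ⟨R' * (n * R), fun N ε η δ x hx => ?_⟩
  have hblock := fun i => hR (ε i, η i) (x i) (hx.1 i)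
  choose P hPsum hP using hblock
  -- All pieces of all blocks, with the number of their block.
  let Q : Multiset (Fin N × (Fin n → ℤ)) := ∑ i, (P i).map fun w => (i, w)
  let f : Fin N × (Fin n → ℤ) → (Fin N → Fin n → ℤ) := fun q => Pi.single q.1 q.2
  have hQ : ∀ q ∈ Q, q.2 ∈ blockCone E (ε q.1) (η q.1) ∧ ∀ k, |q.2 k| ≤ R := fun q hq => by
    obtain ⟨i, -, hi⟩ := Multiset.mem_sum.1 hq
    obtain ⟨w, hw, rfl⟩ := Multiset.mem_map.1 hi
    exact hP i w hw
  have hQx : (Q.map f).sum = x := by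
    rw [← Multiset.coe_mapAddMonoidHom, map_sum, ← Multiset.coe_sumAddMonoidHom, map_sum]
    simp only [Multiset.coe_mapAddMonoidHom, Multiset.coe_sumAddMonoidHom, Multiset.map_map]
    have : ∀ i, ((P i).map (f ∘ fun w => (i, w))).sum = Pi.single i (x i) := fun i => by
      change ((P i).map (AddMonoidHom.single (fun _ : Fin N => Fin n → ℤ) i)).sum = _
      rw [← map_multiset_sum, hPsum i]
      rfl
    simp only [this]
    exact Finset.univ_sum_single x
  have hlink : ∀ (p : Multiset (Fin N × (Fin n → ℤ))) (r : Fin db),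
      ∑ i, B.mulVec ((p.map f).sum i) r = ((p.map Prod.snd).map fun v => B.mulVec v r).sum := by
    intro p r
    induction p using Multiset.induction with
    | empty => simp
    | cons q p ih =>
      simp only [Multiset.map_cons, Multiset.sum_cons, Pi.add_apply, Matrix.mulVec_add,
        sum_add_distrib, ih]
      congr 1
      rw [Finset.sum_eq_single q.1]
      · simp [f]
      · intro i _ hi
        simp [f, Pi.single_eq_of_ne hi]
      · simp
  have hsmul : ∀ (p : Multiset (Fin n → ℤ)) (r : Fin db),
      (p.map fun v => (δ r : ℤ) * B.mulVec v r).sum =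
        δ r * (p.map fun v => B.mulVec v r).sum := fun p r => Multiset.sum_map_mul_left
  -- The same `B` acts on every block, so labels are irrelevant for the linking signs and can be
  -- dropped for the grouping.
  obtain ⟨H, hH, hH'⟩ := hR' δ (Q.map Prod.snd) (fun a ha => by
      obtain ⟨q, hq, rfl⟩ := Multiset.mem_map.1 ha
      have := fun k => abs_le.1 ((hQ q hq).2 k)
      exact Finset.mem_Icc.2 ⟨fun k => (this k).1, fun k => (this k).2⟩) fun r => by
    rw [hsmul, ← hlink, hQx]
    exact hx.2 r
  obtain ⟨L, hL, hLH⟩ := Multiset.exists_sum_eq_of_map_eq_sum Prod.snd H Q hH.symm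
  refine ⟨L.map fun p => (p.map f).sum, ?_, fun m hm => ?_⟩
  · rw [← hQx, ← hL]
    clear hL hLH
    induction L using Multiset.induction with
    | empty => simp
    | cons p L ih => simp [ih]
  · obtain ⟨p, hp, rfl⟩ := Multiset.mem_map.1 hm
    have hpQ : ∀ q ∈ p, q ∈ Q := fun q hq => by
      rw [← hL]; exact Multiset.mem_of_le (Multiset.le_sum_of_mem hp) hq
    have hc := (hH' _ (hLH p hp)).2
    rw [Multiset.card_map] at hc
    refine ⟨⟨fun i => ?_, fun r => ?_⟩, ?_⟩
    · have : (p.map f).sum i = ((p.map f).map fun y => y i).sum :=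
        map_multiset_sum (Pi.evalAddMonoidHom (fun _ : Fin N => Fin n → ℤ) i) (p.map f)
      rw [this, Multiset.map_map]
      refine AddSubmonoid.multiset_sum_mem _ _ fun v hv => ?_
      obtain ⟨q, hq, rfl⟩ := Multiset.mem_map.1 hv
      rcases eq_or_ne i q.1 with rfl | hne
      · simpa [f] using (hQ q (hpQ q hq)).1
      · simp [f, Pi.single_eq_of_ne hne]
    · rw [hlink, ← hsmul]
      exact (hH' _ (hLH p hp)).1 r
    · have hnorm : ∀ p : Multiset (Fin N × (Fin n → ℤ)), (∀ q ∈ p, ∀ k, |q.2 k| ≤ R) →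
          ∑ i, ∑ k, |(p.map f).sum i k| ≤ (Multiset.card p : ℤ) * (n * R) := fun p => by
        induction p using Multiset.induction with
        | empty => simp
        | cons q p ih =>
          intro hq
          have h1 := ih fun q' hq' => hq q' (Multiset.mem_cons_of_mem hq')
          have h2 : ∑ i, ∑ k, |f q i k| ≤ n * R := by
            rw [Finset.sum_eq_single q.1]
            · refine (sum_le_card_nsmul _ _ (R : ℤ) fun k _ => ?_).trans_eq (by simp)
              simpa [f] using hq q (Multiset.mem_cons_self _ _) k
            · intro i _ hi
              simp [f, Pi.single_eq_of_ne hi]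
            · simp
          have h3 : ∑ i, ∑ k, |((q ::ₘ p).map f).sum i k| ≤
              ∑ i, ∑ k, |f q i k| + ∑ i, ∑ k, |(p.map f).sum i k| := by
            rw [← sum_add_distrib]
            refine sum_le_sum fun i _ => ?_
            rw [← sum_add_distrib]
            refine sum_le_sum fun k _ => ?_
            rw [Multiset.map_cons, Multiset.sum_cons]
            exact abs_add_le _ _
          rw [Multiset.card_cons]
          push_cast
          linarith
      refine (hnorm p fun q hq => (hQ q (hpQ q hq)).2).trans ?_
      exact_mod_cast Nat.mul_le_mul_right (n * R) hc

end NFold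

namespace NFold
open Finset

/-! ### Superadditivity of convex functions -/

/-- `y + a` and `y + b` are convex combinations of `y` and `y + a + b` with swapped weights `a / (a
+ b)` and `b / (a + b)`. If `a + b = 0`, then equal signs force `a = b = 0`. -/
theorem ConvexOn.add_add_le {f : ℝ → ℝ} (hf : ConvexOn ℝ Set.univ f) (y : ℝ) {a b : ℝ}
    (hab : 0 ≤ a * b) : f (y + a) + f (y + b) ≤ f (y + a + b) + f y := by
  rcases eq_or_ne (a + b) 0 with h0 | h0
  · have hb : b = -a := by linarith
    subst hb
    have ha : a = 0 := by nlinarith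
    simp [ha]
  · have h1 : 0 ≤ a / (a + b) := by
      rw [← mul_div_mul_right a (a + b) h0]
      exact div_nonneg (by nlinarith [mul_self_nonneg a]) (mul_self_nonneg _)
    have h2 : 0 ≤ b / (a + b) := by
      rw [← mul_div_mul_right b (a + b) h0]
      exact div_nonneg (by nlinarith [mul_self_nonneg b]) (mul_self_nonneg _)
    have h3 : a / (a + b) + b / (a + b) = 1 := by field_simp
    have e1 : b / (a + b) * y + a / (a + b) * (y + a + b) = y + a := by field_simp; ring
    have e2 : a / (a + b) * y + b / (a + b) * (y + a + b) = y + b := by field_simp; ring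
    have i1 := hf.2 (Set.mem_univ y) (Set.mem_univ (y + a + b)) h2 h1 (by linarith)
    have i2 := hf.2 (Set.mem_univ y) (Set.mem_univ (y + a + b)) h1 h2 h3
    simp only [smul_eq_mul] at i1 i2
    rw [e1] at i1
    rw [e2] at i2
    have e3 : ∀ t, a / (a + b) * t + b / (a + b) * t = t := fun t => by rw [← add_mul, h3, one_mul]
    linarith [e3 (f y), e3 (f (y + a + b))]

theorem abs_add_add_le (y : ℤ) {a b : ℤ} (hab : 0 ≤ a * b) :
    |y + a| + |y + b| ≤ |y + a + b| + |y| := by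
  rcases mul_nonneg_iff.1 hab with ⟨ha, hb⟩ | ⟨ha, hb⟩ <;>
  rcases abs_cases (y + a) with ⟨h1, -⟩ | ⟨h1, -⟩ <;>
  rcases abs_cases (y + b) with ⟨h2, -⟩ | ⟨h2, -⟩ <;>
  rw [h1, h2] <;>
  linarith [le_abs_self (y + a + b), neg_le_abs (y + a + b), le_abs_self y, neg_le_abs y]

theorem mul_nonneg_of_units (ε : ℤˣ) {a b : ℤ} (ha : 0 ≤ (ε : ℤ) * a) (hb : 0 ≤ (ε : ℤ) * b) :
    0 ≤ a * b := by
  have h := mul_nonneg ha hb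
  have hε : (ε : ℤ) * ε = 1 := by rw [← Units.val_mul, Int.units_mul_self, Units.val_one]
  calc 0 ≤ (ε : ℤ) * a * (ε * b) := h
    _ = (ε * ε : ℤ) * (a * b) := by ring
    _ = a * b := by rw [hε, one_mul]

theorem exists_unit_mul_nonneg (z : ℤ) : ∃ ε : ℤˣ, 0 ≤ (ε : ℤ) * z := by
  rcases le_total 0 z with h | h
  · exact ⟨1, by simpa using h⟩
  · exact ⟨-1, by simpa using h⟩

variable {da db n s N : ℕ} {A : Matrix (Fin da) (Fin n) ℤ} {B : Matrix (Fin db) (Fin n) ℤ}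
  {C : Matrix (Fin s) (Fin n) ℤ} {ε : Fin N → Fin n → ℤˣ} {η : Fin N → Fin da ⊕ Fin s → ℤˣ}
  {δ : Fin db → ℤˣ}

/-- Two vectors of one cone shift the argument of every absolute value in the penalty in the same
direction, so `abs_add_add_le` applies term by term. -/
theorem penalty_add_add_le (D : Data da db n N) (x : Fin N → Fin n → ℤ)
    {d e : Fin N → Fin n → ℤ} (hd : d ∈ cone (Matrix.fromRows A C) B ε η δ)
    (he : e ∈ cone (Matrix.fromRows A C) B ε η δ) :
    D.penalty A B (x + d) + D.penalty A B (x + e) ≤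
      D.penalty A B (x + d + e) + D.penalty A B x := by
  have hq : ∀ i, D.qblk A i (x i + d i) + D.qblk A i (x i + e i) ≤
      D.qblk A i (x i + d i + e i) + D.qblk A i (x i) := fun i => by
    have h1 : ∀ k, (|(x i + d i) k| + |D.u i k - (x i + d i) k|) +
        (|(x i + e i) k| + |D.u i k - (x i + e i) k|) ≤
        (|(x i + d i + e i) k| + |D.u i k - (x i + d i + e i) k|) +
        (|x i k| + |D.u i k - x i k|) := fun k => by
      have hs := mul_nonneg_of_units _ ((hd.1 i).1 k) ((he.1 i).1 k)
      have h1 := abs_add_add_le (x i k) hs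
      have h2 := abs_add_add_le (x i k - D.u i k) hs
      simp only [Pi.add_apply, abs_sub_comm (D.u i k)]
      rw [show x i k + d i k - D.u i k = x i k - D.u i k + d i k by ring,
        show x i k + e i k - D.u i k = x i k - D.u i k + e i k by ring,
        show x i k + d i k + e i k - D.u i k = x i k - D.u i k + d i k + e i k by ring]
      linarith
    have h2 : ∀ r, |A.mulVec (x i + d i) r - D.b i r| + |A.mulVec (x i + e i) r - D.b i r| ≤
        |A.mulVec (x i + d i + e i) r - D.b i r| + |A.mulVec (x i) r - D.b i r| := fun r => by
      have hs := mul_nonneg_of_units _ ((hd.1 i).2 (.inl r)) ((he.1 i).2 (.inl r))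
      simp only [Matrix.fromRows_mulVec, Sum.elim_inl] at hs
      have h1 := abs_add_add_le (A.mulVec (x i) r - D.b i r) hs
      simp only [Matrix.mulVec_add, Pi.add_apply]
      convert h1 using 3 <;> ring_nf
    have h1' := sum_le_sum fun k (_ : k ∈ univ) => h1 k
    have h2' := sum_le_sum fun r (_ : r ∈ univ) => h2 r
    simp only [Data.qblk, sum_add_distrib] at h1' h2' ⊢
    linarith
  have hl : ∀ r, |∑ i, B.mulVec (x i + d i) r - D.b₀ r| + |∑ i, B.mulVec (x i + e i) r - D.b₀ r| ≤
      |∑ i, B.mulVec (x i + d i + e i) r - D.b₀ r| + |∑ i, B.mulVec (x i) r - D.b₀ r| :=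
    fun r => by
    have hs := mul_nonneg_of_units _ (hd.2 r) (he.2 r)
    have h1 := abs_add_add_le (∑ i, B.mulVec (x i) r - D.b₀ r) hs
    simp only [Matrix.mulVec_add, Pi.add_apply, sum_add_distrib]
    convert h1 using 3 <;> ring_nf
  have hq' := sum_le_sum fun i (_ : i ∈ univ) => hq i
  have hl' := sum_le_sum fun r (_ : r ∈ univ) => hl r
  rw [sum_add_distrib, sum_add_distrib] at hq' hl'
  simp only [Data.penalty, Pi.add_apply]
  linarith

theorem value_add_add_le (D : Data da db n N) {O : Fin N → Fin s → EvalOracle}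
    (hO : ∀ i j (y : ℤ) {a b : ℤ}, 0 ≤ a * b → (O i j).val (y + a) + (O i j).val (y + b) ≤
      (O i j).val (y + a + b) + (O i j).val y) (x : Fin N → Fin n → ℤ)
    {d e : Fin N → Fin n → ℤ} (hd : d ∈ cone (Matrix.fromRows A C) B ε η δ)
    (he : e ∈ cone (Matrix.fromRows A C) B ε η δ) :
    D.value C O (x + d) + D.value C O (x + e) ≤ D.value C O (x + d + e) + D.value C O x := by
  rw [Data.value, Data.value, Data.value, Data.value, ← sum_add_distrib, ← sum_add_distrib]
  refine sum_le_sum fun i _ => ?_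
  have h1 : ∀ j, (O i j).val (C.mulVec (x i + d i) j) + (O i j).val (C.mulVec (x i + e i) j) ≤
      (O i j).val (C.mulVec (x i + d i + e i) j) + (O i j).val (C.mulVec (x i) j) := fun j => by
    have hs := mul_nonneg_of_units _ ((hd.1 i).2 (.inr j)) ((he.1 i).2 (.inr j))
    simp only [Matrix.fromRows_mulVec, Sum.elim_inr] at hs
    simpa only [Matrix.mulVec_add, Pi.add_apply] using hO i j _ hs
  have h1' := sum_le_sum fun j (_ : j ∈ univ) => h1 j
  rw [sum_add_distrib, sum_add_distrib] at h1'
  simp only [Data.fblk, Pi.add_apply, dotProduct_add]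
  linarith

/-- The two-term inequality is iterated by splitting off one step at a time; the remaining steps
still sum to an element of the cone. -/
theorem sum_sub_le_of_add_add_le {V ι : Type*} [AddCommGroup V] (Γ : AddSubmonoid V) (G : V → ℤ)
    (x : V) (h : ∀ d ∈ Γ, ∀ e ∈ Γ, G (x + d) + G (x + e) ≤ G (x + d + e) + G x)
    (J : Finset ι) (w : ι → V) (hw : ∀ j ∈ J, w j ∈ Γ) :
    ∑ j ∈ J, (G (x + w j) - G x) ≤ G (x + ∑ j ∈ J, w j) - G x := by
  classical
  induction J using Finset.induction_on with
  | empty => simp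
  | insert a J ha ih =>
    rw [sum_insert ha, sum_insert ha]
    have h1 := ih fun j hj => hw j (mem_insert_of_mem hj)
    have h2 := h (w a) (hw a (mem_insert_self _ _)) (∑ j ∈ J, w j)
      (sum_mem fun j hj => hw j (mem_insert_of_mem hj))
    rw [← add_assoc]
    linarith

theorem sum_range_bitIndices {c J : ℕ} (hc : c < 2 ^ J) :
    ∑ j ∈ range J, (if j ∈ c.bitIndices then 2 ^ j else 0) = c := by
  rw [← sum_filter]
  have h : (range J).filter (· ∈ c.bitIndices) = c.bitIndices.toFinset := by
    ext j
    simp only [mem_filter, mem_range, List.mem_toFinset, and_iff_right_iff_imp]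
    intro hj
    exact (Nat.pow_lt_pow_iff_right (by norm_num)).1
      ((Nat.two_pow_le_of_mem_bitIndices hj).trans_lt hc)
  rw [h, sum_toFinset_bitIndices_two_pow]

/-- Signs agree within the cone, so the copies of `m` contribute at least one unit each to `|L.sum i
k|` and nothing cancels them. -/
theorem count_le_abs {κ : Type*} [Fintype κ] {E : Matrix κ (Fin n) ℤ} {η : Fin N → κ → ℤˣ}
    {L : Multiset (Fin N → Fin n → ℤ)} (hL : ∀ m ∈ L, m ∈ cone E B ε η δ)
    {m : Fin N → Fin n → ℤ} (hm : m ∈ L) {i : Fin N} {k : Fin n} (hik : m i k ≠ 0) :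
    (L.count m : ℤ) ≤ |L.sum i k| := by
  obtain ⟨L', hL'⟩ := Multiset.le_iff_exists_add.1 (Multiset.le_count_iff_replicate_le.1
    (le_refl (L.count m)))
  have hsum : L.sum = L.count m • m + L'.sum := by
    conv_lhs => rw [hL']
    rw [Multiset.sum_add, Multiset.sum_replicate]
  have h1 : L'.sum ∈ cone E B ε η δ := AddSubmonoid.multiset_sum_mem _ _ fun m' hm' => hL m' (by
    rw [hL']; exact Multiset.mem_add.2 (Or.inr hm'))
  have h2 := (h1.1 i).1 k
  have h3 := ((hL m hm).1 i).1 k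
  have hε : |(ε i k : ℤ)| = 1 := by
    rcases Int.units_eq_one_or (ε i k) with h | h <;> simp [h]
  have h4 : 1 ≤ (ε i k : ℤ) * m i k := by
    have : (ε i k : ℤ) * m i k ≠ 0 := mul_ne_zero (Units.ne_zero _) hik
    omega
  have h5 : (ε i k : ℤ) * L.sum i k = L.count m * (ε i k * m i k) + ε i k * L'.sum i k := by
    rw [hsum]
    simp only [Pi.add_apply, Pi.smul_apply]
    rw [nsmul_eq_mul]
    ring
  have h6 : (ε i k : ℤ) * L.sum i k ≤ |L.sum i k| := by
    refine (le_abs_self _).trans_eq ?_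
    rw [abs_mul, hε, one_mul]
  nlinarith [Int.natCast_nonneg (L.count m)]

/-- A vector that is at least as good as all single steps from `x` closes a polynomial fraction of
the gap between `x` and any other vector `z`. -/
theorem gap_le {κ : Type*} [Fintype κ] {E : Matrix κ (Fin n) ℤ} {B : Matrix (Fin db) (Fin n) ℤ}
    {g : ℕ} (hg : ∀ (ε : Fin N → Fin n → ℤˣ) (η : Fin N → κ → ℤˣ) (δ : Fin db → ℤˣ),
      ∀ x ∈ cone E B ε η δ, ∃ L : Multiset (Fin N → Fin n → ℤ), L.sum = x ∧
        ∀ m ∈ L, m ∈ cone E B ε η δ ∧ ∑ i, ∑ k, |m i k| ≤ g)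
    {G : (Fin N → Fin n → ℤ) → ℤ}
    (hG : ∀ (ε : Fin N → Fin n → ℤˣ) (η : Fin N → κ → ℤˣ) (δ : Fin db → ℤˣ),
      ∀ x, ∀ d ∈ cone E B ε η δ, ∀ e ∈ cone E B ε η δ, G (x + d) + G (x + e) ≤ G (x + d + e) + G x)
    {W : ℤ} {J : ℕ} (hJ : W < 2 ^ J) {x y z : Fin N → Fin n → ℤ}
    (hz : ∀ i k, |z i k - x i k| ≤ W) (hy : G y ≤ G x)
    (hyx : ∀ j : ℕ, (2 : ℤ) ^ j ≤ W → ∀ m ∈ ball N n g, G y ≤ G (x + (2 : ℤ) ^ j • m)) :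
    G x - G z ≤ (((ball N n g).card * J : ℕ) : ℤ) * (G x - G y) := by
  -- The cone is chosen to contain the direction `z - x`.
  choose ε hε using fun (i : Fin N) (k : Fin n) => exists_unit_mul_nonneg ((z - x) i k)
  choose η hη using fun (i : Fin N) (r : κ) => exists_unit_mul_nonneg (E.mulVec ((z - x) i) r)
  choose δ hδ using fun (r : Fin db) =>
    exists_unit_mul_nonneg (∑ i, B.mulVec ((z - x) i) r)
  have hmem : z - x ∈ cone E B ε η δ := ⟨fun i => ⟨hε i, hη i⟩, hδ⟩
  obtain ⟨L, hLs, hL⟩ := hg ε η δ _ hmem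
  have hcount : ∀ m ∈ L, m ≠ 0 → (L.count m : ℤ) ≤ W := fun m hm hm0 => by
    obtain ⟨i, k, hik⟩ : ∃ i k, m i k ≠ 0 := by
      by_contra! hc
      exact hm0 (by ext i k; exact hc i k)
    refine (count_le_abs (fun m hm => (hL m hm).1) hm hik).trans ?_
    rw [hLs]
    exact hz i k
  -- The step `2 ^ j • m` if bit `j` of the multiplicity of `m` is set, else `0`. The zero vector is
  -- excluded because its multiplicity is not bounded by `W`.
  let w : (Fin N → Fin n → ℤ) × ℕ → (Fin N → Fin n → ℤ) := fun p =>
    if p.1 ≠ 0 ∧ p.2 ∈ (L.count p.1).bitIndices then (2 : ℤ) ^ p.2 • p.1 else 0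
  have hw : ∀ p, w p ∈ cone E B ε η δ ∧ G y ≤ G (x + w p) ∨ p.1 ∉ ball N n g := fun p => by
    by_cases hp : p.1 ≠ 0 ∧ p.2 ∈ (L.count p.1).bitIndices
    · have h2 := Nat.two_pow_le_of_mem_bitIndices hp.2
      have hmL : p.1 ∈ L := Multiset.count_pos.1 (lt_of_lt_of_le (by positivity) h2)
      by_cases hb : p.1 ∈ ball N n g
      · left
        simp only [w, if_pos hp]
        constructor
        · have := AddSubmonoid.nsmul_mem _ (hL _ hmL).1 (2 ^ p.2)
          convert this using 1
          ext i k
          simp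
        · refine hyx _ (le_trans ?_ (hcount _ hmL hp.1)) _ hb
          exact_mod_cast h2
      · exact Or.inr hb
    · left
      simp only [w, if_neg hp]
      -- The trivial step is covered by `G y ≤ G x`, so the index set can be the full product.
      exact ⟨zero_mem _, by simpa using hy⟩
  have hsum : ∑ p ∈ ball N n g ×ˢ range J, w p = z - x := by
    have hsub : L.toFinset ⊆ ball N n g := fun m hm =>
      mem_ball_of_sum_le (hL m (Multiset.mem_toFinset.1 hm)).2
    rw [sum_product, ← hLs, Finset.sum_multiset_count_of_subset _ _ hsub]
    refine sum_congr rfl fun m hm => ?_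
    by_cases hm0 : m = 0
    · simp [w, hm0]
    have hc : L.count m < 2 ^ J := by
      by_cases hmL : m ∈ L
      · exact_mod_cast (hcount m hmL hm0).trans_lt hJ
      · rw [Multiset.count_eq_zero_of_notMem hmL]; positivity
    conv_rhs => rw [← sum_range_bitIndices hc, sum_smul]
    refine sum_congr rfl fun j hj => ?_
    simp only [w, ne_eq, hm0, not_false_eq_true, true_and]
    split_ifs
    · ext i k; simp
    · simp
  have hle := sum_sub_le_of_add_add_le (cone E B ε η δ) G x (hG ε η δ x)
    (ball N n g ×ˢ range J) w fun p hp =>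
      ((hw p).resolve_right fun h => h (mem_product.1 hp).1).1
  rw [hsum, add_sub_cancel] at hle
  have hlow : ∑ p ∈ ball N n g ×ˢ range J, (G y - G x) ≤
      ∑ p ∈ ball N n g ×ˢ range J, (G (x + w p) - G x) := sum_le_sum fun p hp =>
    sub_le_sub_right ((hw p).resolve_right fun h => h (mem_product.1 hp).1).2 _
  rw [sum_const, card_product, card_range, nsmul_eq_mul] at hlow
  linarith

end NFold

namespace NFold
open Finset

variable {da db n s N : ℕ}

/-! ### Penalty and feasibility -/

section Feasible

variable (D : Data da db n N) (A : Matrix (Fin da) (Fin n) ℤ) (B : Matrix (Fin db) (Fin n) ℤ)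
  (x : Fin N → Fin n → ℤ)

theorem le_abs_add_abs_sub (u z : ℤ) : u ≤ |z| + |u - z| := by
  linarith [le_abs_self z, le_abs_self (u - z)]

theorem sum_le_penalty : ∑ i, ∑ k, D.u i k ≤ D.penalty A B x := by
  have h1 : ∀ i, ∑ k, D.u i k ≤ D.qblk A i (x i) := fun i => by
    have h2 := sum_le_sum fun k (_ : k ∈ univ) => le_abs_add_abs_sub (D.u i k) (x i k)
    exact h2.trans (le_add_of_nonneg_right (sum_nonneg fun _ _ => abs_nonneg _))
  exact (sum_le_sum fun i _ => h1 i).trans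
    (le_add_of_nonneg_right (sum_nonneg fun _ _ => abs_nonneg _))

theorem objective_eq_value {C : Matrix (Fin s) (Fin n) ℤ} {f : Fin N → Fin s → ℝ → ℝ}
    {O : Fin N → Fin s → EvalOracle}
    (hf : ∀ i j (y : ℤ), f i j (y : ℝ) = (((O i j).val y : ℤ) : ℝ)) :
    D.objective C f x = (D.value C O x : ℤ) := by
  simp only [Data.objective, Data.value, Data.fblk, hf]
  push_cast
  exact sum_congr rfl fun i _ => add_comm _ _

variable {D A B x}

theorem penalty_eq_of_feasible (h : D.Feasible A B x) :
    D.penalty A B x = ∑ i, ∑ k, D.u i k := by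
  have h1 : ∀ r, ∑ i, B.mulVec (x i) r - D.b₀ r = 0 := fun r => by
    rw [← h.1, Finset.sum_apply, sub_self]
  have h2 : ∀ i r, A.mulVec (x i) r - D.b i r = 0 := fun i r => by rw [h.2.1 i, sub_self]
  have h3 : ∀ i k, |x i k| + |D.u i k - x i k| = D.u i k := fun i k => by
    rw [abs_of_nonneg ((h.2.2 i).1 k), abs_of_nonneg (sub_nonneg.2 ((h.2.2 i).2 k))]
    ring
  simp [Data.penalty, Data.qblk, h1, h2, h3]

/-- The penalty minus `∑ u` is a sum of nonnegative terms, so all of them vanish; `|x| + |u - x| =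
u` is the same as `0 ≤ x ≤ u`. No sign of `u` is assumed: a negative bound makes equality
impossible. -/
theorem feasible_of_penalty_le (h : D.penalty A B x ≤ ∑ i, ∑ k, D.u i k) :
    D.Feasible A B x := by
  have t0 : ∀ i k, 0 ≤ |x i k| + |D.u i k - x i k| - D.u i k := fun i k =>
    sub_nonneg.2 (le_abs_add_abs_sub _ _)
  have h1 : 0 ≤ ∑ i, ∑ k, (|x i k| + |D.u i k - x i k| - D.u i k) :=
    sum_nonneg fun i _ => sum_nonneg fun k _ => t0 i k
  have h2 : 0 ≤ ∑ i, ∑ r, |A.mulVec (x i) r - D.b i r| :=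
    sum_nonneg fun i _ => sum_nonneg fun k _ => abs_nonneg _
  have h3 : 0 ≤ ∑ r, |∑ i, B.mulVec (x i) r - D.b₀ r| := sum_nonneg fun i _ => abs_nonneg _
  have hsum : D.penalty A B x = ∑ i, ∑ k, (|x i k| + |D.u i k - x i k| - D.u i k) +
      ∑ i, ∑ k, D.u i k + ∑ i, ∑ r, |A.mulVec (x i) r - D.b i r| +
      ∑ r, |∑ i, B.mulVec (x i) r - D.b₀ r| := by
    simp only [Data.penalty, Data.qblk, sum_add_distrib, sum_sub_distrib]
    ring
  have e1 : ∑ i, ∑ k, (|x i k| + |D.u i k - x i k| - D.u i k) = 0 := by linarith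
  have e2 : ∑ i, ∑ r, |A.mulVec (x i) r - D.b i r| = 0 := by linarith
  have e3 : ∑ r, |∑ i, B.mulVec (x i) r - D.b₀ r| = 0 := by linarith
  rw [sum_eq_zero_iff_of_nonneg fun i _ => sum_nonneg fun k _ => t0 i k] at e1
  rw [sum_eq_zero_iff_of_nonneg fun i _ => sum_nonneg fun k _ => abs_nonneg _] at e2
  rw [sum_eq_zero_iff_of_nonneg fun i _ => abs_nonneg _] at e3
  have e1' : ∀ i k, |x i k| + |D.u i k - x i k| - D.u i k = 0 := fun i k =>
    (sum_eq_zero_iff_of_nonneg fun k _ => t0 i k).1 (e1 i (mem_univ _)) k (mem_univ _)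
  have e2' : ∀ i r, A.mulVec (x i) r - D.b i r = 0 := fun i r => abs_eq_zero.1
    ((sum_eq_zero_iff_of_nonneg fun k _ => abs_nonneg _).1 (e2 i (mem_univ _)) r (mem_univ _))
  refine ⟨?_, fun i => funext fun r => sub_eq_zero.1 (e2' i r), fun i => ⟨fun k => ?_, fun k => ?_⟩⟩
  · funext r
    rw [Finset.sum_apply]
    exact sub_eq_zero.1 (abs_eq_zero.1 (e3 r (mem_univ _)))
  · have := e1' i k
    have := neg_le_abs (x i k)
    have := le_abs_self (D.u i k - x i k)
    change 0 ≤ x i k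
    linarith
  · have := e1' i k
    have := le_abs_self (x i k)
    have := neg_le_abs (D.u i k - x i k)
    linarith

end Feasible

/-! ### Numerical bounds -/

theorem Polynomial.eval_nat_mono (p : Polynomial ℕ) {a b : ℕ} (h : a ≤ b) :
    p.eval a ≤ p.eval b := by
  rw [Polynomial.eval_eq_sum_range, Polynomial.eval_eq_sum_range]
  exact sum_le_sum fun i _ => Nat.mul_le_mul_left _ (Nat.pow_le_pow_left h i)

/-- The first two binomial terms of `(r + 1) ^ (r + 1)` already give `2 * r ^ (r + 1) + r ^ r`. -/
theorem two_mul_pow_le (r : ℕ) : 2 * r ^ (r + 1) ≤ (r + 1) ^ (r + 1) := by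
  have key : ∀ k : ℕ, r ^ (k + 1) + (k + 1) * r ^ k ≤ (r + 1) ^ (k + 1) := by
    intro k
    induction k with
    | zero => simp
    | succ k ih =>
      calc r ^ (k + 1 + 1) + (k + 1 + 1) * r ^ (k + 1)
          ≤ (r ^ (k + 1) + (k + 1) * r ^ k) * (r + 1) := by
            have : 0 ≤ (k + 1) * r ^ k := Nat.zero_le _
            ring_nf
            nlinarith
        _ ≤ (r + 1) ^ (k + 1 + 1) := by
            rw [pow_succ (r + 1)]
            exact Nat.mul_le_mul_right _ ih
  have h := key r
  have h2 : (r + 1) * r ^ r = r ^ (r + 1) + r ^ r := by ring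
  have h3 : 0 ≤ r ^ r := Nat.zero_le _
  omega

/-- After `R * γ` rounds that close a fraction `1 / R` of the gap, a gap below `2 ^ γ` is below `1`. -/
theorem mul_pow_lt_pow {R γ : ℕ} (hR : 0 < R) {z : ℤ} (hz : z < 2 ^ γ) :
    z * ((R : ℤ) - 1) ^ (R * γ) < (R : ℤ) ^ (R * γ) := by
  obtain ⟨r, rfl⟩ : ∃ r, R = r + 1 := ⟨R - 1, by omega⟩
  have e : (((r + 1 : ℕ) : ℤ) - 1) = r := by push_cast; ring
  rw [e]
  have h1 : (2 * r ^ (r + 1)) ^ γ ≤ ((r + 1) ^ (r + 1)) ^ γ :=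
    Nat.pow_le_pow_left (two_mul_pow_le r) γ
  rw [mul_pow, ← pow_mul, ← pow_mul] at h1
  have h1' : (2 : ℤ) ^ γ * (r : ℤ) ^ ((r + 1) * γ) ≤ ((r + 1 : ℕ) : ℤ) ^ ((r + 1) * γ) := by
    exact_mod_cast h1
  -- The power vanishes when `r = 0` and the exponent is positive, that is, when a single round
  -- closes the whole gap.
  rcases Nat.eq_zero_or_pos (r ^ ((r + 1) * γ)) with h0 | h0
  · have h0' : (r : ℤ) ^ ((r + 1) * γ) = 0 := by exact_mod_cast h0
    rw [h0', mul_zero]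
    positivity
  · have h0' : (0 : ℤ) < (r : ℤ) ^ ((r + 1) * γ) := by exact_mod_cast h0
    exact (mul_lt_mul_of_pos_right hz h0').trans_le h1'

/-- On both sides an integer difference of penalties has a factor larger than any compensating
difference of objectives. The right side needs no bound `M`, so the program can evaluate it. -/
theorem lex_lt_iff {M q q' f f' : ℤ} (hf : |f| ≤ M) (hf' : |f'| ≤ M) :
    (2 * M + 1) * q' + f' < (2 * M + 1) * q + f ↔ 0 < (q - q') * (|f - f'| + 1) + (f - f') := by
  have h1 := abs_le.1 hf
  have h2 := abs_le.1 hf'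
  have h3 := neg_abs_le (f - f')
  have h4 := le_abs_self (f - f')
  have h5 := abs_nonneg (f - f')
  rcases lt_trichotomy q q' with h | rfl | h
  · constructor <;> intro h' <;> exfalso <;> nlinarith
  · constructor <;> intro h' <;> linarith
  · constructor <;> intro h' <;> nlinarith

/-- Sum of the absolute values of all entries of a matrix. -/
def entryNorm {k m : ℕ} (T : Matrix (Fin k) (Fin m) ℤ) : ℕ := ∑ r, ∑ j, (T r j).natAbs

theorem abs_mulVec_le {k m : ℕ} (T : Matrix (Fin k) (Fin m) ℤ) {v : Fin m → ℤ} {X : ℤ}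
    (hX : 0 ≤ X) (hv : ∀ j, |v j| ≤ X) (r : Fin k) : |T.mulVec v r| ≤ entryNorm T * X := by
  have h1 : |T.mulVec v r| ≤ ∑ j, |T r j| * X := by
    change |∑ j, T r j * v j| ≤ _
    refine (abs_sum_le_sum_abs _ _).trans (sum_le_sum fun j _ => ?_)
    rw [abs_mul]
    exact mul_le_mul_of_nonneg_left (hv j) (abs_nonneg _)
  refine h1.trans ?_
  rw [← sum_mul]
  refine mul_le_mul_of_nonneg_right ?_ hX
  have h2 : ∑ j, (T r j).natAbs ≤ entryNorm T :=
    single_le_sum (f := fun r => ∑ j, (T r j).natAbs) (fun _ _ => Nat.zero_le _) (mem_univ r)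
  calc ∑ j, |T r j| = ((∑ j, (T r j).natAbs : ℕ) : ℤ) := by push_cast; rfl
    _ ≤ _ := by exact_mod_cast h2

theorem abs_lt_of_intSize_le {z : ℤ} {Z : ℕ} (h : intSize z ≤ Z) : |z| ≤ 2 ^ Z :=
  (lt_two_pow_intSize z).le.trans (pow_le_pow_right₀ (by norm_num) h)

theorem intSize_le_of_le_two_pow {z : ℤ} {k : ℕ} (h : |z| ≤ 2 ^ k) : intSize z ≤ k + 2 :=
  intSize_le_of_lt_two_pow (k := k + 1) (h.trans_lt (pow_lt_pow_right₀ (by norm_num) (by omega)))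

section Length

variable (D : Data da db n N)

theorem Data.intSize_b0_le (k : Fin db) : intSize (D.b₀ k) ≤ D.length := by
  have : intSize (D.b₀ k) ≤ ∑ k, intSize (D.b₀ k) :=
    single_le_sum (f := fun k => intSize (D.b₀ k)) (fun _ _ => Nat.zero_le _) (mem_univ k)
  unfold Data.length; omega

theorem intSize_le_sum {m : ℕ} (F : Fin N → Fin m → ℤ) (i : Fin N) (k : Fin m) :
    intSize (F i k) ≤ ∑ i, ∑ k, intSize (F i k) :=
  (single_le_sum (f := fun k => intSize (F i k)) (fun _ _ => Nat.zero_le _) (mem_univ k)).trans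
    (single_le_sum (f := fun i => ∑ k, intSize (F i k)) (fun _ _ => Nat.zero_le _) (mem_univ i))

theorem Data.intSize_b_le (i : Fin N) (k : Fin da) : intSize (D.b i k) ≤ D.length := by
  have := intSize_le_sum D.b i k
  unfold Data.length; omega

theorem Data.intSize_u_le (i : Fin N) (k : Fin n) : intSize (D.u i k) ≤ D.length := by
  have := intSize_le_sum D.u i k
  unfold Data.length; omega

theorem Data.intSize_c_le (i : Fin N) (k : Fin n) : intSize (D.c i k) ≤ D.length := by
  have := intSize_le_sum D.c i k
  unfold Data.length; omega

theorem Data.card_le_length : N ≤ D.length := by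
  unfold Data.length; omega

theorem abs_layout_le {m r : ℕ} {F : Fin m → Fin r → ℤ} {M : ℤ} (hM : 0 ≤ M)
    (h : ∀ i k, |F i k| ≤ M) (p : ℤ) : |layout F p| ≤ M := by
  unfold layout
  split_ifs
  · exact h _ _
  · simpa using hM

theorem Data.ok_init {M : ℤ} (hN : (N : ℤ) ≤ M) (hb0 : ∀ k, |D.b₀ k| ≤ M)
    (hb : ∀ i k, |D.b i k| ≤ M) (hu : ∀ i k, |D.u i k| ≤ M) (hc : ∀ i k, |D.c i k| ≤ M) :
    Ok D M D.init where
  var_le v := by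
    simp only [Data.init]
    split_ifs
    · rwa [Nat.abs_cast]
    · simp; omega
  arr_le a p := by
    have hM : 0 ≤ M := by omega
    match a with
    | 0 => exact abs_layout_le hM (fun _ => hb0) p
    | 1 => exact abs_layout_le hM hb p
    | 2 => exact abs_layout_le hM hu p
    | 3 => exact abs_layout_le hM hc p
    | _ + 4 => simpa [Data.init] using hM
  var_zero := by simp [Data.init]
  data _ _ := rfl

end Length

theorem natCast_le_two_pow (k : ℕ) : (k : ℤ) ≤ 2 ^ k := by
  exact_mod_cast Nat.lt_two_pow_self.le

theorem abs_sum_le_mul {m : ℕ} {f : Fin m → ℤ} {Y : ℤ} (h : ∀ j, |f j| ≤ Y) :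
    |∑ j, f j| ≤ m * Y :=
  (abs_sum_le_sum_abs _ _).trans ((sum_le_card_nsmul _ _ Y fun j _ => h j).trans_eq (by simp))

theorem penalty_zero_le (D : Data da db n N) (A : Matrix (Fin da) (Fin n) ℤ)
    (B : Matrix (Fin db) (Fin n) ℤ) {Z : ℕ} (hZ : D.length ≤ Z) :
    D.penalty A B 0 ≤ 2 ^ (n + da + db + 2 * Z) := by
  have hu := fun i k => abs_lt_of_intSize_le ((D.intSize_u_le i k).trans hZ)
  have hb := fun i k => abs_lt_of_intSize_le ((D.intSize_b_le i k).trans hZ)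
  have hb0 := fun k => abs_lt_of_intSize_le ((D.intSize_b0_le k).trans hZ)
  have e : D.penalty A B 0 =
      ∑ i, (∑ k, |D.u i k| + ∑ r, |D.b i r|) + ∑ r, |D.b₀ r| := by
    simp [Data.penalty, Data.qblk]
  have h1 : ∀ i, ∑ k, |D.u i k| + ∑ r, |D.b i r| ≤ (n + da) * 2 ^ Z := fun i => by
    have h2 := (sum_le_card_nsmul univ _ _ fun k _ => hu i k)
    have h3 := (sum_le_card_nsmul univ _ _ fun k _ => hb i k)
    simp only [card_univ, Fintype.card_fin, nsmul_eq_mul] at h2 h3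
    linarith
  have h2 := sum_le_card_nsmul univ _ _ fun i _ => h1 i
  have h3 := sum_le_card_nsmul univ _ _ fun k _ => hb0 k
  simp only [card_univ, Fintype.card_fin, nsmul_eq_mul] at h2 h3
  have hN : (N : ℤ) + 1 ≤ 2 ^ Z := by
    have h4 := D.card_le_length.trans hZ
    have h5 : Z < 2 ^ Z := Nat.lt_two_pow_self
    exact_mod_cast (by omega : N + 1 ≤ 2 ^ Z)
  have hK := natCast_le_two_pow (n + da + db)
  push_cast at hK
  rw [e]
  have hp : (0 : ℤ) < 2 ^ Z := by positivity
  calc _ ≤ (N : ℤ) * ((n + da) * 2 ^ Z) + db * 2 ^ Z := add_le_add h2 h3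
    _ ≤ (n + da + db) * ((N + 1) * 2 ^ Z) := by
        have : (0 : ℤ) ≤ (n + da) * 2 ^ Z + db * (N * 2 ^ Z) := by positivity
        linarith
    _ ≤ 2 ^ (n + da + db) * (2 ^ Z * 2 ^ Z) := by gcongr
    _ = _ := by rw [pow_add _ (n + da + db), two_mul, pow_add _ Z]

theorem tame_of_box (D : Data da db n N) (A : Matrix (Fin da) (Fin n) ℤ)
    (B : Matrix (Fin db) (Fin n) ℤ) (C : Matrix (Fin s) (Fin n) ℤ)
    (O : Fin N → Fin s → EvalOracle) {Z ex T S : ℕ} (hZ : D.length ≤ Z) (hex : Z ≤ ex)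
    (hT : ∀ i j (y : ℤ), |y| ≤ 2 ^ (entryNorm C + ex) → (O i j).time y ≤ T) (hTS : T ≤ S)
    {x : Fin N → Fin n → ℤ} (hx : ∀ i k, |x i k| ≤ 2 ^ ex) :
    D.Tame A B C O (2 ^ (3 * n + da * (entryNorm A + 1) + entryNorm B + 1 + 2 * ex + T)) S x := by
  have h2 : (2 : ℤ) ^ Z ≤ 2 ^ ex := pow_le_pow_right₀ (by norm_num) hex
  have hu := fun i k => (abs_lt_of_intSize_le ((D.intSize_u_le i k).trans hZ)).trans h2
  have hb := fun i k => (abs_lt_of_intSize_le ((D.intSize_b_le i k).trans hZ)).trans h2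
  have hc := fun i k => (abs_lt_of_intSize_le ((D.intSize_c_le i k).trans hZ)).trans h2
  have hb0 := fun k => (abs_lt_of_intSize_le ((D.intSize_b0_le k).trans hZ)).trans h2
  set K := 3 * n + da * (entryNorm A + 1) + entryNorm B + 1 with hK
  have hX1 : (1 : ℤ) ≤ 2 ^ ex := one_le_pow₀ (by norm_num)
  set X : ℤ := 2 ^ ex with hX
  have hX0 : 0 ≤ X := by linarith
  have hXX : X ≤ X * X := by nlinarith
  have hYK : ∀ a : ℕ, a ≤ K → (a : ℤ) * (X * X) ≤ 2 ^ (K + 2 * ex + T) := fun a ha => by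
    have h1 := natCast_le_two_pow K
    have h3 : (1 : ℤ) ≤ 2 ^ T := one_le_pow₀ (by norm_num)
    have h4 : (a : ℤ) ≤ K := by exact_mod_cast ha
    rw [pow_add _ (K + 2 * ex) T, pow_add _ K, two_mul ex, pow_add _ ex, ← hX]
    calc (a : ℤ) * (X * X) ≤ 2 ^ K * (X * X) := by gcongr; linarith
      _ ≤ 2 ^ K * (X * X) * 2 ^ T := le_mul_of_one_le_right (by positivity) h3
  have hYK' : ∀ a : ℕ, a ≤ K → (a : ℤ) * X ≤ 2 ^ (K + 2 * ex + T) := fun a ha =>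
    (mul_le_mul_of_nonneg_left hXX (by positivity)).trans (hYK a ha)
  have hCx : ∀ i j, |C.mulVec (x i) j| ≤ 2 ^ (entryNorm C + ex) := fun i j => by
    refine (abs_mulVec_le C hX0 (hx i) j).trans ?_
    rw [pow_add]
    exact mul_le_mul_of_nonneg_right (natCast_le_two_pow _) hX0
  refine ⟨fun i => ?_, fun i => ?_, fun i => ?_, fun i j => ?_, fun i j => ?_, fun i r => ?_,
    fun r => ?_⟩
  · have h3 : ∀ k, (|(|x i k| + |D.u i k - x i k|)|) ≤ 3 * X := fun k => by
      rw [abs_of_nonneg (add_nonneg (abs_nonneg _) (abs_nonneg _))]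
      linarith [abs_sub (D.u i k) (x i k), hx i k, hu i k]
    have h4 : ∀ r, (|(|A.mulVec (x i) r - D.b i r|)|) ≤ (entryNorm A + 1) * X := fun r => by
      rw [abs_abs]
      linarith [abs_sub (A.mulVec (x i) r) (D.b i r), abs_mulVec_le A hX0 (hx i) r, hb i r]
    have h5 := hYK' (3 * n + da * (entryNorm A + 1)) (by omega)
    push_cast at h5
    refine (abs_add_le _ _).trans ?_
    linarith [abs_sum_le_mul h3, abs_sum_le_mul h4]
  · exact (abs_sum_le_mul (hu i)).trans (hYK' n (by omega))
  · refine (abs_sum_le_mul fun k => ?_).trans (hYK n (by omega))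
    rw [abs_mul]
    exact mul_le_mul (hc i k) (hx i k) (abs_nonneg _) hX0
  -- An answer is no longer than the time to give it, which is why `T` enters the exponent.
  · refine (abs_lt_of_intSize_le (((O i j).size_val_le _).trans (hT i j _ (hCx i j)))).trans ?_
    exact pow_le_pow_right₀ (by norm_num) (by omega)
  · exact (hT i j _ (hCx i j)).trans hTS
  · exact (abs_mulVec_le B hX0 (hx i) r).trans (hYK' _ (by omega))
  · refine (hb0 r).trans ?_
    simpa using hYK' 1 (by omega)

/-- The sublevel set of the penalty lies in a box by `abs_le_penalty`, hence is finite, and contains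
`0`. -/
theorem exists_minimizer (D : Data da db n N) (A : Matrix (Fin da) (Fin n) ℤ)
    (B : Matrix (Fin db) (Fin n) ℤ) (G : (Fin N → Fin n → ℤ) → ℤ) :
    ∃ z, D.penalty A B z ≤ D.penalty A B 0 ∧
      ∀ x, D.penalty A B x ≤ D.penalty A B 0 → G z ≤ G x := by
  have hfin : {x | D.penalty A B x ≤ D.penalty A B 0}.Finite := by
    refine (Set.finite_Icc (fun _ _ => -D.penalty A B 0) fun _ _ => D.penalty A B 0).subset
      fun x hx => ?_
    have h := fun i k => abs_le.1 ((abs_le_penalty D A B x i k).trans hx)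
    exact ⟨fun i k => (h i k).1, fun i k => (h i k).2⟩
  obtain ⟨z, hz, hmin⟩ := Set.exists_min_image _ G hfin ⟨0, le_refl (D.penalty A B 0)⟩
  exact ⟨z, hz, hmin⟩

end NFold

/-! ### Assembly of the bounds and the main theorem. -/

namespace NFold
open Finset

variable {da db n s N : ℕ}

theorem val_add_add_le {f : Fin N → Fin s → ℝ → ℝ} {O : Fin N → Fin s → EvalOracle}
    (hc : ∀ i j, ConvexOn ℝ Set.univ (f i j))
    (hf : ∀ i j (y : ℤ), f i j (y : ℝ) = (((O i j).val y : ℤ) : ℝ)) (i : Fin N) (j : Fin s)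
    (y : ℤ) {a b : ℤ} (hab : 0 ≤ a * b) : (O i j).val (y + a) + (O i j).val (y + b) ≤
      (O i j).val (y + a + b) + (O i j).val y := by
  have h := ConvexOn.add_add_le (hc i j) (y : ℝ) (a := (a : ℝ)) (b := (b : ℝ))
    (by exact_mod_cast hab)
  rw [← Int.cast_add, ← Int.cast_add, ← Int.cast_add, hf, hf, hf, hf] at h
  exact_mod_cast h

/-- The bounds on all numbers that occur in a run, for inputs of size `Z`. -/
theorem setup_of_length (A : Matrix (Fin da) (Fin n) ℤ) (B : Matrix (Fin db) (Fin n) ℤ)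
    (C : Matrix (Fin s) (Fin n) ℤ) (D : Data da db n N) (O : Fin N → Fin s → EvalOracle)
    {Z ex T y m S : ℕ} (hZ : D.length ≤ Z) (hex : Z ≤ ex)
    (hT : ∀ i j (y : ℤ), |y| ≤ 2 ^ (entryNorm C + ex) → (O i j).time y ≤ T)
    (hy : y = 3 * n + da * (entryNorm A + 1) + entryNorm B + 1 + 2 * ex + T)
    (hm : m = y + Z + (s + db + n + 7)) (hS : S = m + 2 + T) :
    Setup A B C D O (2 ^ ex) (2 ^ y) (2 ^ m) S
        (fun x => (2 * 2 ^ m + 1) * D.penalty A B x + D.value C O x) ∧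
      ∀ x, (∀ i k, |x i k| ≤ 2 ^ ex) → |D.value C O x| ≤ 2 ^ m := by
  have htame : ∀ x : Fin N → Fin n → ℤ, (∀ i k, |x i k| ≤ 2 ^ ex) →
      D.Tame A B C O (2 ^ y) S x := fun x hx => by
    rw [hy]
    exact tame_of_box D A B C O hZ hex hT (by omega) hx
  have hN : N + 1 ≤ 2 ^ Z := by
    have h4 := D.card_le_length.trans hZ
    have h5 : Z < 2 ^ Z := Nat.lt_two_pow_self
    omega
  have hle : ∀ a : ℕ, a ≤ (N + 1) * (s + db + 4) → (a : ℤ) * 2 ^ y ≤ 2 ^ m := fun a ha => by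
    have h1 : s + db + 4 ≤ 2 ^ (s + db + n + 7) :=
      (by omega : s + db + 4 ≤ s + db + n + 7).trans Nat.lt_two_pow_self.le
    have h2 : a ≤ 2 ^ Z * 2 ^ (s + db + n + 7) := ha.trans (Nat.mul_le_mul hN h1)
    rw [hm]
    have h3 : a * 2 ^ y ≤ 2 ^ (y + Z + (s + db + n + 7)) := by
      rw [add_assoc, pow_add, pow_add, mul_comm]
      exact Nat.mul_le_mul_left _ h2
    exact_mod_cast h3
  have hval : ∀ x : Fin N → Fin n → ℤ, (∀ i k, |x i k| ≤ 2 ^ ex) →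
      |D.value C O x| ≤ 2 ^ m := fun x hx => by
    have ht := htame x hx
    have h1 : ∀ i, |D.fblk C O i (x i)| ≤ ((s + 1 : ℕ) : ℤ) * 2 ^ y := fun i => by
      refine (abs_add_le _ _).trans ?_
      push_cast
      linarith [ht.c i, abs_sum_le_mul (ht.val i)]
    refine (abs_sum_le_mul h1).trans ?_
    have h2 := hle (N * (s + 1)) (Nat.mul_le_mul (by omega) (by omega))
    push_cast at h2 ⊢
    linarith
  refine ⟨⟨fun z hz => ?_, hle, one_le_pow₀ (by norm_num),
    pow_le_pow_right₀ (by norm_num) (by omega), ?_, htame, fun x x' hx hx' => ?_⟩, hval⟩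
  · rw [hS]
    exact (intSize_le_of_le_two_pow hz).trans (by omega)
  · have h1 : n ≤ 2 ^ n := Nat.lt_two_pow_self.le
    have h2 : N * n ≤ 2 ^ (Z + n) := by
      rw [pow_add]
      exact Nat.mul_le_mul (by omega) h1
    exact_mod_cast h2.trans (Nat.pow_le_pow_right (by norm_num) (by omega))
  · exact lex_lt_iff (hval x hx) (hval x' hx')

end NFold

open NFold in
theorem mainTheorem3 {da db n s : ℕ} (A : Matrix (Fin da) (Fin n) ℤ)
    (B : Matrix (Fin db) (Fin n) ℤ) (C : Matrix (Fin s) (Fin n) ℤ) :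
    ∃ prog : NFold.Cmd, ∀ p : Polynomial ℕ, ∃ q : Polynomial ℕ,
      ∀ (N : ℕ) (D : NFold.Data da db n N) (f : Fin N → Fin s → ℝ → ℝ)
        (O : Fin N → Fin s → NFold.EvalOracle) (l : ℕ),
        (∀ i j, ConvexOn ℝ Set.univ (f i j)) →
        (∀ i j (y : ℤ), f i j (y : ℝ) = (((O i j).val y : ℤ) : ℝ)) →
        (∀ i j (y : ℤ), (O i j).time y ≤ p.eval (NFold.intSize y + l)) →
        ∃ (t : ℕ) (σ : NFold.State), NFold.Exec O prog D.init t σ ∧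
          t ≤ q.eval (D.length + l) ∧ D.SolvedBy A B C f σ := by
  obtain ⟨g, hg⟩ := exists_cone_generators (Matrix.fromRows A C) B
  refine ⟨mainCmd A B C g, fun p => ?_⟩
  -- Exponents as polynomials in the input size: `2 ^ w` bounds the penalty of `0`, `2 ^ ex` the
  -- entries of evaluated vectors, `2 ^ y` single terms, `2 ^ m` all numbers. `T` bounds oracle
  -- times, and `S` is the time unit.
  let w : Polynomial ℕ := ((n + da + db : ℕ) : Polynomial ℕ) + 2 * Polynomial.X
  let ex : Polynomial ℕ := w + ((2 * g + 1 : ℕ) : Polynomial ℕ)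
  let T : Polynomial ℕ := p.comp (((entryNorm C + 2 : ℕ) : Polynomial ℕ) + ex + Polynomial.X)
  let y : Polynomial ℕ :=
    ((3 * n + da * (entryNorm A + 1) + entryNorm B + 1 : ℕ) : Polynomial ℕ) + 2 * ex + T
  let m : Polynomial ℕ := y + Polynomial.X + ((s + db + n + 7 : ℕ) : Polynomial ℕ)
  let S : Polynomial ℕ := m + 2 + T
  -- The bound `R * γ`, where `R` is the size of the ball times `w + 2` binary digits and `2 ^ γ`
  -- with `γ = m + w + 4` exceeds the initial gap.
  let rounds : Polynomial ℕ := (2 * (Polynomial.X * (n : Polynomial ℕ)) + 1) ^ g * (w + 2) * (m + w + 4)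
  refine ⟨((mainCmd A B C g).wt : Polynomial ℕ) * ((rounds + 2) * ((w + 2 + 1) *
    ((Polynomial.X * (n : Polynomial ℕ) + Polynomial.X + 1) ^ (g + 1) * S))), ?_⟩
  intro N D f O l hc hf ht
  set Z := D.length + l with hZdef
  have hZ : D.length ≤ Z := Nat.le_add_right _ _
  have hNZ : N ≤ Z := D.card_le_length.trans hZ
  have ew : w.eval Z = n + da + db + 2 * Z := by simp [w]
  have eex : ex.eval Z = w.eval Z + (2 * g + 1) := by simp [ex]
  have eT : T.eval Z = p.eval (entryNorm C + 2 + ex.eval Z + Z) := by simp [T]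
  have ey : y.eval Z = 3 * n + da * (entryNorm A + 1) + entryNorm B + 1 + 2 * ex.eval Z +
    T.eval Z := by simp [y]
  have em : m.eval Z = y.eval Z + Z + (s + db + n + 7) := by simp [m]
  have eS : S.eval Z = m.eval Z + 2 + T.eval Z := by simp [S]
  have er : rounds.eval Z = (2 * (Z * n) + 1) ^ g * (w.eval Z + 2) * (m.eval Z + w.eval Z + 4) := by
    simp [rounds]
  simp only [Polynomial.eval_mul, Polynomial.eval_add, Polynomial.eval_natCast,
    Polynomial.eval_pow, Polynomial.eval_X, Polynomial.eval_one, Polynomial.eval_ofNat,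
    Nat.cast_id, er]
  generalize w.eval Z = w at *
  generalize ex.eval Z = ex at *
  generalize T.eval Z = T at *
  generalize y.eval Z = y at *
  generalize m.eval Z = m at *
  generalize S.eval Z = S at *
  have hT : ∀ i j (z : ℤ), |z| ≤ 2 ^ (entryNorm C + ex) → (O i j).time z ≤ T := fun i j z hz => by
    rw [eT]
    refine (ht i j z).trans (Polynomial.eval_nat_mono p ?_)
    have := intSize_le_of_le_two_pow hz
    omega
  obtain ⟨hs, hval⟩ := setup_of_length A B C D O hZ (by omega) hT ey em eS
  have hW : D.penalty A B 0 ≤ 2 ^ w := by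
    rw [ew]; exact penalty_zero_le D A B hZ
  have hW0 : 0 ≤ D.penalty A B 0 := by
    simp only [Data.penalty, Data.qblk]; positivity
  set G : (Fin N → Fin n → ℤ) → ℤ := fun x => (2 * 2 ^ m + 1) * D.penalty A B x + D.value C O x
    with hG
  set W := D.penalty A B 0 with hWdef
  have hWX : W + g * (2 * W) ≤ 2 ^ ex := by
    have h1 := natCast_le_two_pow (2 * g + 1)
    push_cast at h1
    rw [eex, pow_add, mul_comm ((2 : ℤ) ^ w)]
    calc W + g * (2 * W) = (2 * g + 1) * W := by ring
      _ ≤ 2 ^ (2 * g + 1) * 2 ^ w := by gcongr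
  have hgW : 0 ≤ (g : ℤ) * (2 * W) := by positivity
  have hWX' : W ≤ 2 ^ ex := by linarith
  have hWM : 4 * W + 1 ≤ 2 ^ m := by
    have h1 : (2 : ℤ) ^ (w + 3) ≤ 2 ^ m := pow_le_pow_right₀ (by norm_num) (by omega)
    have h2 : (1 : ℤ) ≤ 2 ^ w := one_le_pow₀ (by norm_num)
    rw [pow_add] at h1
    linarith
  have hJ : 2 * W < 2 ^ (w + 2) := by
    have h2 : (1 : ℤ) ≤ 2 ^ w := one_le_pow₀ (by norm_num)
    rw [pow_add]
    linarith
  have hbox : ∀ x : Fin N → Fin n → ℤ, D.penalty A B x ≤ W → ∀ i k, |x i k| ≤ W :=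
    fun x hx i k => (abs_le_penalty D A B x i k).trans hx
  obtain ⟨z, hz, hmin⟩ := exists_minimizer D A B G
  have hball : 0 < (ball N n g).card := Finset.card_pos.2
    ⟨0, mem_ball_of_sum_le (by simp)⟩
  have hR : 0 < (ball N n g).card * (w + 2) := Nat.mul_pos hball (by omega)
  have hsuper : ∀ (ε : Fin N → Fin n → ℤˣ) (η : Fin N → Fin da ⊕ Fin s → ℤˣ) (δ : Fin db → ℤˣ),
      ∀ x, ∀ d ∈ cone (Matrix.fromRows A C) B ε η δ, ∀ e ∈ cone (Matrix.fromRows A C) B ε η δ,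
      G (x + d) + G (x + e) ≤ G (x + d + e) + G x := fun ε η δ x d hd e he => by
    have h1 := penalty_add_add_le D x hd he
    have h2 := value_add_add_le (C := C) D (val_add_add_le hc hf) x hd he
    have h3 : (0 : ℤ) ≤ 2 * 2 ^ m + 1 := by positivity
    have h4 := mul_le_mul_of_nonneg_left h1 h3
    simp only [hG]
    linarith
  have hgap : ∀ x y, D.penalty A B x ≤ W → G y ≤ G x →
      (∀ j : ℕ, (2 : ℤ) ^ j ≤ 2 * W → ∀ m ∈ ball N n g, G y ≤ G (x + (2 : ℤ) ^ j • m)) →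
      G x - G z ≤ (((ball N n g).card * (w + 2) : ℕ) : ℤ) * (G x - G y) :=
    fun x y hx hyx hall => gap_le (hg N) hsuper hJ (fun i k => by
      have := hbox x hx i k
      have := hbox z hz i k
      linarith [abs_sub (z i k) (x i k)]) hyx hall
  have hK : G 0 - G z < 2 ^ (m + w + 4) := by
    have h1 := abs_le.1 (hval 0 fun i k => by simp)
    have h2 := abs_le.1 (hval z fun i k => (hbox z hz i k).trans hWX')
    have h3 : 0 ≤ D.penalty A B z := by
      simp only [Data.penalty, Data.qblk]; positivity
    have h4 : (1 : ℤ) ≤ 2 ^ m := one_le_pow₀ (by norm_num)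
    have h5 : (1 : ℤ) ≤ 2 ^ w := one_le_pow₀ (by norm_num)
    have h6 : (2 * 2 ^ m + 1) * W ≤ (2 * 2 ^ m + 1) * (2 : ℤ) ^ w :=
      mul_le_mul_of_nonneg_left hW (by positivity)
    have h7 : 0 ≤ (2 * 2 ^ m + 1) * D.penalty A B z := mul_nonneg (by positivity) h3
    rw [pow_add, pow_add]
    simp only [hG]
    nlinarith
  have hdata : Ok D (2 ^ m) D.init := by
    have hp : (2 : ℤ) ^ Z ≤ 2 ^ m := pow_le_pow_right₀ (by norm_num) (by omega)
    refine D.ok_init ?_ (fun k => ?_) (fun i k => ?_) (fun i k => ?_) fun i k => ?_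
    · exact le_trans (by exact_mod_cast hNZ) ((natCast_le_two_pow Z).trans hp)
    · exact (abs_lt_of_intSize_le ((D.intSize_b0_le k).trans hZ)).trans hp
    · exact (abs_lt_of_intSize_le ((D.intSize_b_le i k).trans hZ)).trans hp
    · exact (abs_lt_of_intSize_le ((D.intSize_u_le i k).trans hZ)).trans hp
    · exact (abs_lt_of_intSize_le ((D.intSize_c_le i k).trans hZ)).trans hp
  obtain ⟨t, σ, hexec, htime, hpen, hopt, hres⟩ := runs_main hs hWdef.symm hWX hWM hJ hR hmin hgap
    (mul_pow_lt_pow hR hK) hdata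
  refine ⟨t, σ, hexec, htime.trans (Nat.mul_le_mul_left _ (Nat.mul_le_mul
    (Nat.add_le_add_right (Nat.mul_le_mul_right _ (Nat.mul_le_mul_right _
      ((card_ball_le N n g).trans (Nat.pow_le_pow_left (by gcongr) g)))) 2)
    (Nat.mul_le_mul_left _ (Nat.mul_le_mul_right _ (Nat.pow_le_pow_left (by gcongr) _))))), ?_⟩
  have hfeas : ∀ x, D.Feasible A B x → D.penalty A B x ≤ W := fun x hx => by
    rw [penalty_eq_of_feasible hx]; exact sum_le_penalty D A B 0
  rcases hres with ⟨h0, hlt⟩ | ⟨h1, hle⟩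
  -- A feasible vector would have penalty `∑ u`, and the penalty of a minimiser of `G` cannot exceed
  -- it.
  · refine Or.inr ⟨h0, fun x hx => ?_⟩
    have h2 := hs.penalty_le (fun i k => (hbox x (hfeas x hx) i k).trans hWX')
      (fun i k => (hbox _ hpen i k).trans hWX') (hopt.trans_le (hmin x (hfeas x hx)))
    rw [penalty_eq_of_feasible hx] at h2
    linarith
  · have hf' := feasible_of_penalty_le hle
    refine Or.inl ⟨h1, hf', fun x hx => ?_⟩
    rw [objective_eq_value D _ hf, objective_eq_value D _ hf]
    have h2 := hopt.trans_le (hmin x (hfeas x hx))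
    -- All feasible vectors have the same penalty, so on them `G` orders by the objective.
    simp only [hG, penalty_eq_of_feasible hx, penalty_eq_of_feasible hf'] at h2
    exact_mod_cast (by linarith : D.value C O (σ.output N n) ≤ D.value C O x)
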